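/- **Environments.** Fix $\rho\in(0,1)$. Let $\eta=(\eta_t(x))_{t\in\mathbb R,\,x\in\mathbb Z}$ be one of the following two stationary particle systems of density parameter $\rho$. * *Simple symmetric exclusion process* with rate $\gamma>0$: $(\eta_0(x))_{x\in\mathbb Z}$ are i.i.d. Bernoulli variables of mean $\rho$; independently, each edge $\{x,x+1\}$ of $\mathbb Z$ carries an independent Poisson process on $\mathbb R$ of rate $\gamma$, and at each of its arrivals the contents of the sites $x$ and $x+1$ are exchanged. * *Poisson cloud of random walks* with parameter $q\in(0,1)$: $(\eta_0(x))_{x\in\mathbb Z}$ are i.i.d. Poisson variables of parameter $-\ln(1-\rho)$; the particles move independently as lazy discrete-time walks whose steps, made between consecutive integer times, are $-1,0,1$ with probabilities $\frac{1-q}2,q,\frac{1-q}2$; $\eta_t(x)$ is the number of particles at $x$ at time $\lfloor t\rfloor$. (For negative times the independent steps are used backwards from time $0$.) **Walks.** Let $0<p_\circ\le p_\bullet<1$, let $\mathbb L_d=(2\mathbb Z)^2\cup((1,1)+(2\mathbb Z)^2)$, and let $(U_w)_{w\in\mathbb L_d}$ be i.i.d. uniform on $[0,1]$, independent of $\eta$.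 Write points of $\mathbb R^2$ as $w=(x,t)$ (space, time), with $\pi_1(w)=x$. For $w=(x,n)\in\mathbb L_d$, the walk $X^w$ has $X^w_0=x$, and at each integer time $m$ at which it is at a site $z$ it jumps to $z+1$ if $U_{(z,m)}\le p$ and to $z-1$ otherwise, where $p=p_\bullet$ if $\eta_m(z)>0$ and $p=p_\circ$ if $\eta_m(z)=0$; thus $X^w_k$ is its position at time $n+k$, and $X^w_s$ is defined for real $s\ge0$ by linear interpolation. Let $\mathbb L=\{u+s(\pm1,1):u\in\mathbb L_d,\ 0\le s<1\}$. From $w\in\mathbb L\setminus\mathbb L_d$, the walk follows the segment of $\mathbb L$ containing $w$ upwards in time until it reaches $\mathbb L_d$, and then follows the walk started there; from $w\in\mathbb R^2\setminus\mathbb L$, it stays at $\pi_1(w)$ until its space-time trajectory reaches $\mathbb L$, and then follows the walk started there. Let $\mathbb P^\rho$ be the joint law of $\eta$ and $(U_w)$. **Speeds.** For $H\ge 0$ and $v\in\mathbb R$ let $$p_H(v)=\sup_{w\in\mathbb R^2}\mathbb P^\rho\big(\exists\, y\in w+[0,H)\times\{0\}:\ X^y_H-\pi_1(y)\ge vH\big),$$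 $$\tilde p_H(v)=\sup_{w\in\mathbb R^2}\mathbb P^\rho\big(\exists\, y\in w+[0,H)\times\{0\}:\ X^y_H-\pi_1(y)\le vH\big),$$ and $$v_+=\inf\{v\in\mathbb R:\liminf_{H\to\infty}p_H(v)=0\},\qquad v_-=\sup\{v\in\mathbb R:\liminf_{H\to\infty}\tilde p_H(v)=0\}.$$ **Lemma.** For either environment, every $\rho\in(0,1)$ and all $0<p_\circ\le p_\bullet<1$: for every $\epsilon>0$ there is a constant $c\in(0,\infty)$ (depending on $\epsilon$, $\rho$ and the fixed parameters of the environment and of the walk) such that, for every real $H\ge1$, $$p_H\big(\max(v_+,0)+\epsilon\big)\le c\,\exp\big(-2(\ln H)^{3/2}\big),\qquad \tilde p_H\big(\min(v_-,0)-\epsilon\big)\le c\,\exp\big(-2(\ln H)^{3/2}\big).$$ -/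

import Mathlib

open MeasureTheory ProbabilityTheory Filter Topology
open scoped ENNReal NNReal

noncomputable section

namespace DynRW

/-! ### Dynamic random environments

An environment configuration is a function `η : ℝ → ℤ → ℕ∞`, where `η t x` is the number of particles
at the site `x` at time `t`. Both environments are the stationary ones, run for all real times. -/

/-- A random environment: a sample space with its law, and the particle numbers as a function of the
sample. Only the two concrete environments built below are ever used. -/
structure RandomEnv where
  Ω : Type
  [mΩ : MeasurableSpace Ω]
  law : Measure Ω
  field : Ω → ℝ → ℤ → ℕ∞

attribute [instance] RandomEnv.mΩ

/-! #### The simple symmetric exclusion process -/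

/-- The Bernoulli law of parameter `ρ` (meant for `0 ≤ ρ ≤ 1`); `true` stands for a particle. -/
def coinLaw (ρ : ℝ) : Measure Bool :=
  ENNReal.ofReal ρ • Measure.dirac true + ENNReal.ofReal (1 - ρ) • Measure.dirac false

/-- Sample space: the configuration at time `0`, and for every edge `{x, x + 1}` the successive
waiting times of its Poisson clock, forwards (`true`) and backwards (`false`) from time `0`. -/
abbrev SSEPSample : Type := (ℤ → Bool) × (ℤ × Bool × ℕ → ℝ)

/-- Independent Bernoulli variables of mean `ρ`, and independent of them i.i.d. exponential waiting
times of rate `γ`, so that the clocks below are independent Poisson processes on `ℝ` of rate `γ`. -/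
def ssepLaw (ρ γ : ℝ) : Measure SSEPSample :=
  (Measure.infinitePi fun _ : ℤ => coinLaw ρ).prod
    (Measure.infinitePi fun _ : ℤ × Bool × ℕ => expMeasure γ)

/-- The set of all arrival times of the Poisson process attached to the edge `{x, x + 1}`. -/
def arrivals (τ : ℤ × Bool × ℕ → ℝ) (x : ℤ) : Set ℝ :=
  {t | ∃ n : ℕ, t = ∑ i ∈ Finset.range (n + 1), τ (x, true, i)} ∪
    {t | ∃ n : ℕ, t = -∑ i ∈ Finset.range (n + 1), τ (x, false, i)}

/-- What the arrivals at time `s` do to the content of the site `y`: it is moved to the site `z`,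
that is, across the edge `{y, y + 1}` or `{y - 1, y}` if that edge rings, and nowhere otherwise. -/
def Exchange (T : ℤ → Set ℝ) (s : ℝ) (y z : ℤ) : Prop :=
  (s ∈ T y ∧ z = y + 1) ∨ (s ∈ T (y - 1) ∧ z = y - 1) ∨ (s ∉ T y ∧ s ∉ T (y - 1) ∧ z = y)

/-- A càdlàg trajectory in `ℤ` which at every arrival at an adjacent edge moves across that edge, and
which does not move otherwise: the trajectory of the content of a site when, at each arrival at the
edge `{x, x + 1}`, the contents of `x` and `x + 1` are exchanged. -/
def IsStirringPath (T : ℤ → Set ℝ) (path : ℝ → ℤ) : Prop :=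
  ∀ s : ℝ, (∃ y : ℤ, (∀ᶠ r in 𝓝[<] s, path r = y) ∧ Exchange T s y (path s)) ∧
    ∀ᶠ r in 𝓝[>] s, path r = path s

open Classical in
/-- The exclusion process: there is a particle at `x` at time `t` if and only if the content of `x`
at time `t` was brought there by the exchanges from an occupied site of the configuration at time
`0`. (Almost surely, exactly one stirring path is at `x` at time `t`.) -/
def ssepField (ω : SSEPSample) (t : ℝ) (x : ℤ) : ℕ∞ :=
  if ∃ path, IsStirringPath (arrivals ω.2) path ∧ path t = x ∧ ω.1 (path 0) = true then 1 else 0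

/-- The simple symmetric exclusion process of density `ρ` and rate `γ`. -/
def ssep (ρ γ : ℝ) : RandomEnv where
  Ω := SSEPSample
  law := ssepLaw ρ γ
  field := ssepField

/-! #### The Poisson cloud of independent lazy random walks -/

/-- The law of a step of a lazy walk: `-1, 0, 1` with probabilities `(1-q)/2, q, (1-q)/2`. -/
def stepLaw (q : ℝ) : Measure ℤ :=
  ENNReal.ofReal ((1 - q) / 2) • Measure.dirac (-1) + ENNReal.ofReal q • Measure.dirac 0 +
    ENNReal.ofReal ((1 - q) / 2) • Measure.dirac 1

/-- Sample space: the numbers of particles at time `0`, and for the `i`-th particle of the site `x`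
its step between the times `j` and `j + 1`, at the index `(x, i, j)`. -/
abbrev PCRWSample : Type := (ℤ → ℕ) × (ℤ × ℕ × ℤ → ℤ)

/-- Independent Poisson variables of parameter `-ln (1 - ρ)`, and independent i.i.d. lazy steps. -/
def pcrwLaw (ρ q : ℝ) : Measure PCRWSample :=
  (Measure.infinitePi fun _ : ℤ => poissonMeasure (-Real.log (1 - ρ)).toNNReal).prod
    (Measure.infinitePi fun _ : ℤ × ℕ × ℤ => stepLaw q)

/-- The position at time `t` of the `i`-th particle which is at `x` at time `0`. Of the two sums one
is empty: for `t < 0` the steps made between the times `⌊t⌋` and `0` are undone. -/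
def particle (ξ : ℤ × ℕ × ℤ → ℤ) (x : ℤ) (i : ℕ) (t : ℝ) : ℤ :=
  x + ∑ j ∈ Finset.Ico 0 ⌊t⌋, ξ (x, i, j) - ∑ j ∈ Finset.Ico ⌊t⌋ 0, ξ (x, i, j)

/-- The number of particles at the site `y` at time `t`. -/
def pcrwField (ω : PCRWSample) (t : ℝ) (y : ℤ) : ℕ∞ :=
  {a : ℤ × ℕ | a.2 < ω.1 a.1 ∧ particle ω.2 a.1 a.2 t = y}.encard

/-- The Poisson cloud of random walks of density parameter `ρ` and laziness `q`. -/
def pcrw (ρ q : ℝ) : RandomEnv where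
  Ω := PCRWSample
  law := pcrwLaw ρ q
  field := pcrwField

/-! #### Both models -/

/-- The choice of the environment with its fixed parameter: the exclusion process with jump rate
`γ > 0`, or the Poisson cloud of random walks with laziness `q ∈ (0, 1)`. -/
inductive EnvModel where
  | exclusion (γ : ℝ) (hγ : 0 < γ)
  | cloud (q : ℝ) (hq0 : 0 < q) (hq1 : q < 1)

/-- The environment of density `ρ`. -/
def EnvModel.env (ρ : ℝ) : EnvModel → RandomEnv
  | .exclusion γ _ => ssep ρ γ
  | .cloud q _ _ => pcrw ρ q

/-! ### The coupled walks

`η` is a realization of the environment, `U` one of the uniform variables, indexed by `ℤ × ℤ` (those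
at the points `(x, n)` with `x + n` odd are never used for the walks in the plane); `pb` and `pw` are
the probabilities to jump to the right from an occupied and from a vacant site. -/

section Walk

variable (η : ℝ → ℤ → ℕ∞) (U : ℤ × ℤ → unitInterval) (pb pw : ℝ)

open Classical in
/-- The position after one step of the walk which is at `x` at the integer time `n`. -/
def jump (x n : ℤ) : ℤ :=
  if 0 < η n x then
    x + 2 * (if (U (x, n) : ℝ) ≤ pb then 1 else 0) - 1
  else
    x + 2 * (if (U (x, n) : ℝ) ≤ pw then 1 else 0) - 1

/-- The position after `m` steps of the walk started from the space-time point `(x, n)`. -/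
def discreteWalk (x n : ℤ) : ℕ → ℤ
  | 0 => x
  | m + 1 => jump η U pb pw (discreteWalk x n m) (n + m)

/-- The discrete space-time lattice `(2ℤ)² ∪ ((1,1) + (2ℤ)²)`. -/
def latticeD : Set (ℝ × ℝ) :=
  {w | ∃ i j : ℤ, w = (2 * (i : ℝ), 2 * (j : ℝ)) ∨ w = (1 + 2 * (i : ℝ), 1 + 2 * (j : ℝ))}

/-- The union of the segments from the points of the discrete lattice to their two successors. -/
def latticeC : Set (ℝ × ℝ) :=
  {w | ∃ u ∈ latticeD, ∃ t : ℝ, 0 ≤ t ∧ t < 1 ∧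
    (w = (u.1 + t, u.2 + t) ∨ w = (u.1 - t, u.2 + t))}

/-- The walk started from a point `w` of the discrete lattice, interpolated linearly in time. -/
def walkD (w : ℝ × ℝ) (t : ℝ) : ℝ :=
  let X : ℕ → ℤ := discreteWalk η U pb pw ⌊w.1⌋ ⌊w.2⌋
  X ⌊t⌋₊ + (t - ⌊t⌋₊) * ((X (⌊t⌋₊ + 1) : ℝ) - X ⌊t⌋₊)

open Classical in
/-- The walk started from a point `w` of the continuous lattice: it follows the segment on which `w`
lies up to the discrete lattice, and from there on the corresponding walk. -/
def walkC (w : ℝ × ℝ) (t : ℝ) : ℝ :=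
  if w ∈ latticeD then walkD η U pb pw w t
  else
    let σ : ℝ := (-1) ^ (⌊w.1⌋ + ⌊w.2⌋)
    let t₀ : ℝ := sInf {s : ℝ | 0 ≤ s ∧ (w.1 + s * σ, w.2 + s) ∈ latticeD}
    if t < t₀ then w.1 + σ * t else walkD η U pb pw (w.1 + t₀ * σ, w.2 + t₀) (t - t₀)

open Classical in
/-- The walk `X^w` started from an arbitrary space-time point `w`, after the time `t ≥ 0`: it stays
where it is until it hits the continuous lattice, and follows the corresponding walk from there. -/
def walk (w : ℝ × ℝ) (t : ℝ) : ℝ :=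
  let s₀ : ℝ := sInf {s : ℝ | 0 ≤ s ∧ (w.1, w.2 + s) ∈ latticeC}
  if t < s₀ then w.1 else walkC η U pb pw (w.1, w.2 + s₀) (t - s₀)

end Walk

/-! ### The annealed law, deviation probabilities, and upper and lower speeds -/

/-- The joint law of the environment and of independent i.i.d. uniform variables on `[0, 1]`. -/
def annealed (E : RandomEnv) : Measure (E.Ω × (ℤ × ℤ → unitInterval)) :=
  E.law.prod (Measure.infinitePi fun _ : ℤ × ℤ => (volume : Measure unitInterval))

/-- The event that some walk started in `w + [0, H) × {0}` has average speed at least `v` over the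
time `H`. -/
def fastEvent (E : RandomEnv) (pb pw H : ℝ) (w : ℝ × ℝ) (v : ℝ) :
    Set (E.Ω × (ℤ × ℤ → unitInterval)) :=
  {ω | ∃ y : ℝ × ℝ, w.1 ≤ y.1 ∧ y.1 < w.1 + H ∧ y.2 = w.2 ∧
    walk (E.field ω.1) ω.2 pb pw y H - y.1 ≥ v * H}

/-- The event that some walk started in `w + [0, H) × {0}` has average speed at most `v` over the
time `H`. -/
def slowEvent (E : RandomEnv) (pb pw H : ℝ) (w : ℝ × ℝ) (v : ℝ) :
    Set (E.Ω × (ℤ × ℤ → unitInterval)) :=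
  {ω | ∃ y : ℝ × ℝ, w.1 ≤ y.1 ∧ y.1 < w.1 + H ∧ y.2 = w.2 ∧
    walk (E.field ω.1) ω.2 pb pw y H - y.1 ≤ v * H}

/-- The supremum over `w ∈ ℝ²` of the probabilities of the fast events. -/
def fastProb (E : RandomEnv) (pb pw H v : ℝ) : ℝ≥0∞ :=
  ⨆ w : ℝ × ℝ, annealed E (fastEvent E pb pw H w v)

/-- The supremum over `w ∈ ℝ²` of the probabilities of the slow events. -/
def slowProb (E : RandomEnv) (pb pw H v : ℝ) : ℝ≥0∞ :=
  ⨆ w : ℝ × ℝ, annealed E (slowEvent E pb pw H w v)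

/-- The upper speed. -/
def upperSpeed (E : RandomEnv) (pb pw : ℝ) : ℝ :=
  sInf {v : ℝ | liminf (fun H : ℝ => fastProb E pb pw H v) atTop = 0}

/-- The lower speed. -/
def lowerSpeed (E : RandomEnv) (pb pw : ℝ) : ℝ :=
  sSup {v : ℝ | liminf (fun H : ℝ => slowProb E pb pw H v) atTop = 0}

/-! ### The laws are probability measures -/

theorem isProbabilityMeasure_coinLaw {ρ : ℝ} (h0 : 0 < ρ) (h1 : ρ < 1) :
    IsProbabilityMeasure (coinLaw ρ) where
  measure_univ := by
    simp only [coinLaw, Measure.coe_add, Measure.coe_smul, Pi.add_apply, Pi.smul_apply,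
      measure_univ, smul_eq_mul, mul_one]
    rw [← ENNReal.ofReal_add h0.le (by linarith)]
    simp

theorem isProbabilityMeasure_stepLaw {q : ℝ} (h0 : 0 < q) (h1 : q < 1) :
    IsProbabilityMeasure (stepLaw q) where
  measure_univ := by
    simp only [stepLaw, Measure.coe_add, Measure.coe_smul, Pi.add_apply, Pi.smul_apply,
      measure_univ, smul_eq_mul, mul_one]
    rw [← ENNReal.ofReal_add (by linarith) h0.le, ← ENNReal.ofReal_add (by linarith) (by linarith),
      ← ENNReal.ofReal_one]
    congr 1
    ring

theorem isProbabilityMeasure_annealed (M : EnvModel) {ρ : ℝ} (h0 : 0 < ρ) (h1 : ρ < 1) :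
    IsProbabilityMeasure (annealed (M.env ρ)) := by
  have hE : IsProbabilityMeasure (M.env ρ).law := by
    cases M with
    | exclusion γ hγ =>
      have := isProbabilityMeasure_coinLaw h0 h1
      have := isProbabilityMeasure_expMeasure hγ
      change IsProbabilityMeasure (ssepLaw ρ γ)
      unfold ssepLaw
      infer_instance
    | cloud q hq0 hq1 =>
      have := isProbabilityMeasure_stepLaw hq0 hq1
      change IsProbabilityMeasure (pcrwLaw ρ q)
      unfold pcrwLaw
      infer_instance
  unfold annealed
  infer_instance

end DynRW

end

/-! All walks follow one random Boolean field of arrows, and the two bounds are the same statement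
about this field, read in the direction `s = 1` or `s = -1`. Let q_n(v) be the supremum, over
starting intervals of length n, of the probability that some walk from the interval has speed at
least v over the time n (`fastSup`).

The probabilistic input is `Decoupled`: for v > 0, what happens in two boxes of side of order n,
inside a time slab of length T and at horizontal distance at least v T, is independent up to an
error C exp(-c n). The reason is that the environment moves diffusively, so within time T
information rarely travels as far as v T.

The rest is a renormalisation. If a walk has speed at least v + 6/l over the time l n, cut the time
into l blocks and consider the first and the last block of speed at least v. Outside the stretch
between them the walk never beats v, so on that stretch it gains v times the elapsed time plus 6 n.
Hence the two fast blocks lie in boxes whose horizontal distance exceeds v times the elapsed time,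
and they decouple although nothing separates them in time (`exists_first_last_fast`,
`fastArrows_mul_subset`). A union bound gives q_{ln}(v + 6/l) ≤ 9 l⁴ (q_n(v)² + C exp(-c n))
(`fastSup_mul_le`). With scale ratios 2^(K+k) the speed increases in total by at most 12/2^K, while
the probability at the k-th scale falls below exp(-(3/2)^k), once it is small enough at one
sufficiently large initial scale (`exists_scale_decay`). The definition of the upper speed supplies
such scales for every speed above it, and decoupling requires the speed to be positive, whence the
maximum with 0. The logarithm of the k-th scale is of order k², so (ln H)^(3/2) is of order k³ and
loses against (3/2)^k. A pigeonhole argument covers the times between the scales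
(`exists_fast_decay`), and `devProb_le_of_decoupled` returns to the walks in the plane.

Decoupling of the exclusion process (`decoupled_ssep`): on a time mesh in which only isolated rings
act, the content of a site performs a lazy random walk backwards in time. By stationarity these
trajectories need only be followed to the beginning of the slab. Unless one of them comes close to a
cut between the boxes, the two boxes use disjoint sets of independent variables. A Chernoff bound
controls the exceptional event uniformly in the mesh, which is then refined. Decoupling of the
Poisson cloud (`decoupled_pcrw`): the particles meeting only the first box are independent of those
meeting only the second, and Hoeffding's inequality bounds the expected number of particles which
meet both. -/

noncomputable section

namespace DynRW

/-! ### Walks in a field of arrows -/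

/-- The walk which starts from the site `x` at time `t` and follows the arrows: it jumps to the right
from `(z, m)` if `a (z, m)` holds and to the left otherwise. -/
def arrowWalk (a : ℤ × ℤ → Bool) (x t : ℤ) : ℕ → ℤ
  | 0 => x
  | k + 1 => arrowWalk a x t k + if a (arrowWalk a x t k, t + k) then 1 else -1

theorem arrowWalk_add (a : ℤ × ℤ → Bool) (x t : ℤ) (k j : ℕ) :
    arrowWalk a x t (k + j) = arrowWalk a (arrowWalk a x t k) (t + k) j := by
  induction j with
  | zero => rfl
  | succ j ih =>
    rw [← add_assoc, arrowWalk, arrowWalk, ih]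
    push_cast
    rw [add_assoc]

theorem abs_arrowWalk_sub_le (a : ℤ × ℤ → Bool) (x t : ℤ) (k : ℕ) :
    |arrowWalk a x t k - x| ≤ k := by
  induction k with
  | zero => simp [arrowWalk]
  | succ k ih =>
    rw [arrowWalk]
    rw [abs_le] at ih ⊢
    push_cast
    split_ifs <;> constructor <;> linarith [ih.1, ih.2]

theorem abs_arrowWalk_add_sub_le (a : ℤ × ℤ → Bool) (x t : ℤ) (k j : ℕ) :
    |arrowWalk a x t (k + j) - arrowWalk a x t k| ≤ j := by
  rw [arrowWalk_add]
  exact abs_arrowWalk_sub_le ..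

theorem even_arrowWalk (a : ℤ × ℤ → Bool) {x t : ℤ} (h : Even (x + t)) (k : ℕ) :
    Even (arrowWalk a x t k + (t + k)) := by
  induction k with
  | zero => simpa [arrowWalk] using h
  | succ k ih =>
    rw [arrowWalk]
    push_cast
    rw [Int.even_iff] at ih ⊢
    split_ifs <;> omega

theorem arrowWalk_congr {a a' : ℤ × ℤ → Bool} {x t : ℤ} {n : ℕ}
    (h : ∀ z m : ℤ, |z - x| < n → t ≤ m → m < t + n → a (z, m) = a' (z, m)) {k : ℕ} (hk : k ≤ n) :
    arrowWalk a x t k = arrowWalk a' x t k := by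
  induction k with
  | zero => rfl
  | succ k ih =>
    have h1 := abs_arrowWalk_sub_le a x t k
    rw [arrowWalk, arrowWalk, ← ih (by omega), h _ _ (by omega) (by omega) (by omega)]

/-- The space-time box of the sites in `[x, x + 3 n)` and times in `[t, t + n)`. -/
def box (x t : ℤ) (n : ℕ) : Set (ℤ × ℤ) := {p | (x ≤ p.1 ∧ p.1 < x + 3 * n) ∧ t ≤ p.2 ∧ p.2 < t + n}

/-- Some walk started from the discrete lattice in `[x, x + n) × {t}` has in the direction `s` an
average speed of at least `v` over the time `n`. -/
def fastArrows (s : ℤ) (n : ℕ) (v : ℝ) (x t : ℤ) : Set (ℤ × ℤ → Bool) :=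
  {a | ∃ y, x ≤ y ∧ y < x + n ∧ Even (y + t) ∧ v * n ≤ s * (arrowWalk a y t n - y)}

/-- A walk started in `[x, x + n)` moves by at most `n` to either side, which is why the boxes have
width `3 n` and this one starts at `x - n`. -/
theorem dependsOn_fastArrows (s : ℤ) (n : ℕ) (v : ℝ) (x t : ℤ) :
    DependsOn (· ∈ fastArrows s n v x t) (box (x - n) t n) := by
  intro a a' h
  have key : ∀ y, x ≤ y → y < x + n → arrowWalk a y t n = arrowWalk a' y t n := by
    intro y h1 h2
    refine arrowWalk_congr (fun z m hz hm hm' => h (z, m) ?_) le_rfl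
    rw [abs_lt] at hz
    exact ⟨⟨by dsimp; linarith, by dsimp; linarith⟩, hm, hm'⟩
  apply propext
  constructor
  · rintro ⟨y, h1, h2, h3, h4⟩
    exact ⟨y, h1, h2, h3, by rwa [← key y h1 h2]⟩
  · rintro ⟨y, h1, h2, h3, h4⟩
    exact ⟨y, h1, h2, h3, by rwa [key y h1 h2]⟩

/-! ### The recursion over scales -/

section Recursion

variable {Ω : Type*} [MeasurableSpace Ω]

/-- The arrows decouple in space: events which depend on two boxes, whose times lie in an interval
of length `T` and whose horizontal distance is at least `v T`, are almost independent. -/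
def Decoupled (P : Measure Ω) (a : Ω → ℤ × ℤ → Bool) : Prop :=
  ∀ v : ℝ, 0 < v → ∃ C : ℝ, 0 < C ∧ ∃ c : ℝ, 0 < c ∧ ∀ (n T : ℕ) (x₁ x₂ t t₁ t₂ : ℤ), 1 ≤ n →
    n ≤ T → t ≤ t₁ → t₁ + n ≤ t + T → t ≤ t₂ → t₂ + n ≤ t + T →
    (x₁ + 3 * n + v * T ≤ x₂ ∨ x₂ + 3 * n + v * T ≤ x₁) →
    ∀ S₁ S₂ : Set (ℤ × ℤ → Bool), DependsOn (· ∈ S₁) (box x₁ t₁ n) →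
      DependsOn (· ∈ S₂) (box x₂ t₂ n) →
      P (a ⁻¹' S₁ ∩ a ⁻¹' S₂) ≤ P (a ⁻¹' S₁) * P (a ⁻¹' S₂) + ENNReal.ofReal (C * Real.exp (-c * n))

/-- The supremum over all starting intervals of the probability of a fast walk. -/
def fastSup (P : Measure Ω) (a : Ω → ℤ × ℤ → Bool) (s : ℤ) (n : ℕ) (v : ℝ) : ℝ≥0∞ :=
  ⨆ (x : ℤ) (t : ℤ), P (a ⁻¹' fastArrows s n v x t)

theorem le_fastSup (P : Measure Ω) (a : Ω → ℤ × ℤ → Bool) (s : ℤ) (n : ℕ) (v : ℝ) (x t : ℤ) :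
    P (a ⁻¹' fastArrows s n v x t) ≤ fastSup P a s n v :=
  le_iSup₂ (f := fun x t => P (a ⁻¹' fastArrows s n v x t)) x t

theorem fastSup_anti (P : Measure Ω) (a : Ω → ℤ × ℤ → Bool) (s : ℤ) (n : ℕ) {v v' : ℝ} (h : v ≤ v') :
    fastSup P a s n v' ≤ fastSup P a s n v := by
  refine iSup₂_mono fun x t => measure_mono ?_
  rintro ω ⟨y, h1, h2, h3, h4⟩
  exact ⟨y, h1, h2, h3, le_trans (by gcongr) h4⟩

theorem sub_le_of_slow {D : ℕ → ℝ} {w : ℝ} {i j : ℕ} (hij : i ≤ j)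
    (h : ∀ k, i ≤ k → k < j → D (k + 1) - D k ≤ w) : D j - D i ≤ (j - i : ℝ) * w := by
  induction j, hij using Nat.le_induction with
  | base => simp
  | succ j hj ih =>
    have h1 := ih fun k hk hk' => h k hk (by omega)
    have h2 := h j hj (by omega)
    push_cast
    linarith

/-- If a sequence gains more than `w` per step on average, then between its first and its last
increment of at least `w` it gains as much more than `w` per step. -/
theorem exists_first_last_fast {D : ℕ → ℝ} {w g : ℝ} {l : ℕ} (hg : 0 < g)
    (h : l * w + g ≤ D l - D 0) :
    ∃ i j, i ≤ j ∧ j < l ∧ w ≤ D (i + 1) - D i ∧ w ≤ D (j + 1) - D j ∧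
      (j - i + 1 : ℝ) * w + g ≤ D (j + 1) - D i := by
  classical
  have hne : ∃ i, i < l ∧ w ≤ D (i + 1) - D i := by
    by_contra! hcon
    have := sub_le_of_slow (D := D) (w := w) (Nat.zero_le l) fun k _ hk => (hcon k hk).le
    simp at this
    linarith
  let F := (Finset.range l).filter fun i => w ≤ D (i + 1) - D i
  have hF : F.Nonempty := by
    obtain ⟨i, h1, h2⟩ := hne
    exact ⟨i, by simp [F, h1, h2]⟩
  have hi := F.min'_mem hF
  have hj := F.max'_mem hF
  set i := F.min' hF with hidef
  set j := F.max' hF with hjdef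
  simp only [F, Finset.mem_filter, Finset.mem_range] at hi hj
  have hij : i ≤ j := F.min'_le_max' hF
  refine ⟨i, j, hij, hj.1, hi.2, hj.2, ?_⟩
  -- Before the first fast increment and after the last one every increment is below `w`, so the
  -- whole surplus `g` is gained in between.
  have h1 := sub_le_of_slow (D := D) (w := w) (Nat.zero_le i) fun k _ hk => by
    by_contra! hcon
    exact absurd (F.min'_le k (by simp [F]; exact ⟨by omega, hcon.le⟩)) (by omega)
  have h2 := sub_le_of_slow (D := D) (w := w) (show j + 1 ≤ l by omega) fun k hk hk' => by
    by_contra! hcon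
    exact absurd (F.le_max' k (by simp [F]; exact ⟨by omega, hcon.le⟩)) (by omega)
  push_cast at h1 h2
  linarith

/-- Rounding the current position down to the grid `x + n ℤ` leaves only finitely many starting
intervals for the later union bounds. -/
theorem mem_fastArrows_of_increment {a : ℤ × ℤ → Bool} {s : ℤ} {n : ℕ} {v : ℝ} {x t y : ℤ} {i : ℕ}
    (hn : 1 ≤ n) (hy : Even (y + t))
    (h : v * n ≤ s * (arrowWalk a y t ((i + 1) * n) : ℝ) - s * (arrowWalk a y t (i * n) : ℝ)) :
    a ∈ fastArrows s n v (x + (arrowWalk a y t (i * n) - x) / n * n) (t + i * n) := by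
  have hn' : (0 : ℤ) < n := by exact_mod_cast hn
  refine ⟨arrowWalk a y t (i * n), ?_, ?_, ?_, ?_⟩
  · have := Int.ediv_mul_le (arrowWalk a y t (i * n) - x) hn'.ne'
    linarith
  · have := Int.lt_ediv_add_one_mul_self (arrowWalk a y t (i * n) - x) hn'
    linarith
  · have := even_arrowWalk a hy (i * n)
    push_cast at this
    exact this
  · rw [add_mul, one_mul, arrowWalk_add] at h
    push_cast at h
    linarith

/-- The geometric core. Of the surplus `6 n`, a part `n` pays for the increment of the last fast
block itself, `n` for rounding to the grid and `3 n` for the width of a box; one `n` is spare. The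
sign `s` decides which of the two boxes is on the left. -/
theorem fastArrows_mul_subset {s : ℤ} (hs : s = 1 ∨ s = -1) {n l : ℕ} (hn : 1 ≤ n) (hl : 1 ≤ l) {v : ℝ}
    (x t : ℤ) {a : ℤ × ℤ → Bool} (ha : a ∈ fastArrows s (l * n) (v + 6 / l) x t) :
    ∃ i j b b' : ℤ, (0 ≤ i ∧ i ≤ j ∧ j < l) ∧ (-l ≤ b ∧ b < 2 * l) ∧ (-l ≤ b' ∧ b' < 2 * l) ∧
      (((x + b * n - n : ℤ) : ℝ) + 3 * n + v * ((j - i + 1) * n) ≤ ((x + b' * n - n : ℤ) : ℝ) ∨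
       ((x + b' * n - n : ℤ) : ℝ) + 3 * n + v * ((j - i + 1) * n) ≤ ((x + b * n - n : ℤ) : ℝ)) ∧
      a ∈ fastArrows s n v (x + b * n) (t + i * n) ∧ a ∈ fastArrows s n v (x + b' * n) (t + j * n) := by
  obtain ⟨y, h1, h2, h3, h4⟩ := ha
  have hn' : (0 : ℤ) < n := by exact_mod_cast hn
  have hl0 : (0 : ℝ) < l := by exact_mod_cast hl
  have hn0 : (0 : ℝ) < n := by exact_mod_cast hn
  obtain ⟨i, j, hij, hjl, hi, hj, hgap⟩ := exists_first_last_fast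
    (D := fun i => s * (arrowWalk a y t (i * n) : ℝ)) (w := v * n) (g := 6 * n) (l := l)
    (by positivity) (by
      simp only [zero_mul, arrowWalk]
      have : (v + 6 / l) * ((l * n : ℕ) : ℝ) = l * (v * n) + 6 * n := by
        push_cast; field_simp
      linarith)
  -- The start lies in `[x, x + l n)` and the walk moves by at most `l n`, so `3 l` cells of width
  -- `n` suffice.
  have hbox : ∀ k, k < l → -(l : ℤ) ≤ (arrowWalk a y t (k * n) - x) / n ∧
      (arrowWalk a y t (k * n) - x) / n < 2 * l := by
    intro k hk
    have hd := abs_le.1 (abs_arrowWalk_sub_le a y t (k * n))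
    have hkn : k * n ≤ l * n := Nat.mul_le_mul_right _ hk.le
    zify at hkn hd h2
    constructor
    · rw [Int.le_ediv_iff_mul_le hn']
      linarith [hd.1]
    · rw [Int.ediv_lt_iff_lt_mul hn']
      linarith [hd.2]
  refine ⟨i, j, (arrowWalk a y t (i * n) - x) / n, (arrowWalk a y t (j * n) - x) / n,
    ⟨by positivity, by exact_mod_cast hij, by exact_mod_cast hjl⟩, hbox i (by omega), hbox j hjl, ?_,
    mem_fastArrows_of_increment hn h3 hi, mem_fastArrows_of_increment hn h3 hj⟩
  have e1 : (((arrowWalk a y t (i * n) - x) / n * n : ℤ) : ℝ) ≤ ((arrowWalk a y t (i * n) - x : ℤ) : ℝ) := by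
    exact_mod_cast Int.ediv_mul_le (arrowWalk a y t (i * n) - x) hn'.ne'
  have e2 : ((arrowWalk a y t (i * n) - x : ℤ) : ℝ) ≤ (((arrowWalk a y t (i * n) - x) / n * n : ℤ) : ℝ) + n := by
    exact_mod_cast (by linarith [Int.lt_ediv_add_one_mul_self (arrowWalk a y t (i * n) - x) hn'] :
      arrowWalk a y t (i * n) - x ≤ (arrowWalk a y t (i * n) - x) / n * n + n)
  have e3 : (((arrowWalk a y t (j * n) - x) / n * n : ℤ) : ℝ) ≤ ((arrowWalk a y t (j * n) - x : ℤ) : ℝ) := by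
    exact_mod_cast Int.ediv_mul_le (arrowWalk a y t (j * n) - x) hn'.ne'
  have e4 : ((arrowWalk a y t (j * n) - x : ℤ) : ℝ) ≤ (((arrowWalk a y t (j * n) - x) / n * n : ℤ) : ℝ) + n := by
    exact_mod_cast (by linarith [Int.lt_ediv_add_one_mul_self (arrowWalk a y t (j * n) - x) hn'] :
      arrowWalk a y t (j * n) - x ≤ (arrowWalk a y t (j * n) - x) / n * n + n)
  have e5 : |(arrowWalk a y t (j * n + n) : ℝ) - arrowWalk a y t (j * n)| ≤ n := by
    exact_mod_cast abs_arrowWalk_add_sub_le a y t (j * n) n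
  rw [abs_le] at e5
  simp only [add_mul, one_mul] at hgap
  push_cast at e1 e2 e3 e4 hgap ⊢
  rcases hs with rfl | rfl
  · left
    push_cast at hgap
    linarith [e5.1, e5.2]
  · right
    push_cast at hgap
    linarith [e5.1, e5.2]

/-- Union bound over the two block indices (`l ^ 2` choices) and the two grid cells (`9 l ^ 2`
choices), with decoupling for the slab of length `(j - i + 1) n`. As `v₀ ≤ v`, separation at speed
`v` implies separation at speed `v₀`, so the same constants `C, c` serve at every scale although the
speed increases. -/
theorem fastSup_mul_le {P : Measure Ω} {a : Ω → ℤ × ℤ → Bool} {s : ℤ} (hs : s = 1 ∨ s = -1)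
    {v₀ v C c : ℝ} (hv : v₀ ≤ v)
    (hdec : ∀ (n T : ℕ) (x₁ x₂ t t₁ t₂ : ℤ), 1 ≤ n →
      n ≤ T → t ≤ t₁ → t₁ + n ≤ t + T → t ≤ t₂ → t₂ + n ≤ t + T →
      (x₁ + 3 * n + v₀ * T ≤ x₂ ∨ x₂ + 3 * n + v₀ * T ≤ x₁) →
      ∀ S₁ S₂ : Set (ℤ × ℤ → Bool), DependsOn (· ∈ S₁) (box x₁ t₁ n) →
        DependsOn (· ∈ S₂) (box x₂ t₂ n) →
        P (a ⁻¹' S₁ ∩ a ⁻¹' S₂)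
          ≤ P (a ⁻¹' S₁) * P (a ⁻¹' S₂) + ENNReal.ofReal (C * Real.exp (-c * n)))
    {n l : ℕ} (hn : 1 ≤ n) (hl : 1 ≤ l) :
    fastSup P a s (l * n) (v + 6 / l)
      ≤ 9 * l ^ 4 * (fastSup P a s n v ^ 2 + ENNReal.ofReal (C * Real.exp (-c * n))) := by
  classical
  refine iSup₂_le fun x t => ?_
  let I : Finset ((ℤ × ℤ) × (ℤ × ℤ)) :=
    (((Finset.Ico 0 (l : ℤ)) ×ˢ (Finset.Ico 0 (l : ℤ))) ×ˢ
      ((Finset.Ico (-(l : ℤ)) (2 * l)) ×ˢ (Finset.Ico (-(l : ℤ)) (2 * l))))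
  let E : (ℤ × ℤ) × (ℤ × ℤ) → Set Ω := fun q =>
    {ω | (q.1.1 ≤ q.1.2 ∧
      (((x + q.2.1 * n - n : ℤ) : ℝ) + 3 * n + v * ((q.1.2 - q.1.1 + 1) * n) ≤ ((x + q.2.2 * n - n : ℤ) : ℝ) ∨
       ((x + q.2.2 * n - n : ℤ) : ℝ) + 3 * n + v * ((q.1.2 - q.1.1 + 1) * n) ≤ ((x + q.2.1 * n - n : ℤ) : ℝ))) ∧
      a ω ∈ fastArrows s n v (x + q.2.1 * n) (t + q.1.1 * n) ∧
      a ω ∈ fastArrows s n v (x + q.2.2 * n) (t + q.1.2 * n)}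
  have hsub : a ⁻¹' fastArrows s (l * n) (v + 6 / l) x t ⊆ ⋃ q ∈ I, E q := by
    intro ω hω
    obtain ⟨i, j, b, b', hij, hb, hb', hg, h1, h2⟩ := fastArrows_mul_subset hs hn hl x t hω
    simp only [Set.mem_iUnion]
    refine ⟨((i, j), (b, b')), ?_, ⟨hij.2.1, hg⟩, h1, h2⟩
    simp only [I, Finset.mem_product, Finset.mem_Ico]
    refine ⟨⟨⟨?_, ?_⟩, ?_, ?_⟩, hb, hb'⟩ <;> omega
  have hE : ∀ q ∈ I, P (E q) ≤ fastSup P a s n v ^ 2 + ENNReal.ofReal (C * Real.exp (-c * n)) := by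
    rintro ⟨⟨i, j⟩, b, b'⟩ hq
    simp only [I, Finset.mem_product, Finset.mem_Ico] at hq
    by_cases hc : (i ≤ j ∧
      (((x + b * n - n : ℤ) : ℝ) + 3 * n + v * ((j - i + 1) * n) ≤ ((x + b' * n - n : ℤ) : ℝ) ∨
       ((x + b' * n - n : ℤ) : ℝ) + 3 * n + v * ((j - i + 1) * n) ≤ ((x + b * n - n : ℤ) : ℝ)))
    · obtain ⟨hij, hg⟩ := hc
      have hT : (((j - i + 1).toNat * n : ℕ) : ℤ) = (j - i + 1) * n := by
        push_cast; rw [Int.toNat_of_nonneg (by omega)]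
      have hT' : (((j - i + 1).toNat * n : ℕ) : ℝ) = (j - i + 1) * n := by exact_mod_cast hT
      have hvT : v₀ * ((j - i + 1) * n : ℝ) ≤ v * ((j - i + 1) * n) := by
        rw [← hT']; gcongr
      have hin : (i : ℤ) * n ≤ j * n := by gcongr
      calc P (E ((i, j), (b, b')))
          ≤ P (a ⁻¹' fastArrows s n v (x + b * n) (t + i * n) ∩
              a ⁻¹' fastArrows s n v (x + b' * n) (t + j * n)) :=
            measure_mono fun ω hω => ⟨hω.2.1, hω.2.2⟩
        _ ≤ P (a ⁻¹' fastArrows s n v (x + b * n) (t + i * n)) *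
              P (a ⁻¹' fastArrows s n v (x + b' * n) (t + j * n)) +
              ENNReal.ofReal (C * Real.exp (-c * n)) := by
            refine hdec n ((j - i + 1).toNat * n) _ _ (t + i * n) _ _ hn ?_ le_rfl ?_ ?_ ?_ ?_ _ _
              (dependsOn_fastArrows ..) (dependsOn_fastArrows ..)
            · exact Nat.le_mul_of_pos_left _ (by omega)
            · rw [hT]; linarith
            · linarith
            · rw [hT]; linarith
            · rw [hT']
              exact hg.imp (fun h => by linarith) (fun h => by linarith)
        _ ≤ _ := by
            rw [sq]
            gcongr <;> exact le_fastSup ..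
    · have : E ((i, j), (b, b')) = ∅ := by
        ext ω
        simp only [E, Set.mem_ofPred_eq, Set.mem_empty_iff_false, iff_false]
        exact fun h => hc h.1
      rw [this]
      simp
  calc P (a ⁻¹' fastArrows s (l * n) (v + 6 / l) x t) ≤ P (⋃ q ∈ I, E q) := measure_mono hsub
    _ ≤ ∑ q ∈ I, P (E q) := measure_biUnion_finset_le _ _
    _ ≤ ∑ q ∈ I, (fastSup P a s n v ^ 2 + ENNReal.ofReal (C * Real.exp (-c * n))) :=
        Finset.sum_le_sum hE
    _ = _ := by
        rw [Finset.sum_const, nsmul_eq_mul]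
        congr 1
        have : I.card = 9 * l ^ 4 := by
          simp only [I, Finset.card_product, Int.card_Ico]
          have : (2 * (l : ℤ) - -l).toNat = 3 * l := by omega
          rw [this]; simp; ring
        rw [this]
        push_cast
        ring

end Recursion

/-! ### Decay along the scales -/

/-- Scales whose ratios grow geometrically. -/
def scale (n₀ K : ℕ) : ℕ → ℕ
  | 0 => n₀
  | k + 1 => 2 ^ (K + k) * scale n₀ K k

theorem mul_two_pow_le_scale {n₀ K : ℕ} (hK : 1 ≤ K) (k : ℕ) : n₀ * 2 ^ k ≤ scale n₀ K k := by
  induction k with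
  | zero => simp [scale]
  | succ k ih =>
    rw [scale]
    calc n₀ * 2 ^ (k + 1) = 2 ^ 1 * (n₀ * 2 ^ k) := by ring
      _ ≤ 2 ^ (K + k) * scale n₀ K k := Nat.mul_le_mul (Nat.pow_le_pow_right (by norm_num) (by omega)) ih

/-- The logarithm of the scales grows only quadratically in `k`; this is what a bound of the form
`exp (-(3/2)^k)` is compared with in the end. -/
theorem scale_le (n₀ K k : ℕ) : scale n₀ K k ≤ n₀ * 2 ^ ((K + k) * k) := by
  induction k with
  | zero => simp [scale]
  | succ k ih =>
    rw [scale]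
    calc 2 ^ (K + k) * scale n₀ K k ≤ 2 ^ (K + k) * (n₀ * 2 ^ ((K + k) * k)) := by gcongr
      _ = n₀ * 2 ^ (K + k + (K + k) * k) := by ring
      _ ≤ _ := by
        apply Nat.mul_le_mul_left
        apply Nat.pow_le_pow_right (by norm_num)
        nlinarith

theorem scale_pos {n₀ K : ℕ} (hn : 1 ≤ n₀) (hK : 1 ≤ K) (k : ℕ) : 1 ≤ scale n₀ K k :=
  le_trans (Nat.one_le_iff_ne_zero.2 (by positivity)) (mul_two_pow_le_scale hK k)

theorem sixteen_pow_le_exp (j : ℕ) : (18 * 16 ^ j : ℝ) ≤ Real.exp (3 + 3 * j) := by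
  have h3 : (18 : ℝ) ≤ Real.exp 3 := by
    have h1 := Real.exp_one_gt_d9
    have : Real.exp 3 = Real.exp 1 ^ 3 := by rw [← Real.exp_nat_mul]; norm_num
    rw [this]
    calc (18 : ℝ) ≤ 2.7 ^ 3 := by norm_num
      _ ≤ _ := by gcongr; linarith
  rw [Real.exp_add, mul_comm (3 : ℝ) j, Real.exp_nat_mul]
  have : (16 : ℝ) ^ j ≤ Real.exp 3 ^ j := by gcongr; linarith
  gcongr

/-- With `u = m (3/2)^k`, squaring yields `exp (-2u)`, and the combinatorial factor `18 · 16^(K+k)`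
is at most `exp (u/2)` because `u` grows faster than linearly in `k`. What is left is `exp (-3u/2)`.
The choice `m = 12 + 6 K` makes this work from `k = 0` on. -/
theorem scale_step_bound {K k : ℕ} {m C c N : ℝ} (hm : m = 12 + 6 * K)
    (hN : C + 2 * m * (3 / 2) ^ k ≤ c * N) :
    9 * ((2 : ℝ) ^ (K + k)) ^ 4 *
      (Real.exp (-(m * (3 / 2) ^ k)) ^ 2 + C * Real.exp (-c * N))
        ≤ Real.exp (-(m * (3 / 2) ^ (k + 1))) := by
  have hb : 1 + (k : ℝ) * (1 / 2) ≤ (3 / 2 : ℝ) ^ k := by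
    have := one_add_mul_le_pow (a := (1 / 2 : ℝ)) (by norm_num) k
    norm_num at this ⊢
    linarith
  have hK : (0 : ℝ) ≤ K := by positivity
  have hk : (0 : ℝ) ≤ k := by positivity
  have h1 : 3 + 3 * ((K + k : ℕ) : ℝ) ≤ 1 / 2 * m * (3 / 2) ^ k := by
    push_cast
    calc 3 + 3 * ((K : ℝ) + k) ≤ 1 / 2 * m * (1 + k * (1 / 2)) := by rw [hm]; nlinarith [mul_nonneg hK hk]
      _ ≤ _ := by
        have : 0 ≤ 1 / 2 * m := by rw [hm]; positivity
        gcongr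
  have e16 : ((2 : ℝ) ^ (K + k)) ^ 4 = 16 ^ (K + k) := by
    rw [← pow_mul, mul_comm, pow_mul]; norm_num
  have h2 := sixteen_pow_le_exp (K + k)
  have h3 : (18 * 16 ^ (K + k) : ℝ) ≤ Real.exp (1 / 2 * m * (3 / 2) ^ k) :=
    h2.trans (Real.exp_le_exp.2 h1)
  rw [e16]
  set u := m * (3 / 2 : ℝ) ^ k with hu
  have hu' : m * (3 / 2 : ℝ) ^ (k + 1) = 3 / 2 * u := by rw [hu]; ring
  have h3' : (18 * 16 ^ (K + k) : ℝ) ≤ Real.exp (1 / 2 * u) := by convert h3 using 2; rw [hu]; ring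
  rw [hu']
  have hC : C ≤ Real.exp C := by linarith [Real.add_one_le_exp C]
  have t2 : C * Real.exp (-c * N) ≤ Real.exp (-(2 * u)) := by
    calc C * Real.exp (-c * N) ≤ Real.exp C * Real.exp (-c * N) := by gcongr
      _ = Real.exp (C - c * N) := by rw [← Real.exp_add]; ring_nf
      _ ≤ _ := Real.exp_le_exp.2 (by rw [hu]; linarith)
  have t1 : Real.exp (-u) ^ 2 = Real.exp (-(2 * u)) := by
    rw [← Real.exp_nat_mul]; push_cast; ring_nf
  calc 9 * (16 : ℝ) ^ (K + k) * (Real.exp (-u) ^ 2 + C * Real.exp (-c * N))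
      ≤ 9 * (16 : ℝ) ^ (K + k) * (Real.exp (-(2 * u)) + Real.exp (-(2 * u))) := by rw [t1]; gcongr
    _ = 18 * 16 ^ (K + k) * Real.exp (-(2 * u)) := by ring
    _ ≤ Real.exp (1 / 2 * u) * Real.exp (-(2 * u)) := by gcongr
    _ = Real.exp (-(3 / 2 * u)) := by rw [← Real.exp_add]; ring_nf

section Decay

variable {Ω : Type*} [MeasurableSpace Ω]

theorem exists_scale_decay {P : Measure Ω} {a : Ω → ℤ × ℤ → Bool} (hdec : Decoupled P a) {s : ℤ}
    (hs : s = 1 ∨ s = -1) {v ε : ℝ} (hv : 0 < v) (hε : 0 < ε)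
    (hsmall : ∀ δ : ℝ, 0 < δ → ∀ N : ℕ, ∃ n, N ≤ n ∧ fastSup P a s n v ≤ ENNReal.ofReal δ) :
    ∃ n₀ K : ℕ, 1 ≤ n₀ ∧ 1 ≤ K ∧ ∀ k,
      fastSup P a s (scale n₀ K k) (v + ε) ≤ ENNReal.ofReal (Real.exp (-(3 / 2) ^ k)) := by
  obtain ⟨C, hC, c, hc, hd⟩ := hdec v hv
  obtain ⟨K', hK'⟩ := pow_unbounded_of_one_lt (12 / ε) (show (1 : ℝ) < 2 by norm_num)
  set K := K' + 1
  have hK : 12 / 2 ^ K ≤ ε := by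
    rw [div_le_iff₀ (by positivity)]
    rw [div_lt_iff₀ hε] at hK'
    have : (2 : ℝ) ^ K' ≤ 2 ^ K := pow_le_pow_right₀ (by norm_num) (by omega)
    nlinarith
  set m : ℝ := 12 + 6 * K with hm
  have hm1 : 1 ≤ m := by
    have : (0 : ℝ) ≤ K := by positivity
    linarith
  obtain ⟨N, hN⟩ := exists_nat_ge ((C + 2 * m) / c)
  -- The initial scale must have probability at most `exp (-m)` and be so large that the decoupling
  -- error stays below `exp (-2u)` at all later scales.
  obtain ⟨n₀, hn₀, hq⟩ := hsmall (Real.exp (-m)) (Real.exp_pos _) (N + 1)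
  refine ⟨n₀, K, by omega, by omega, ?_⟩
  have hcn : C + 2 * m ≤ c * n₀ := by
    rw [div_le_iff₀ hc] at hN
    have : (N : ℝ) ≤ n₀ := by exact_mod_cast (by omega : N ≤ n₀)
    nlinarith
  -- The increments of speed `6 / 2^(K+k)` sum to `12 / 2^K`, which is at most `ε` by the choice of
  -- `K`.
  have key : ∀ k, fastSup P a s (scale n₀ K k) (v + 12 / 2 ^ K * (1 - 1 / 2 ^ k))
      ≤ ENNReal.ofReal (Real.exp (-(m * (3 / 2) ^ k))) := by
    intro k
    induction k with
    | zero => simpa [scale] using hq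
    | succ k ih =>
      have hv' : v ≤ v + 12 / 2 ^ K * (1 - 1 / 2 ^ k) := by
        have : (1 : ℝ) / 2 ^ k ≤ 1 := by
          rw [div_le_one (by positivity)]
          exact one_le_pow₀ (by norm_num)
        have : 0 ≤ 12 / (2 : ℝ) ^ K * (1 - 1 / 2 ^ k) := by
          apply mul_nonneg (by positivity); linarith
        linarith
      have h1 := fastSup_mul_le hs hv' hd (scale_pos (by omega : 1 ≤ n₀) (by omega : 1 ≤ K) k)
        (Nat.one_le_two_pow (n := K + k))
      have e1 : v + 12 / 2 ^ K * (1 - 1 / 2 ^ (k + 1)) =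
          v + 12 / 2 ^ K * (1 - 1 / 2 ^ k) + 6 / ((2 ^ (K + k) : ℕ) : ℝ) := by
        push_cast
        rw [pow_add, pow_succ]
        field_simp
        ring
      rw [e1, scale]
      refine h1.trans ?_
      refine le_trans ?_ (ENNReal.ofReal_le_ofReal
        (scale_step_bound (K := K) (k := k) (C := C) (c := c) (N := scale n₀ K k) hm ?_))
      · rw [ENNReal.ofReal_mul (p := 9 * ((2 : ℝ) ^ (K + k)) ^ 4) (by positivity),
          ENNReal.ofReal_add (by positivity) (by positivity), ENNReal.ofReal_mul (p := 9) (by norm_num),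
          ENNReal.ofReal_pow (p := (2 : ℝ) ^ (K + k)) (by positivity),
          ENNReal.ofReal_pow (p := Real.exp _) (by positivity)]
        have : ENNReal.ofReal (2 ^ (K + k)) = ((2 ^ (K + k) : ℕ) : ℝ≥0∞) := by
          rw [← ENNReal.ofReal_natCast]; push_cast; rfl
        rw [this]
        simp only [ENNReal.ofReal_ofNat]
        gcongr
      · have h2 : ((n₀ * 2 ^ k : ℕ) : ℝ) ≤ scale n₀ K k := by
          exact_mod_cast mul_two_pow_le_scale (by omega) k
        have h3 : (1 : ℝ) ≤ (3 / 2) ^ k := one_le_pow₀ (by norm_num)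
        have h4 : (3 / 2 : ℝ) ^ k ≤ 2 ^ k := by gcongr; norm_num
        push_cast at h2
        calc C + 2 * m * (3 / 2) ^ k ≤ (C + 2 * m) * (3 / 2) ^ k := by nlinarith
          _ ≤ (C + 2 * m) * 2 ^ k := by gcongr
          _ ≤ c * n₀ * 2 ^ k := by gcongr
          _ ≤ c * scale n₀ K k := by rw [mul_assoc]; gcongr
  intro k
  refine ((fastSup_anti P a s _ ?_).trans (key k)).trans ?_
  · have : 12 / (2 : ℝ) ^ K * (1 - 1 / 2 ^ k) ≤ 12 / 2 ^ K * 1 := by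
      gcongr
      linarith [show (0 : ℝ) ≤ 1 / 2 ^ k by positivity]
    linarith
  · apply ENNReal.ofReal_le_ofReal
    rw [Real.exp_le_exp]
    have : (0 : ℝ) < (3 / 2) ^ k := by positivity
    nlinarith

/-! ### Interpolation between the scales -/

/-- Pigeonhole: an average speed above `v` over `J` blocks forces one block of speed at least `v`.
There are `J` blocks and `M + 2 J` cells in which it can start. -/
theorem measure_fast_multiple_le (P : Measure Ω) (a : Ω → ℤ × ℤ → Bool) (s : ℤ) {n J M : ℕ}
    (hn : 1 ≤ n) (hJ : 1 ≤ J) (v : ℝ) (x t : ℤ) :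
    P {ω | ∃ y, x ≤ y ∧ y < x + M * n ∧ Even (y + t) ∧
        v * (J * n) < s * (arrowWalk (a ω) y t (J * n) - y)}
      ≤ (J * (M + 2 * J) : ℕ) * fastSup P a s n v := by
  classical
  have hn' : (0 : ℤ) < n := by exact_mod_cast hn
  let I : Finset (ℤ × ℤ) := Finset.Ico 0 (J : ℤ) ×ˢ Finset.Ico (-(J : ℤ)) (M + J)
  have hsub : {ω | ∃ y, x ≤ y ∧ y < x + M * n ∧ Even (y + t) ∧
        v * (J * n) < s * (arrowWalk (a ω) y t (J * n) - y)} ⊆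
      ⋃ q ∈ I, a ⁻¹' fastArrows s n v (x + q.2 * n) (t + q.1 * n) := by
    rintro ω ⟨y, h1, h2, h3, h4⟩
    have : ∃ i, i < J ∧ v * n ≤ s * (arrowWalk (a ω) y t ((i + 1) * n) : ℝ)
        - s * (arrowWalk (a ω) y t (i * n) : ℝ) := by
      by_contra! hcon
      have := sub_le_of_slow (D := fun i => s * (arrowWalk (a ω) y t (i * n) : ℝ)) (w := v * n)
        (Nat.zero_le J) fun k _ hk => (hcon k hk).le
      simp [arrowWalk] at this
      linarith
    obtain ⟨i, hi, hfast⟩ := this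
    simp only [Set.mem_iUnion]
    refine ⟨(i, (arrowWalk (a ω) y t (i * n) - x) / n), ?_,
      mem_fastArrows_of_increment (x := x) hn h3 hfast⟩
    have hd := abs_le.1 (abs_arrowWalk_sub_le (a ω) y t (i * n))
    have hkn : i * n ≤ J * n := Nat.mul_le_mul_right _ hi.le
    zify at hkn hd
    simp only [I, Finset.mem_product, Finset.mem_Ico]
    refine ⟨⟨by positivity, by exact_mod_cast hi⟩, ?_, ?_⟩
    · rw [Int.le_ediv_iff_mul_le hn']
      linarith [hd.1]
    · rw [Int.ediv_lt_iff_lt_mul hn']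
      linarith [hd.2]
  calc _ ≤ P (⋃ q ∈ I, a ⁻¹' fastArrows s n v (x + q.2 * n) (t + q.1 * n)) := measure_mono hsub
    _ ≤ ∑ q ∈ I, P (a ⁻¹' fastArrows s n v (x + q.2 * n) (t + q.1 * n)) :=
        measure_biUnion_finset_le _ _
    _ ≤ ∑ q ∈ I, fastSup P a s n v := Finset.sum_le_sum fun q _ => le_fastSup ..
    _ = _ := by
        rw [Finset.sum_const, nsmul_eq_mul]
        congr 2
        simp only [I, Finset.card_product, Int.card_Ico]
        have : ((M : ℤ) + J - -J).toNat = M + 2 * J := by omega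
        rw [this]; simp

theorem exists_scale_between {g : ℕ → ℕ} (hg : ∀ k, k ≤ g k) (k₀ : ℕ) {H : ℝ} (hH : g k₀ ≤ H) :
    ∃ k, k₀ ≤ k ∧ (g k : ℝ) ≤ H ∧ H < g (k + 1) := by
  classical
  have hex : ∃ j, H < g (k₀ + j + 1) := by
    obtain ⟨j, hj⟩ := exists_nat_gt H
    refine ⟨j, hj.trans_le ?_⟩
    exact_mod_cast (by omega : j ≤ k₀ + j + 1).trans (hg _)
  refine ⟨k₀ + Nat.find hex, by omega, ?_, Nat.find_spec hex⟩
  rcases h : Nat.find hex with _ | j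
  · simpa using hH
  · have := Nat.find_min hex (m := j) (by omega)
    push Not at this
    exact this

theorem exists_cube_le_pow (B : ℝ) : ∃ k₀ : ℕ, ∀ k : ℕ, k₀ ≤ k → B * (k + 1) ^ 3 ≤ (3 / 2 : ℝ) ^ k := by
  have h := tendsto_pow_const_div_const_pow_of_one_lt 3 (show (1 : ℝ) < 3 / 2 by norm_num)
  have hB : 0 < |B| * 8 + 1 := by positivity
  have h1 := (h.eventually (gt_mem_nhds (inv_pos.2 hB))).and (eventually_ge_atTop 1)
  obtain ⟨k₀, hk₀⟩ := eventually_atTop.1 h1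
  refine ⟨k₀, fun k hk => ?_⟩
  obtain ⟨h2, h3⟩ := hk₀ k hk
  have hk1 : (1 : ℝ) ≤ k := by exact_mod_cast h3
  rw [div_lt_iff₀ (by positivity), inv_mul_eq_div, lt_div_iff₀ hB] at h2
  calc B * (k + 1 : ℝ) ^ 3 ≤ |B| * (k + 1 : ℝ) ^ 3 := by gcongr; exact le_abs_self B
    _ ≤ |B| * (2 * k : ℝ) ^ 3 := by gcongr; linarith
    _ = k ^ 3 * (|B| * 8) := by ring
    _ ≤ k ^ 3 * (|B| * 8 + 1) := by gcongr; linarith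
    _ ≤ _ := h2.le

/-- Here `ln H ≤ A (k+1)²`, so both `(ln H)^(3/2)` and the logarithm of the number of blocks and
cells are at most of order `(k+1)³`, which `(3/2)^k` eventually dominates. -/
theorem exists_interpolation_bound (n₀ K : ℕ) (hn₀ : 1 ≤ n₀) : ∃ k₀ : ℕ, ∀ k : ℕ, k₀ ≤ k → ∀ H : ℝ, 1 ≤ H →
    H < ((scale n₀ K (k + 1) * 2 ^ (k + 1) : ℕ) : ℝ) →
    32 * ((2 : ℝ) ^ (2 * k + K + 1)) ^ 2 * Real.exp (-(3 / 2) ^ k)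
      ≤ Real.exp (-2 * Real.log H ^ (3 / 2 : ℝ)) := by
  set A : ℝ := Real.log n₀ + K + 2 with hA
  have hlog : 0 ≤ Real.log n₀ := Real.log_nonneg (by exact_mod_cast hn₀)
  have hA0 : 0 ≤ A := by positivity
  obtain ⟨k₀, hk₀⟩ := exists_cube_le_pow (11 + 2 * K + 2 * A ^ (3 / 2 : ℝ))
  refine ⟨k₀, fun k hk H hH hHk => ?_⟩
  have h1 := hk₀ k hk
  have hl2 : Real.log 2 ≤ 1 := by
    have := Real.log_two_lt_d9; linarith
  have hk0 : (0 : ℝ) ≤ k := by positivity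
  have hK0 : (0 : ℝ) ≤ K := by positivity
  have hlogH : Real.log H ≤ A * (k + 1) ^ 2 := by
    have hs : ((scale n₀ K (k + 1) * 2 ^ (k + 1) : ℕ) : ℝ) ≤ n₀ * 2 ^ ((K + (k + 1)) * (k + 1) + (k + 1)) := by
      rw [pow_add _ ((K + (k + 1)) * (k + 1)) (k + 1), ← mul_assoc]
      have := scale_le n₀ K (k + 1)
      have h' : ((scale n₀ K (k + 1) : ℕ) : ℝ) ≤ n₀ * 2 ^ ((K + (k + 1)) * (k + 1)) := by
        exact_mod_cast this
      push_cast
      gcongr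
    calc Real.log H ≤ Real.log (n₀ * 2 ^ ((K + (k + 1)) * (k + 1) + (k + 1))) :=
          Real.log_le_log (by linarith) (hHk.le.trans hs)
      _ = Real.log n₀ + ((K + (k + 1)) * (k + 1) + (k + 1)) * Real.log 2 := by
          rw [Real.log_mul (by positivity) (by positivity), Real.log_pow]
          push_cast
          ring
      _ ≤ Real.log n₀ + ((K + (k + 1)) * (k + 1) + (k + 1)) * 1 := by gcongr
      _ ≤ A * (k + 1) ^ 2 := by rw [hA]; nlinarith [mul_nonneg hlog hk0, mul_nonneg hK0 hk0, mul_nonneg (mul_nonneg hlog hk0) hk0, mul_nonneg (mul_nonneg hK0 hk0) hk0]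
  have hpow : Real.log H ^ (3 / 2 : ℝ) ≤ A ^ (3 / 2 : ℝ) * (k + 1) ^ 3 := by
    calc Real.log H ^ (3 / 2 : ℝ) ≤ (A * (k + 1) ^ 2) ^ (3 / 2 : ℝ) :=
          Real.rpow_le_rpow (Real.log_nonneg hH) hlogH (by norm_num)
      _ = A ^ (3 / 2 : ℝ) * (k + 1) ^ 3 := by
          rw [Real.mul_rpow hA0 (by positivity), ← Real.rpow_natCast, ← Real.rpow_mul (by positivity),
            ← Real.rpow_natCast]
          norm_num
  have h2 : 32 * ((2 : ℝ) ^ (2 * k + K + 1)) ^ 2 ≤ Real.exp ((11 + 2 * K) * (k + 1) ^ 3) := by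
    have e1 : 32 * ((2 : ℝ) ^ (2 * k + K + 1)) ^ 2 = 2 ^ (4 * k + 2 * K + 7) := by
      rw [← pow_mul, show (32 : ℝ) = 2 ^ 5 by norm_num, ← pow_add]
      congr 1
      ring
    rw [e1]
    have e2 : (2 : ℝ) ≤ Real.exp 1 := by linarith [Real.exp_one_gt_d9]
    calc (2 : ℝ) ^ (4 * k + 2 * K + 7) ≤ Real.exp 1 ^ (4 * k + 2 * K + 7) := by gcongr
      _ = Real.exp (4 * k + 2 * K + 7) := by rw [← Real.exp_nat_mul]; push_cast; ring_nf
      _ ≤ _ := by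
        rw [Real.exp_le_exp]
        have : (1 + k : ℝ) ≤ (k + 1) ^ 3 := by nlinarith [sq_nonneg (k : ℝ), mul_nonneg hk0 (sq_nonneg (k : ℝ))]
        calc (4 * k + 2 * K + 7 : ℝ) ≤ (11 + 2 * K) * (1 + k) := by nlinarith [mul_nonneg hK0 hk0]
          _ ≤ _ := by gcongr
  calc 32 * ((2 : ℝ) ^ (2 * k + K + 1)) ^ 2 * Real.exp (-(3 / 2) ^ k)
      ≤ Real.exp ((11 + 2 * K) * (k + 1) ^ 3) * Real.exp (-(3 / 2) ^ k) := by gcongr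
    _ = Real.exp ((11 + 2 * K) * (k + 1) ^ 3 - (3 / 2) ^ k) := by rw [← Real.exp_add]; ring_nf
    _ ≤ _ := by
      rw [Real.exp_le_exp]
      linarith

/-- The decay of the probability of fast walks, for all large times `H`. -/
theorem exists_fast_decay {P : Measure Ω} {a : Ω → ℤ × ℤ → Bool} (hdec : Decoupled P a) {s : ℤ}
    (hs : s = 1 ∨ s = -1) {v ε : ℝ} (hv : 0 < v) (hε : 0 < ε)
    (hsmall : ∀ δ : ℝ, 0 < δ → ∀ N : ℕ, ∃ n, N ≤ n ∧ fastSup P a s n v ≤ ENNReal.ofReal δ) :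
    ∃ H₁ : ℝ, 1 ≤ H₁ ∧ ∀ H : ℝ, H₁ ≤ H → ∀ (x t : ℤ) (N : ℕ), H - 5 ≤ N → N ≤ H →
      P {ω | ∃ y : ℤ, x ≤ y ∧ (y : ℝ) < x + (H + 4) ∧ Even (y + t) ∧
        (v + ε) * H - 3 ≤ s * (arrowWalk (a ω) y t N - y)}
        ≤ ENNReal.ofReal (Real.exp (-2 * Real.log H ^ (3 / 2 : ℝ)) / 4) := by
  obtain ⟨n₀, K, hn₀, hK, hq⟩ := exists_scale_decay hdec hs hv (half_pos hε) hsmall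
  obtain ⟨k₁, hk₁⟩ := exists_interpolation_bound n₀ K hn₀
  obtain ⟨k₂, hk₂⟩ := pow_unbounded_of_one_lt (16 / ε + 8) (show (1 : ℝ) < 2 by norm_num)
  -- A scale `n` is used only for times `H ≥ n 2^k`. Then `n` is small compared with `ε H`, and
  -- replacing `H` by a multiple of `n` costs at most `ε / 2` in speed.
  have hg : ∀ k, k ≤ scale n₀ K k * 2 ^ k := fun k =>
    k.lt_two_pow_self.le.trans (Nat.le_mul_of_pos_left _ (scale_pos hn₀ hK k))
  refine ⟨max 1 ((scale n₀ K (max k₁ k₂) * 2 ^ (max k₁ k₂) : ℕ) : ℝ), le_max_left _ _,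
    fun H hH x t N hN hNH => ?_⟩
  have hH1 : 1 ≤ H := (le_max_left _ _).trans hH
  obtain ⟨k, hk, hkH, hHk⟩ := exists_scale_between hg (max k₁ k₂) ((le_max_right _ _).trans hH)
  have hb := hk₁ k ((le_max_left _ _).trans hk) H hH1 hHk
  set n := scale n₀ K k with hn
  have hn1 : 1 ≤ n := scale_pos hn₀ hK k
  have hn1' : (1 : ℝ) ≤ n := by exact_mod_cast hn1
  have h2k : 16 / ε + 8 ≤ (2 : ℝ) ^ k :=
    hk₂.le.trans (pow_le_pow_right₀ (by norm_num) ((le_max_right _ _).trans hk))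
  push_cast at hkH
  have hnH8 : 8 * n ≤ H := by
    have : (8 : ℝ) ≤ 2 ^ k := by linarith [show 0 < 16 / ε by positivity]
    nlinarith
  have hnHε : 8 * n ≤ ε / 2 * H := by
    have h1 : 16 / ε ≤ (2 : ℝ) ^ k := by linarith
    rw [div_le_iff₀ hε] at h1
    have h2 : n * (16 : ℝ) ≤ n * (2 ^ k * ε) := by gcongr
    have h3 : (n * 2 ^ k : ℝ) * ε ≤ H * ε := by gcongr
    linarith
  set J := N / n with hJ
  have hJN : J * n ≤ N := Nat.div_mul_le_self N n
  have hJN' : N < J * n + n := Nat.lt_div_mul_add (show 0 < n by omega)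
  have hJ1 : 1 ≤ J := by
    rw [hJ, Nat.le_div_iff_mul_le (by omega)]
    have : (n : ℝ) ≤ N := by linarith
    have : n ≤ N := by exact_mod_cast this
    omega
  set M := ⌈(H + 4) / n⌉₊ with hM
  have hMn : H + 4 ≤ M * n := by
    rw [← div_le_iff₀ (by linarith)]
    exact Nat.le_ceil _
  have hMle : (M : ℝ) ≤ H / n + 5 := by
    have h1 : (M : ℝ) ≤ (H + 4) / n + 1 := (Nat.ceil_lt_add_one (by positivity)).le
    rw [add_div] at h1
    have : (4 : ℝ) / n ≤ 4 := by
      rw [div_le_iff₀ (by linarith)]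
      linarith
    linarith
  -- From the upper bound on `H`: the ratio of the scales is `2^(K+k)`, and the extra factor in the
  -- range of times is `2^(k+1)`.
  have hR : H / n ≤ 2 ^ (2 * k + K + 1) := by
    rw [div_le_iff₀ (by linarith)]
    refine hHk.le.trans (le_of_eq ?_)
    rw [scale]
    push_cast
    rw [← hn]
    ring
  have hJle : (J : ℝ) ≤ H / n := by
    rw [le_div_iff₀ (by linarith)]
    refine le_trans ?_ hNH
    exact_mod_cast hJN
  have hR5 : (5 : ℝ) ≤ H / n := by
    rw [le_div_iff₀ (by linarith)]
    linarith
  have hsub : {ω | ∃ y : ℤ, x ≤ y ∧ (y : ℝ) < x + (H + 4) ∧ Even (y + t) ∧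
        (v + ε) * H - 3 ≤ s * (arrowWalk (a ω) y t N - y)} ⊆
      {ω | ∃ y, x ≤ y ∧ y < x + M * n ∧ Even (y + t) ∧
        (v + ε / 2) * (J * n) < s * (arrowWalk (a ω) y t (J * n) - y)} := by
    rintro ω ⟨y, h1, h2, h3, h4⟩
    refine ⟨y, h1, ?_, h3, ?_⟩
    · have : (y : ℝ) < x + M * n := by linarith
      exact_mod_cast this
    · have h5 : |(arrowWalk (a ω) y t (J * n + (N - J * n)) : ℝ) - arrowWalk (a ω) y t (J * n)| ≤ n := by
        have h6 := abs_arrowWalk_add_sub_le (a ω) y t (J * n) (N - J * n)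
        have h7 : ((N - J * n : ℕ) : ℤ) ≤ n := by omega
        exact_mod_cast h6.trans h7
      rw [Nat.add_sub_cancel' hJN, abs_le] at h5
      have h8 : (v + ε / 2) * (J * n) ≤ (v + ε / 2) * H := by
        have : (J : ℝ) * n ≤ H := by
          refine le_trans ?_ hNH
          exact_mod_cast hJN
        gcongr
      rcases hs with rfl | rfl
      · push_cast at h4 ⊢
        linarith [h5.1, h5.2]
      · push_cast at h4 ⊢
        linarith [h5.1, h5.2]
  refine (measure_mono hsub).trans ((measure_fast_multiple_le P a s hn1 hJ1 _ x t).trans ?_)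
  calc ((J * (M + 2 * J) : ℕ) : ℝ≥0∞) * fastSup P a s n (v + ε / 2)
      ≤ ENNReal.ofReal ((J * (M + 2 * J) : ℕ) : ℝ) * ENNReal.ofReal (Real.exp (-(3 / 2) ^ k)) := by
        rw [ENNReal.ofReal_natCast]
        gcongr
        exact hq k
    _ = ENNReal.ofReal (((J * (M + 2 * J) : ℕ) : ℝ) * Real.exp (-(3 / 2) ^ k)) := by
        rw [ENNReal.ofReal_mul (by positivity)]
    _ ≤ _ := by
        apply ENNReal.ofReal_le_ofReal
        rw [le_div_iff₀ (by norm_num)]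
        refine le_trans ?_ hb
        have hJR : (J : ℝ) ≤ 2 ^ (2 * k + K + 1) := hJle.trans hR
        have hMR : (M : ℝ) + 2 * J ≤ 4 * 2 ^ (2 * k + K + 1) := by linarith
        have : ((J * (M + 2 * J) : ℕ) : ℝ) ≤ 8 * (2 ^ (2 * k + K + 1)) ^ 2 := by
          push_cast
          calc (J : ℝ) * (M + 2 * J) ≤ 2 ^ (2 * k + K + 1) * (4 * 2 ^ (2 * k + K + 1)) := by gcongr
            _ ≤ _ := by nlinarith [show (0 : ℝ) ≤ 2 ^ (2 * k + K + 1) by positivity]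
        have he := Real.exp_pos (-(3 / 2 : ℝ) ^ k)
        nlinarith [mul_le_mul_of_nonneg_right this he.le]

end Decay

/-! ### From the walks in the plane to the arrows -/

open Classical in
/-- The arrows which the walks follow: from `(x, n)` to the right if and only if the uniform variable
at `(x, n)` is at most the relevant probability. -/
def arrows (η : ℝ → ℤ → ℕ∞) (U : ℤ × ℤ → unitInterval) (pb pw : ℝ) (p : ℤ × ℤ) : Bool :=
  decide ((U p : ℝ) ≤ if 0 < η p.2 p.1 then pb else pw)

theorem discreteWalk_eq_arrowWalk (η : ℝ → ℤ → ℕ∞) (U : ℤ × ℤ → unitInterval) (pb pw : ℝ) (x n : ℤ)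
    (k : ℕ) : discreteWalk η U pb pw x n k = arrowWalk (arrows η U pb pw) x n k := by
  induction k with
  | zero => rfl
  | succ k ih =>
    rw [discreteWalk, arrowWalk, ih, jump, arrows]
    simp only [decide_eq_true_eq]
    split_ifs <;> ring

theorem mem_latticeD_iff {w : ℝ × ℝ} : w ∈ latticeD ↔ ∃ x n : ℤ, Even (x + n) ∧ w = (↑x, ↑n) := by
  constructor
  · rintro ⟨i, j, rfl | rfl⟩
    · exact ⟨2 * i, 2 * j, by simp [parity_simps], by push_cast; rfl⟩
    · exact ⟨1 + 2 * i, 1 + 2 * j, by simp [parity_simps], by push_cast; rfl⟩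
  · rintro ⟨x, n, h, rfl⟩
    rw [Int.even_iff] at h
    rcases Int.even_or_odd' x with ⟨i, rfl | rfl⟩ <;> rcases Int.even_or_odd' n with ⟨j, rfl | rfl⟩
    · exact ⟨i, j, Or.inl (by push_cast; rfl)⟩
    · omega
    · omega
    · exact ⟨i, j, Or.inr (by push_cast; rw [add_comm, add_comm (2 * (j : ℝ))])⟩

/-- The half-open segments fill complete diagonals. In this form the continuous lattice is visibly
closed along vertical lines, so the infimum defining a hitting time is attained. -/
theorem mem_latticeC_iff {w : ℝ × ℝ} :
    w ∈ latticeC ↔ (∃ k : ℤ, (w.1 - w.2) / 2 = k) ∨ ∃ k : ℤ, (w.1 + w.2) / 2 = k := by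
  constructor
  · rintro ⟨u, hu, t, h0, h1, rfl | rfl⟩ <;> obtain ⟨x, n, ⟨k, hk⟩, rfl⟩ := mem_latticeD_iff.1 hu
    · refine Or.inl ⟨k - n, ?_⟩
      have : (x : ℝ) + n = k + k := by exact_mod_cast hk
      push_cast
      linarith
    · refine Or.inr ⟨k, ?_⟩
      have : (x : ℝ) + n = k + k := by exact_mod_cast hk
      dsimp
      linarith
  · rintro (⟨k, hk⟩ | ⟨k, hk⟩)
    · refine ⟨(((⌊w.2⌋ + 2 * k : ℤ) : ℝ), ((⌊w.2⌋ : ℤ) : ℝ)), mem_latticeD_iff.2 ⟨_, _, ?_, rfl⟩,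
        Int.fract w.2, Int.fract_nonneg _, Int.fract_lt_one _, Or.inl (Prod.ext ?_ ?_)⟩
      · exact ⟨⌊w.2⌋ + k, by ring⟩
      · have := Int.floor_add_fract w.2
        push_cast
        linarith
      · exact (Int.floor_add_fract w.2).symm
    · refine ⟨(((-⌊w.2⌋ + 2 * k : ℤ) : ℝ), ((⌊w.2⌋ : ℤ) : ℝ)), mem_latticeD_iff.2 ⟨_, _, ?_, rfl⟩,
        Int.fract w.2, Int.fract_nonneg _, Int.fract_lt_one _, Or.inr (Prod.ext ?_ ?_)⟩
      · exact ⟨k, by ring⟩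
      · have := Int.floor_add_fract w.2
        push_cast
        linarith
      · exact (Int.floor_add_fract w.2).symm

theorem latticeD_subset_latticeC : latticeD ⊆ latticeC := by
  intro w hw
  obtain ⟨x, n, ⟨k, hk⟩, rfl⟩ := mem_latticeD_iff.1 hw
  refine mem_latticeC_iff.2 (Or.inr ⟨k, ?_⟩)
  have : (x : ℝ) + n = k + k := by exact_mod_cast hk
  dsimp
  linarith

theorem isClosed_setOf_exists_int_eq {f : ℝ → ℝ} (hf : Continuous f) :
    IsClosed {s | ∃ k : ℤ, f s = k} := by
  have h := Int.isClosedEmbedding_coe_real.isClosed_range.preimage hf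
  convert h using 1
  ext s
  simp [eq_comm]

/-- A vertical half-line hits the continuous lattice within a time `2`. -/
theorem hitting_latticeC (x t : ℝ) :
    let s₀ := sInf {s : ℝ | 0 ≤ s ∧ (x, t + s) ∈ latticeC}
    0 ≤ s₀ ∧ s₀ ≤ 2 ∧ (x, t + s₀) ∈ latticeC := by
  intro s₀
  set S := {s : ℝ | 0 ≤ s ∧ (x, t + s) ∈ latticeC} with hS
  have hbdd : BddBelow S := ⟨0, fun s hs => hs.1⟩
  have hmem : 2 * Int.fract ((x - t) / 2) ∈ S := by
    refine ⟨by have := Int.fract_nonneg ((x - t) / 2); positivity, mem_latticeC_iff.2 (Or.inl ⟨⌊(x - t) / 2⌋, ?_⟩)⟩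
    have := Int.floor_add_fract ((x - t) / 2)
    dsimp
    linarith
  have hclosed : IsClosed S := by
    have : S = {s | 0 ≤ s} ∩ ({s | ∃ k : ℤ, (x - (t + s)) / 2 = k} ∪ {s | ∃ k : ℤ, (x + (t + s)) / 2 = k}) := by
      ext s
      simp only [hS, Set.mem_ofPred_eq, mem_latticeC_iff, Set.mem_inter_iff, Set.mem_union]
    rw [this]
    exact (isClosed_le continuous_const continuous_id).inter
      ((isClosed_setOf_exists_int_eq (by fun_prop)).union (isClosed_setOf_exists_int_eq (by fun_prop)))
  have h := hclosed.csInf_mem ⟨_, hmem⟩ hbdd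
  exact ⟨h.1, (csInf_le hbdd hmem).trans (by linarith [Int.fract_lt_one ((x - t) / 2)]), h.2⟩

/-- On the diagonals `x - t ∈ 2ℤ` the two floors have an even sum; on the other diagonals, away from
the discrete lattice, the sum is odd. Thus `σ` points along the segment through `w`, which ends at
the next integer time. -/
theorem hitting_latticeD {w : ℝ × ℝ} (hC : w ∈ latticeC) (hD : w ∉ latticeD) :
    let σ : ℝ := (-1) ^ (⌊w.1⌋ + ⌊w.2⌋)
    let t₀ := sInf {s : ℝ | 0 ≤ s ∧ (w.1 + s * σ, w.2 + s) ∈ latticeD}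
    |σ| ≤ 1 ∧ 0 ≤ t₀ ∧ t₀ ≤ 1 ∧ (w.1 + t₀ * σ, w.2 + t₀) ∈ latticeD := by
  intro σ t₀
  have hfr := Int.floor_add_fract w.2
  have key : (w.1 + (1 - Int.fract w.2) * σ, w.2 + (1 - Int.fract w.2)) ∈ latticeD ∧ |σ| = 1 := by
    rcases mem_latticeC_iff.1 hC with ⟨k, hk⟩ | ⟨k, hk⟩
    · have h1 : w.1 = w.2 + (2 * k : ℤ) := by push_cast; linarith
      have hσ : σ = 1 := by
        have : ⌊w.1⌋ = ⌊w.2⌋ + 2 * k := by rw [h1, Int.floor_add_intCast]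
        simp only [σ]
        rw [this]
        exact Even.neg_one_zpow ⟨⌊w.2⌋ + k, by ring⟩
      refine ⟨mem_latticeD_iff.2 ⟨⌊w.2⌋ + 2 * k + 1, ⌊w.2⌋ + 1, ⟨⌊w.2⌋ + k + 1, by ring⟩, ?_⟩, by simp [hσ]⟩
      rw [hσ, h1]
      push_cast
      exact Prod.ext (by dsimp; linarith) (by dsimp; linarith)
    · have h1 : w.1 = -w.2 + (2 * k : ℤ) := by push_cast; linarith
      have hf0 : 0 < Int.fract w.2 := by
        refine lt_of_le_of_ne (Int.fract_nonneg _) fun h0 => hD (mem_latticeD_iff.2 ⟨-⌊w.2⌋ + 2 * k, ⌊w.2⌋, ⟨k, by ring⟩, ?_⟩)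
        rw [← h0, add_zero] at hfr
        refine Prod.ext ?_ hfr.symm
        push_cast
        push_cast at h1
        linarith
      have hσ : σ = -1 := by
        have h2 : ⌊w.1⌋ = -⌊w.2⌋ - 1 + 2 * k := by
          rw [h1, Int.floor_add_intCast]
          congr 1
          rw [Int.floor_eq_iff]
          push_cast
          constructor <;> linarith [Int.fract_lt_one w.2]
        simp only [σ]
        rw [h2]
        exact Odd.neg_one_zpow ⟨k - 1, by ring⟩
      refine ⟨mem_latticeD_iff.2 ⟨-⌊w.2⌋ + 2 * k - 1, ⌊w.2⌋ + 1, ⟨k, by ring⟩, ?_⟩, by simp [hσ]⟩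
      rw [hσ, h1]
      push_cast
      exact Prod.ext (by dsimp; linarith) (by dsimp; linarith)
  obtain ⟨hmem, hσ⟩ := key
  have hlow : ∀ s, 0 ≤ s → (w.1 + s * σ, w.2 + s) ∈ latticeD → 1 - Int.fract w.2 ≤ s := by
    intro s hs hmem'
    obtain ⟨x, n, hxn, h⟩ := mem_latticeD_iff.1 hmem'
    have h2 : w.2 + s = n := congrArg Prod.snd h
    by_contra hcon
    have hle : (⌊w.2⌋ : ℝ) ≤ n := by linarith [Int.floor_le w.2]
    have hlt : (n : ℝ) < ⌊w.2⌋ + 1 := by linarith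
    have hn : n = ⌊w.2⌋ := by
      have h3 : ⌊w.2⌋ ≤ n := by exact_mod_cast hle
      have h4 : n < ⌊w.2⌋ + 1 := by exact_mod_cast hlt
      omega
    have hs0 : s = 0 := by
      have : (n : ℝ) = ⌊w.2⌋ := by rw [hn]
      linarith [Int.floor_le w.2]
    apply hD
    rw [hs0] at hmem'
    simpa using hmem'
  have ht₀ : t₀ = 1 - Int.fract w.2 := by
    refine IsLeast.csInf_eq ⟨⟨by linarith [Int.fract_lt_one w.2], hmem⟩, ?_⟩
    rintro s ⟨hs, hs'⟩
    exact hlow s hs hs'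
  rw [ht₀]
  exact ⟨hσ.le, by linarith [Int.fract_lt_one w.2], by linarith [Int.fract_nonneg w.2], hmem⟩

theorem walkD_sub_le (η : ℝ → ℤ → ℕ∞) (U : ℤ × ℤ → unitInterval) (pb pw : ℝ) (z m : ℤ) {r : ℝ}
    (hr : 0 ≤ r) :
    |walkD η U pb pw (z, m) r - arrowWalk (arrows η U pb pw) z m ⌊r⌋₊| ≤ 1 := by
  have h1 := abs_arrowWalk_add_sub_le (arrows η U pb pw) z m ⌊r⌋₊ 1
  have h1' : |(arrowWalk (arrows η U pb pw) z m (⌊r⌋₊ + 1) : ℝ) - arrowWalk (arrows η U pb pw) z m ⌊r⌋₊| ≤ 1 := by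
    exact_mod_cast h1
  simp only [walkD, discreteWalk_eq_arrowWalk, Int.floor_intCast]
  rw [add_sub_cancel_left, abs_mul]
  have h2 : |r - ⌊r⌋₊| ≤ 1 := by
    rw [abs_le]
    constructor <;> linarith [Nat.floor_le hr, Nat.lt_floor_add_one r]
  calc _ ≤ (1 : ℝ) * 1 := by gcongr
    _ = 1 := by norm_num

theorem walk_of_mem_latticeD (η : ℝ → ℤ → ℕ∞) (U : ℤ × ℤ → unitInterval) (pb pw : ℝ) {w : ℝ × ℝ}
    (hw : w ∈ latticeD) {h : ℝ} (hh : 0 ≤ h) : walk η U pb pw w h = walkD η U pb pw w h := by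
  have : sInf {s : ℝ | 0 ≤ s ∧ (w.1, w.2 + s) ∈ latticeC} = 0 :=
    IsLeast.csInf_eq ⟨⟨le_rfl, by simpa using latticeD_subset_latticeC hw⟩, fun s hs => hs.1⟩
  simp only [walk, this, add_zero, sub_zero, not_lt.2 hh, if_false, walkC, hw, if_true]

/-- From every point the walk reaches the discrete lattice within a time `3`. -/
theorem exists_walk_eq_walkD (pb pw : ℝ) (w : ℝ × ℝ) : ∃ z m : ℤ, Even (z + m) ∧ w.2 ≤ m ∧
    m ≤ w.2 + 3 ∧ |z - w.1| ≤ 1 ∧ ∀ (η : ℝ → ℤ → ℕ∞) (U : ℤ × ℤ → unitInterval) (h : ℝ), 3 ≤ h →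
      walk η U pb pw w h = walkD η U pb pw (z, m) (h - (m - w.2)) := by
  obtain ⟨h0, h2, hC⟩ := hitting_latticeC w.1 w.2
  set s₀ := sInf {s : ℝ | 0 ≤ s ∧ (w.1, w.2 + s) ∈ latticeC} with hs₀
  by_cases hD : (w.1, w.2 + s₀) ∈ latticeD
  · obtain ⟨z, m, he, hzm⟩ := mem_latticeD_iff.1 hD
    have hz : w.1 = z := congrArg Prod.fst hzm
    have hm : w.2 + s₀ = m := congrArg Prod.snd hzm
    refine ⟨z, m, he, by linarith, by linarith, by simp [hz], fun η U h hh => ?_⟩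
    simp only [walk, ← hs₀, not_lt.2 (show s₀ ≤ h by linarith), if_false, walkC, hD, if_true]
    rw [hzm, ← hm]
    congr 1
    ring
  · obtain ⟨hσ, ht0, ht1, hmem⟩ := hitting_latticeD hC hD
    dsimp only at hσ ht0 ht1 hmem
    set σ : ℝ := (-1) ^ (⌊w.1⌋ + ⌊w.2 + s₀⌋) with hσdef
    set t₀ := sInf {s : ℝ | 0 ≤ s ∧ (w.1 + s * σ, w.2 + s₀ + s) ∈ latticeD} with ht₀
    obtain ⟨z, m, he, hzm⟩ := mem_latticeD_iff.1 hmem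
    have hz : w.1 + t₀ * σ = z := congrArg Prod.fst hzm
    have hm : w.2 + s₀ + t₀ = m := congrArg Prod.snd hzm
    refine ⟨z, m, he, by linarith, by linarith, ?_, fun η U h hh => ?_⟩
    · rw [← hz, add_sub_cancel_left, abs_mul, abs_of_nonneg ht0]
      calc t₀ * |σ| ≤ 1 * 1 := by gcongr
        _ = 1 := by norm_num
    · simp only [walk, ← hs₀, not_lt.2 (show s₀ ≤ h by linarith), if_false, walkC, hD, ← hσdef,
        ← ht₀, not_lt.2 (show t₀ ≤ h - s₀ by linarith)]
      rw [hzm, ← hm]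
      congr 1
      ring

/-! ### Deviations in both directions -/

/-- The event that some walk started in `w + [0, H) × {0}` has in the direction `s` an average speed
of at least `v` over the time `H`. -/
def devEvent (E : RandomEnv) (pb pw : ℝ) (s : ℤ) (H : ℝ) (w : ℝ × ℝ) (v : ℝ) :
    Set (E.Ω × (ℤ × ℤ → unitInterval)) :=
  {ω | ∃ y : ℝ × ℝ, w.1 ≤ y.1 ∧ y.1 < w.1 + H ∧ y.2 = w.2 ∧
    v * H ≤ s * (walk (E.field ω.1) ω.2 pb pw y H - y.1)}

/-- The supremum over the starting intervals of the probabilities of the deviations. -/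
def devProb (E : RandomEnv) (pb pw : ℝ) (s : ℤ) (H v : ℝ) : ℝ≥0∞ :=
  ⨆ w : ℝ × ℝ, annealed E (devEvent E pb pw s H w v)

theorem fastProb_eq_devProb (E : RandomEnv) (pb pw H v : ℝ) :
    fastProb E pb pw H v = devProb E pb pw 1 H v := by
  simp [fastProb, devProb, fastEvent, devEvent]

theorem slowProb_eq_devProb (E : RandomEnv) (pb pw H v : ℝ) :
    slowProb E pb pw H v = devProb E pb pw (-1) H (-v) := by
  simp only [slowProb, devProb, slowEvent, devEvent]
  congr! 9
  push_cast
  constructor <;> rintro ⟨h1, h⟩ <;> exact ⟨h1, by linarith⟩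

section Link

variable (E : RandomEnv) (pb pw : ℝ)

/-- The random arrows of the walks in the environment `E`. -/
abbrev envArrows (ω : E.Ω × (ℤ × ℤ → unitInterval)) : ℤ × ℤ → Bool :=
  arrows (E.field ω.1) ω.2 pb pw

theorem sign_mul_le {s : ℤ} (hs : s = 1 ∨ s = -1) {x δ : ℝ} (h : |x| ≤ δ) : s * x ≤ δ := by
  rw [abs_le] at h
  rcases hs with rfl | rfl <;> push_cast <;> linarith [h.1, h.2]

/-- Walks from the discrete lattice are among the walks in the plane. The loss of 1 is the distance
between the interpolated position at time `H` and the position after `⌊H⌋₊` steps. -/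
theorem fastSup_le_devProb {s : ℤ} (hs : s = 1 ∨ s = -1) {H v v' : ℝ} (hH : 0 ≤ H)
    (h : v' * H ≤ v * ⌊H⌋₊ - 1) :
    fastSup (annealed E) (envArrows E pb pw) s ⌊H⌋₊ v ≤ devProb E pb pw s H v' := by
  refine iSup₂_le fun x t => le_trans (measure_mono ?_)
    (le_iSup (fun w => annealed E (devEvent E pb pw s H w v')) (x, t))
  rintro ω ⟨y, h1, h2, h3, h4⟩
  have hn := Nat.floor_le hH
  refine ⟨(y, t), Int.cast_le.2 h1, ?_, rfl, ?_⟩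
  · have : (y : ℝ) < x + ⌊H⌋₊ := by exact_mod_cast h2
    dsimp
    linarith
  · rw [walk_of_mem_latticeD _ _ _ _ (mem_latticeD_iff.2 ⟨y, t, h3, rfl⟩) hH]
    have h5 := sign_mul_le hs ((abs_sub_comm _ _).trans_le (walkD_sub_le (E.field ω.1) ω.2 pb pw y t hH))
    dsimp only
    linarith

/-- A walk joins the discrete lattice within time 3 and distance 1, so there are four possible
integer times of arrival and the starting interval is enlarged only by a constant. Shifting the
start and interpolating cost at most 1 each, which the 3 covers. -/
theorem devEvent_subset {s : ℤ} (hs : s = 1 ∨ s = -1) {H v : ℝ} (hH : 4 ≤ H) (w : ℝ × ℝ) :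
    devEvent E pb pw s H w v ⊆ ⋃ j ∈ Finset.range 4, {ω | ∃ y : ℤ, ⌊w.1 - 1⌋ ≤ y ∧
      (y : ℝ) < ⌊w.1 - 1⌋ + (H + 4) ∧ Even (y + (⌈w.2⌉ + j)) ∧
      v * H - 3 ≤ s * (arrowWalk (envArrows E pb pw ω) y (⌈w.2⌉ + j)
        ⌊H - (⌈w.2⌉ + j - w.2)⌋₊ - y)} := by
  rintro ω ⟨y, h1, h2, h3, h4⟩
  obtain ⟨z, m, he, hm1, hm2, hz, hwalk⟩ := exists_walk_eq_walkD pb pw y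
  rw [h3] at hm1 hm2 hwalk
  have hc1 := Int.le_ceil w.2
  have hc2 := Int.ceil_lt_add_one w.2
  have hm3 : ⌈w.2⌉ ≤ m := Int.ceil_le.2 hm1
  have hm4 : m < ⌈w.2⌉ + 4 := by
    have : (m : ℝ) < ⌈w.2⌉ + 4 := by linarith
    exact_mod_cast this
  obtain ⟨j, rfl⟩ : ∃ j : ℕ, m = ⌈w.2⌉ + j := ⟨(m - ⌈w.2⌉).toNat, by omega⟩
  simp only [Set.mem_iUnion]
  have hz' := abs_le.1 hz
  refine ⟨j, by simp; omega, z, ?_, ?_, he, ?_⟩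
  · have := Int.floor_le (w.1 - 1)
    have : (⌊w.1 - 1⌋ : ℝ) ≤ z := by linarith
    exact_mod_cast this
  · have := Int.lt_floor_add_one (w.1 - 1)
    linarith
  · rw [hwalk _ _ H (by linarith)] at h4
    have h5 := sign_mul_le hs (walkD_sub_le (E.field ω.1) ω.2 pb pw z (⌈w.2⌉ + j)
      (r := H - ((⌈w.2⌉ + j : ℤ) - w.2)) (by linarith))
    have h6 := sign_mul_le hs hz
    push_cast at h4 h5 ⊢
    linarith

/-- Walks have speed at most 1 up to bounded errors. This makes the set of speeds in the definition
of the infimum nonempty. -/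
theorem devProb_two {s : ℤ} (hs : s = 1 ∨ s = -1) {H : ℝ} (hH : 8 ≤ H) :
    devProb E pb pw s H 2 = 0 := by
  simp only [devProb, ENNReal.iSup_eq_zero]
  intro w
  convert measure_empty (μ := annealed E)
  rw [Set.eq_empty_iff_forall_notMem]
  intro ω hω
  have h := devEvent_subset E pb pw hs (by linarith) w hω
  simp only [Set.mem_iUnion] at h
  obtain ⟨j, hj, y, h1, h2, h3, h4⟩ := h
  have h5 : |(arrowWalk (envArrows E pb pw ω) y (⌈w.2⌉ + j) ⌊H - (⌈w.2⌉ + j - w.2)⌋₊ : ℝ) - y|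
      ≤ ⌊H - (⌈w.2⌉ + j - w.2)⌋₊ := by
    exact_mod_cast abs_arrowWalk_sub_le (envArrows E pb pw ω) y (⌈w.2⌉ + j) ⌊H - (⌈w.2⌉ + j - w.2)⌋₊
  have hj' : (j : ℝ) ≤ 3 := by
    have : j ≤ 3 := by simp at hj; omega
    exact_mod_cast this
  have hc1 := Int.le_ceil w.2
  have hc2 := Int.ceil_lt_add_one w.2
  have h6 := Nat.floor_le (show 0 ≤ H - (⌈w.2⌉ + j - w.2) by linarith)
  have h7 := sign_mul_le hs h5
  have : (0 : ℝ) ≤ j := by positivity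
  linarith

variable [IsProbabilityMeasure (annealed E)]

/-- The bound on the deviation probabilities, for an environment whose arrows decouple. -/
theorem devProb_le_of_decoupled (hdec : Decoupled (annealed E) (envArrows E pb pw)) {s : ℤ}
    (hs : s = 1 ∨ s = -1) {ε : ℝ} (hε : 0 < ε) :
    ∃ c : ℝ, 0 < c ∧ ∀ H : ℝ, 1 ≤ H →
      devProb E pb pw s H
        (max (sInf {v : ℝ | liminf (fun H : ℝ => devProb E pb pw s H v) atTop = 0}) 0 + ε)
        ≤ ENNReal.ofReal (c * Real.exp (-2 * Real.log H ^ (3 / 2 : ℝ))) := by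
  set V := {v : ℝ | liminf (fun H : ℝ => devProb E pb pw s H v) atTop = 0} with hV
  set v₀ := max (sInf V) 0 with hv₀
  have hv₀0 : 0 ≤ v₀ := le_max_right _ _
  have hne : V.Nonempty := by
    refine ⟨2, ?_⟩
    have h0 : (fun H : ℝ => devProb E pb pw s H 2) =ᶠ[atTop] fun _ => 0 := by
      filter_upwards [eventually_ge_atTop 8] with H hH using devProb_two E pb pw hs hH
    simp only [hV, Set.mem_ofPred_eq]
    rw [liminf_congr h0]
    exact liminf_const _
  -- Nonemptiness is enough: whatever value the infimum takes, some admissible speed lies below `v₀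
  -- + ε / 4`.
  obtain ⟨v, hvV, hv⟩ := exists_lt_of_csInf_lt hne
    (show sInf V < v₀ + ε / 4 by linarith [le_max_left (sInf V) 0])
  have hsmall : ∀ δ : ℝ, 0 < δ → ∀ N : ℕ, ∃ n, N ≤ n ∧
      fastSup (annealed E) (envArrows E pb pw) s n (v₀ + ε / 2) ≤ ENNReal.ofReal δ := by
    intro δ hδ N
    -- A vanishing lower limit gives smallness at arbitrarily large times only, but one such time
    -- suffices to start the recursion. The margin from `ε / 4` to `ε / 2` absorbs the rounding of
    -- `H` to an integer.
    have hfreq : ∃ᶠ H : ℝ in atTop, devProb E pb pw s H v < ENNReal.ofReal δ := by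
      refine frequently_lt_of_liminf_lt (by isBoundedDefault) ?_
      simp only [hV, Set.mem_ofPred_eq] at hvV
      rw [hvV]
      simpa using hδ
    obtain ⟨H, hH, hlt⟩ := (hfreq.and_eventually
      (eventually_ge_atTop (max (N + 1 : ℝ) ((v₀ + ε / 4 + 1) / (ε / 4) + 1)))).exists
    have hHN : (N : ℝ) + 1 ≤ H := (le_max_left _ _).trans hlt
    have hHε : (v₀ + ε / 4 + 1) / (ε / 4) + 1 ≤ H := (le_max_right _ _).trans hlt
    have hN0 : (0 : ℝ) ≤ N := by positivity
    have hfl := Nat.lt_floor_add_one H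
    refine ⟨⌊H⌋₊, Nat.le_floor (by linarith), le_trans (fastSup_le_devProb E pb pw hs (by linarith) ?_) hH.le⟩
    have h1 : (v₀ + ε / 4 + 1) / (ε / 4) ≤ ⌊H⌋₊ := by linarith
    rw [div_le_iff₀ (by positivity)] at h1
    calc v * H ≤ (v₀ + ε / 4) * H := by gcongr; linarith
      _ ≤ (v₀ + ε / 4) * (⌊H⌋₊ + 1) := by gcongr
      _ ≤ _ := by linarith
  -- Decoupling needs a positive speed; `v₀ + ε / 2` is positive thanks to the maximum with 0.
  obtain ⟨H₁, hH₁, hdecay⟩ := exists_fast_decay hdec hs (show 0 < v₀ + ε / 2 by positivity)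
    (half_pos hε) hsmall
  set H₂ := max H₁ 8
  have hlogmono : ∀ H, 1 ≤ H → H ≤ H₂ → Real.log H ^ (3 / 2 : ℝ) ≤ Real.log H₂ ^ (3 / 2 : ℝ) :=
    fun H h1 h2 => Real.rpow_le_rpow (Real.log_nonneg h1) (Real.log_le_log (by linarith) h2) (by norm_num)
  have hH2 : 1 ≤ H₂ := hH₁.trans (le_max_left _ _)
  have hl0 : 0 ≤ Real.log H₂ ^ (3 / 2 : ℝ) := Real.rpow_nonneg (Real.log_nonneg hH2) _
  -- With this constant the bound is at least 1 for all `H ≤ H₂`, hence trivial there.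
  refine ⟨Real.exp (2 * Real.log H₂ ^ (3 / 2 : ℝ)), Real.exp_pos _, fun H hH => ?_⟩
  rcases le_total H H₂ with hle | hge
  · refine le_trans (iSup_le fun w => prob_le_one) ?_
    rw [← Real.exp_add, ← ENNReal.ofReal_one]
    apply ENNReal.ofReal_le_ofReal
    rw [← Real.exp_zero, Real.exp_le_exp]
    linarith [hlogmono H hH hle]
  · have hH1 : H₁ ≤ H := (le_max_left _ _).trans hge
    have hH8 : 8 ≤ H := (le_max_right _ _).trans hge
    refine iSup_le fun w => ?_
    refine (measure_mono (devEvent_subset E pb pw hs (by linarith) w)).trans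
      ((measure_biUnion_finset_le _ _).trans ?_)
    calc _ ≤ ∑ j ∈ Finset.range 4, ENNReal.ofReal (Real.exp (-2 * Real.log H ^ (3 / 2 : ℝ)) / 4) := by
          refine Finset.sum_le_sum fun j hj => ?_
          have hj' : (j : ℝ) ≤ 3 := by
            have : j ≤ 3 := by simp at hj; omega
            exact_mod_cast this
          have hc1 := Int.le_ceil w.2
          have hc2 := Int.ceil_lt_add_one w.2
          have hj0 : (0 : ℝ) ≤ j := by positivity
          have hr : 0 ≤ H - (⌈w.2⌉ + j - w.2) := by linarith
          have := hdecay H hH1 ⌊w.1 - 1⌋ (⌈w.2⌉ + j) ⌊H - (⌈w.2⌉ + j - w.2)⌋₊ ?_ ?_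
          · rwa [add_assoc, add_halves] at this
          · linarith [Nat.lt_floor_add_one (H - (⌈w.2⌉ + j - w.2))]
          · linarith [Nat.floor_le hr]
      _ = ENNReal.ofReal (Real.exp (-2 * Real.log H ^ (3 / 2 : ℝ))) := by
          rw [Finset.sum_const, Finset.card_range, nsmul_eq_mul, ← ENNReal.ofReal_natCast,
            ← ENNReal.ofReal_mul (by norm_num)]
          congr 1
          push_cast
          ring
      _ ≤ _ := by
          apply ENNReal.ofReal_le_ofReal
          have := Real.one_le_exp (show 0 ≤ 2 * Real.log H₂ ^ (3 / 2 : ℝ) by positivity)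
          nlinarith [Real.exp_pos (-2 * Real.log H ^ (3 / 2 : ℝ))]

end Link

/-- The deviation bounds for an environment whose arrows decouple. -/
theorem deviation_bounds_of_decoupled (E : RandomEnv) (pb pw : ℝ) [IsProbabilityMeasure (annealed E)]
    (hdec : Decoupled (annealed E) (envArrows E pb pw)) {ε : ℝ} (hε : 0 < ε) :
    ∃ c : ℝ, 0 < c ∧ ∀ H : ℝ, 1 ≤ H →
      fastProb E pb pw H (max (upperSpeed E pb pw) 0 + ε)
        ≤ ENNReal.ofReal (c * Real.exp (-2 * (Real.log H) ^ (3 / 2 : ℝ))) ∧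
      slowProb E pb pw H (min (lowerSpeed E pb pw) 0 - ε)
        ≤ ENNReal.ofReal (c * Real.exp (-2 * (Real.log H) ^ (3 / 2 : ℝ))) := by
  obtain ⟨c₁, hc₁, h₁⟩ := devProb_le_of_decoupled E pb pw hdec (Or.inl rfl) hε
  obtain ⟨c₂, hc₂, h₂⟩ := devProb_le_of_decoupled E pb pw hdec (Or.inr rfl) hε
  have hu : upperSpeed E pb pw =
      sInf {v : ℝ | liminf (fun H : ℝ => devProb E pb pw 1 H v) atTop = 0} := by
    simp only [upperSpeed, fastProb_eq_devProb]
  have hl : lowerSpeed E pb pw =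
      -sInf {v : ℝ | liminf (fun H : ℝ => devProb E pb pw (-1) H v) atTop = 0} := by
    simp only [lowerSpeed, slowProb_eq_devProb]
    rw [← Real.sSup_neg]
    rfl
  refine ⟨max c₁ c₂, lt_max_of_lt_left hc₁, fun H hH => ⟨?_, ?_⟩⟩
  · rw [fastProb_eq_devProb, hu]
    refine (h₁ H hH).trans (ENNReal.ofReal_le_ofReal ?_)
    gcongr
    exact le_max_left _ _
  · rw [slowProb_eq_devProb, hl]
    have : -(min (-sInf {v : ℝ | liminf (fun H : ℝ => devProb E pb pw (-1) H v) atTop = 0}) 0 - ε) =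
        max (sInf {v : ℝ | liminf (fun H : ℝ => devProb E pb pw (-1) H v) atTop = 0}) 0 + ε := by
      rw [neg_sub, sub_eq_add_neg, ← max_neg_neg, neg_neg, neg_zero, add_comm]
    rw [this]
    refine (h₂ H hH).trans (ENNReal.ofReal_le_ofReal ?_)
    gcongr
    exact le_max_right _ _

/-! ### Mixing two independent samples -/

section Mix

variable {X Y : Type*} [MeasurableSpace X] [MeasurableSpace Y]

/-- If the mixture `m` of two independent samples has the law of one sample, then an event which
depends only on the part of the mixture coming from the first sample and one which depends only on
the part coming from the second are independent. -/
theorem measure_inter_eq_mul_of_mix {P : Measure X} [SFinite P] {m : X × X → X}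
    (hm : MeasurePreserving m (P.prod P) P) {A B : Set X} (hA : MeasurableSet A) (hB : MeasurableSet B)
    (h1 : ∀ x y, m (x, y) ∈ A ↔ x ∈ A) (h2 : ∀ x y, m (x, y) ∈ B ↔ y ∈ B) :
    P (A ∩ B) = P A * P B := by
  rw [← hm.measure_preimage (hA.inter hB).nullMeasurableSet, ← Measure.prod_prod]
  congr 1
  ext ⟨x, y⟩
  simp [h1, h2]

theorem measurePreserving_prodProdProdComm (P P' : Measure X) (Q Q' : Measure Y)
    [SFinite P] [SFinite P'] [SFinite Q] [SFinite Q'] :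
    MeasurePreserving (fun p : (X × Y) × (X × Y) => ((p.1.1, p.2.1), (p.1.2, p.2.2)))
      ((P.prod Q).prod (P'.prod Q')) ((P.prod P').prod (Q.prod Q')) := by
  have a := measurePreserving_prodAssoc P Q (P'.prod Q')
  have b1 := (measurePreserving_prodAssoc Q P' Q').symm
  have b2 := (Measure.measurePreserving_swap (μ := Q) (ν := P')).prod (MeasurePreserving.id Q')
  have b3 := measurePreserving_prodAssoc P' Q Q'
  have c := (measurePreserving_prodAssoc P P' (Q.prod Q')).symm
  exact c.comp (((MeasurePreserving.id P).prod (b3.comp (b2.comp b1))).comp a)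

/-- The mixture of two samples of a product of two spaces. -/
def mixProd (m : X × X → X) (m' : Y × Y → Y) (p : (X × Y) × (X × Y)) : X × Y :=
  (m (p.1.1, p.2.1), m' (p.1.2, p.2.2))

theorem measurePreserving_mixProd {P : Measure X} {Q : Measure Y} [SFinite P] [SFinite Q]
    {m : X × X → X} {m' : Y × Y → Y} (hm : MeasurePreserving m (P.prod P) P)
    (hm' : MeasurePreserving m' (Q.prod Q) Q) :
    MeasurePreserving (mixProd m m') ((P.prod Q).prod (P.prod Q)) (P.prod Q) :=
  (hm.prod hm').comp (measurePreserving_prodProdProdComm P P Q Q)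

theorem measurePreserving_mixFstSnd (P : Measure X) (Q : Measure Y) [IsProbabilityMeasure P]
    [IsProbabilityMeasure Q] :
    MeasurePreserving (fun p : (X × Y) × (X × Y) => (p.1.1, p.2.2)) ((P.prod Q).prod (P.prod Q))
      (P.prod Q) :=
  measurePreserving_fst.prod measurePreserving_snd

variable {ι : Type*} {Z : ι → Type*} [∀ i, MeasurableSpace (Z i)]

open Classical in
/-- The mixture which takes the coordinates in `S` from the first sample and the others from the
second. -/
def mixPi (S : Set ι) (p : (∀ i, Z i) × (∀ i, Z i)) : ∀ i, Z i :=
  S.piecewise p.1 p.2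

theorem measurable_mixPi (S : Set ι) : Measurable (mixPi (Z := Z) S) := by
  classical
  refine measurable_pi_iff.2 fun i => ?_
  by_cases hi : i ∈ S
  · simp only [mixPi, Set.piecewise_eq_of_mem _ _ _ hi]
    fun_prop
  · simp only [mixPi, Set.piecewise_eq_of_notMem _ _ _ hi]
    fun_prop

/-- The preimage of a cylinder is the product of its part with indices in `S` and its part with
indices outside `S`, so both sides give the same finite product. -/
theorem measurePreserving_mixPi (μ : ∀ i, Measure (Z i)) [∀ i, IsProbabilityMeasure (μ i)] (S : Set ι) :
    MeasurePreserving (mixPi S) ((Measure.infinitePi μ).prod (Measure.infinitePi μ))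
      (Measure.infinitePi μ) := by
  classical
  refine ⟨measurable_mixPi S, Measure.eq_infinitePi μ fun s t ht => ?_⟩
  have hpi : ∀ u : Finset ι, MeasurableSet ((u : Set ι).pi t) := fun u =>
    .pi u.countable_toSet fun _ _ => ht _
  rw [Measure.map_apply (measurable_mixPi S) (hpi s)]
  have : mixPi S ⁻¹' ((s : Set ι).pi t) =
      (((s.filter (· ∈ S) : Finset ι) : Set ι).pi t) ×ˢ (((s.filter (· ∉ S) : Finset ι) : Set ι).pi t) := by
    ext ⟨x, y⟩
    simp only [Set.mem_preimage, Set.mem_pi, mixPi, Set.mem_prod, Finset.coe_filter, Set.mem_ofPred_eq,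
      Finset.mem_coe]
    constructor
    · intro h
      refine ⟨fun i hi => ?_, fun i hi => ?_⟩
      · simpa [hi.2] using h i hi.1
      · simpa [hi.2] using h i hi.1
    · rintro ⟨h1, h2⟩ i hi
      by_cases hS : i ∈ S
      · simpa [hS] using h1 i ⟨hi, hS⟩
      · simpa [hS] using h2 i ⟨hi, hS⟩
  rw [this, Measure.prod_prod, Measure.infinitePi_pi _ fun _ _ => ht _,
    Measure.infinitePi_pi _ fun _ _ => ht _, Finset.prod_filter_mul_prod_filter_not]

omit [∀ i, MeasurableSpace (Z i)] in
theorem mixPi_of_mem {S : Set ι} {i : ι} (hi : i ∈ S) (p : (∀ i, Z i) × (∀ i, Z i)) :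
    mixPi S p i = p.1 i := by
  classical
  simp [mixPi, hi]

omit [∀ i, MeasurableSpace (Z i)] in
theorem mixPi_of_notMem {S : Set ι} {i : ι} (hi : i ∉ S) (p : (∀ i, Z i) × (∀ i, Z i)) :
    mixPi S p i = p.2 i := by
  classical
  simp [mixPi, hi]

/-- Under a product measure, events which depend on disjoint sets of coordinates are independent. -/
theorem infinitePi_inter_of_dependsOn (μ : ∀ i, Measure (Z i)) [∀ i, IsProbabilityMeasure (μ i)]
    {S T : Set ι} (hST : Disjoint S T) {A B : Set (∀ i, Z i)} (hA : MeasurableSet A)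
    (hB : MeasurableSet B) (hAS : DependsOn (· ∈ A) S) (hBT : DependsOn (· ∈ B) T) :
    Measure.infinitePi μ (A ∩ B) = Measure.infinitePi μ A * Measure.infinitePi μ B := by
  refine measure_inter_eq_mul_of_mix (measurePreserving_mixPi μ S) hA hB (fun x y => ?_) fun x y => ?_
  · exact Eq.to_iff (hAS fun i hi => mixPi_of_mem hi _)
  · exact Eq.to_iff (hBT fun i hi => mixPi_of_notMem (Set.disjoint_right.1 hST hi) _)

end Mix

/-! ### Independence up to a small error -/

/-- Outside `B` the events agree with independent ones. Replacing all three probabilities costs at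
most `3 b + b²`, hence at most `4 b` if `b ≤ 1`; otherwise the bound is trivial. -/
theorem measure_inter_le_of_approx {Ω : Type*} [MeasurableSpace Ω] {P : Measure Ω}
    [IsProbabilityMeasure P] {A₁ A₂ A₁' A₂' B : Set Ω} {b : ℝ≥0∞} (hB : P B ≤ b)
    (h₁ : A₁ ⊆ A₁' ∪ B) (h₁' : A₁' ⊆ A₁ ∪ B) (h₂ : A₂ ⊆ A₂' ∪ B) (h₂' : A₂' ⊆ A₂ ∪ B)
    (hind : P (A₁' ∩ A₂') ≤ P A₁' * P A₂') : P (A₁ ∩ A₂) ≤ P A₁ * P A₂ + 4 * b := by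
  rcases le_total 1 b with hb | hb
  · calc P (A₁ ∩ A₂) ≤ 1 := prob_le_one
      _ ≤ 4 * 1 := by norm_num
      _ ≤ P A₁ * P A₂ + 4 * b := le_add_left (by gcongr)
  · have e1 : P A₁' ≤ P A₁ + b := (measure_mono h₁').trans ((measure_union_le _ _).trans (by gcongr))
    have e2 : P A₂' ≤ P A₂ + b := (measure_mono h₂').trans ((measure_union_le _ _).trans (by gcongr))
    have h1 : P A₁ ≤ 1 := prob_le_one
    have h2 : P A₂ ≤ 1 := prob_le_one
    have hsub : A₁ ∩ A₂ ⊆ (A₁' ∩ A₂') ∪ B := by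
      rintro ω ⟨ha, hb⟩
      rcases h₁ ha with h | h
      · rcases h₂ hb with h' | h'
        · exact Or.inl ⟨h, h'⟩
        · exact Or.inr h'
      · exact Or.inr h
    calc P (A₁ ∩ A₂) ≤ P (A₁' ∩ A₂') + P B := (measure_mono hsub).trans (measure_union_le _ _)
      _ ≤ (P A₁ + b) * (P A₂ + b) + b := by
          gcongr
          exact hind.trans (by gcongr)
      _ = P A₁ * P A₂ + (P A₁ * b + b * P A₂ + b * b + b) := by ring
      _ ≤ P A₁ * P A₂ + (1 * b + b * 1 + b * 1 + b) := by gcongr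
      _ = P A₁ * P A₂ + 4 * b := by ring

/-- It is enough to prove the decoupling for a first box to the left of the second. -/
theorem decoupled_of_left {Ω : Type*} [MeasurableSpace Ω] {P : Measure Ω} {a : Ω → ℤ × ℤ → Bool}
    (h : ∀ v : ℝ, 0 < v → ∃ C : ℝ, 0 < C ∧ ∃ c : ℝ, 0 < c ∧ ∀ (n T : ℕ) (x₁ x₂ t t₁ t₂ : ℤ), 1 ≤ n →
      n ≤ T → t ≤ t₁ → t₁ + n ≤ t + T → t ≤ t₂ → t₂ + n ≤ t + T →
      x₁ + 3 * n + v * T ≤ x₂ →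
      ∀ S₁ S₂ : Set (ℤ × ℤ → Bool), DependsOn (· ∈ S₁) (box x₁ t₁ n) →
        DependsOn (· ∈ S₂) (box x₂ t₂ n) →
        P (a ⁻¹' S₁ ∩ a ⁻¹' S₂)
          ≤ P (a ⁻¹' S₁) * P (a ⁻¹' S₂) + ENNReal.ofReal (C * Real.exp (-c * n))) :
    Decoupled P a := by
  intro v hv
  obtain ⟨C, hC, c, hc, h⟩ := h v hv
  refine ⟨C, hC, c, hc, fun n T x₁ x₂ t t₁ t₂ hn hT h1 h1' h2 h2' hx S₁ S₂ hS₁ hS₂ => ?_⟩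
  rcases hx with hx | hx
  · exact h n T x₁ x₂ t t₁ t₂ hn hT h1 h1' h2 h2' hx S₁ S₂ hS₁ hS₂
  · rw [Set.inter_comm, mul_comm (P _)]
    exact h n T x₂ x₁ t t₂ t₁ hn hT h2 h2' h1 h1' hx S₂ S₁ hS₂ hS₁


/-- The box as a finite set. -/
def boxF (x t : ℤ) (n : ℕ) : Finset (ℤ × ℤ) := Finset.Ico x (x + 3 * n) ×ˢ Finset.Ico t (t + n)

theorem mem_boxF {x t : ℤ} {n : ℕ} {p : ℤ × ℤ} : p ∈ boxF x t n ↔ p ∈ box x t n := by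
  simp [boxF, box]

theorem card_boxF (x t : ℤ) (n : ℕ) : (boxF x t n).card = 3 * n * n := by
  simp only [boxF, Finset.card_product, Int.card_Ico]
  congr 1 <;> omega

/-! ### Poisson clocks -/

section IID

variable {ι X : Type*} [MeasurableSpace X]

/-- Avoiding `E` at `k` successive indices has probability `ν Eᶜ ^ k`, which tends to 0. -/
theorem ae_frequently_of_pos (ν : Measure X) [IsProbabilityMeasure ν] {E : Set X}
    (hE : MeasurableSet E) (hpos : 0 < ν E) {f : ℕ → ι} (hf : Function.Injective f) :
    ∀ᵐ x ∂(Measure.infinitePi fun _ : ι => ν), ∃ᶠ n in atTop, x (f n) ∈ E := by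
  classical
  have hlt : ν Eᶜ < 1 := by
    rw [prob_compl_eq_one_sub hE]
    exact ENNReal.sub_lt_self (by simp) (by simp) hpos.ne'
  have key : ∀ m : ℕ, ∀ᵐ x ∂(Measure.infinitePi fun _ : ι => ν), ∃ n, m ≤ n ∧ x (f n) ∈ E := by
    intro m
    rw [ae_iff]
    refine le_antisymm (ge_of_tendsto' (ENNReal.tendsto_pow_atTop_nhds_zero_of_lt_one hlt) fun k => ?_)
      zero_le
    calc _ ≤ (Measure.infinitePi fun _ : ι => ν)
          ((((Finset.Ico m (m + k)).image f : Finset ι) : Set ι).pi fun _ => Eᶜ) := by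
          refine measure_mono fun x hx => ?_
          simp only [Set.mem_ofPred_eq, not_exists, not_and] at hx
          intro i hi
          obtain ⟨n, hn, rfl⟩ := Finset.mem_image.1 hi
          exact hx n (Finset.mem_Ico.1 hn).1
      _ = ν Eᶜ ^ k := by
          rw [Measure.infinitePi_pi _ fun _ _ => hE.compl, Finset.prod_const,
            Finset.card_image_of_injective _ hf]
          simp
  filter_upwards [ae_all_iff.2 key] with x hx
  exact frequently_atTop.2 hx

theorem ae_forall_mem {ν : Measure X} [IsProbabilityMeasure ν] [Countable ι] {E : Set X}
    (h : ∀ᵐ x ∂ν, x ∈ E) : ∀ᵐ x ∂(Measure.infinitePi fun _ : ι => ν), ∀ i, x i ∈ E := by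
  refine ae_all_iff.2 fun i => ?_
  exact (measurePreserving_eval_infinitePi (fun _ : ι => ν) i).quasiMeasurePreserving.ae h

/-- Splitting off the first variable; the induction on the index of an arrival rests on this. -/
theorem measurePreserving_head_tail (ν : Measure X) [IsProbabilityMeasure ν] :
    MeasurePreserving (fun τ : ℕ → X => (τ 0, fun i => τ (i + 1)))
      (Measure.infinitePi fun _ : ℕ => ν) (ν.prod (Measure.infinitePi fun _ : ℕ => ν)) := by
  have hmeas : Measurable (fun τ : ℕ → X => (τ 0, fun i => τ (i + 1))) := by fun_prop
  refine ⟨hmeas, (Measure.prod_eq fun A B hA hB => ?_).symm⟩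
  rw [Measure.map_apply hmeas (hA.prod hB)]
  have h0 := measurePreserving_eval_infinitePi (fun _ : ℕ => ν) 0
  have h1 : MeasurePreserving (fun (τ : ℕ → X) i => τ (i + 1)) (Measure.infinitePi fun _ : ℕ => ν)
      (Measure.infinitePi fun _ : ℕ => ν) :=
    ⟨by fun_prop, Measure.map_infinitePi_infinitePi_of_inj (P := fun _ : ℕ => ν) (f := fun i => i + 1)
      fun i j h => by simpa using h⟩
  rw [← h0.measure_preimage hA.nullMeasurableSet, ← h1.measure_preimage hB.nullMeasurableSet]
  refine infinitePi_inter_of_dependsOn (fun _ : ℕ => ν) (S := {0}) (T := {0}ᶜ) disjoint_compl_right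
    (h0.measurable hA) (h1.measurable hB) ?_ ?_
  · intro x y h
    change (x 0 ∈ A) = (y 0 ∈ A)
    rw [h 0 rfl]
  · intro x y h
    have : (fun i => x (i + 1)) = fun i => y (i + 1) := funext fun i => h (i + 1) (by simp)
    change ((fun i => x (i + 1)) ∈ B) = ((fun i => y (i + 1)) ∈ B)
    rw [this]

theorem measurePreserving_curry_triple {α β δ : Type*} (ν : Measure X) [IsProbabilityMeasure ν] :
    MeasurePreserving (fun (τ : α × β × δ → X) (e : α × β) (j : δ) => τ (e.1, e.2, j))
      (Measure.infinitePi fun _ : α × β × δ => ν)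
      (Measure.infinitePi fun _ : α × β => Measure.infinitePi fun _ : δ => ν) := by
  have h1 : MeasurePreserving (fun (τ : α × β × δ → X) (q : (α × β) × δ) => τ (q.1.1, q.1.2, q.2))
      (Measure.infinitePi fun _ : α × β × δ => ν) (Measure.infinitePi fun _ : (α × β) × δ => ν) :=
    ⟨by fun_prop, Measure.map_infinitePi_infinitePi_of_inj (P := fun _ : α × β × δ => ν)
      (f := fun q : (α × β) × δ => (q.1.1, q.1.2, q.2)) fun p q h => by
        obtain ⟨⟨a, b⟩, c⟩ := p
        obtain ⟨⟨a', b'⟩, c'⟩ := q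
        simp_all⟩
  have h2 : MeasurePreserving (MeasurableEquiv.curry (α × β) δ X)
      (Measure.infinitePi fun _ : (α × β) × δ => ν)
      (Measure.infinitePi fun _ : α × β => Measure.infinitePi fun _ : δ => ν) :=
    ⟨MeasurableEquiv.measurable _, Measure.infinitePi_map_curry (fun _ _ => ν)⟩
  exact h2.comp h1

end IID

/-! ### Arrival times and the restart of a clock -/

/-- The time of the `n`-th arrival of a clock with the waiting times `τ`. -/
def arrivalTime (τ : ℕ → ℝ) (n : ℕ) : ℝ := ∑ i ∈ Finset.range (n + 1), τ i

theorem arrivalTime_succ' (τ : ℕ → ℝ) (n : ℕ) :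
    arrivalTime τ (n + 1) = τ 0 + arrivalTime (fun i => τ (i + 1)) n := by
  rw [arrivalTime, Finset.sum_range_succ', add_comm]
  rfl

theorem arrivalTime_succ (τ : ℕ → ℝ) (n : ℕ) : arrivalTime τ (n + 1) = arrivalTime τ n + τ (n + 1) := by
  rw [arrivalTime, Finset.sum_range_succ]
  rfl

theorem measurable_arrivalTime (n : ℕ) : Measurable fun τ : ℕ → ℝ => arrivalTime τ n := by
  unfold arrivalTime
  fun_prop

/-- The first arrival after the time `u` is the `n`-th one. -/
def firstAfter (u : ℝ) (n : ℕ) : Set (ℕ → ℝ) :=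
  {τ | (∀ j < n, arrivalTime τ j ≤ u) ∧ u < arrivalTime τ n}

/-- The waiting times after the time `u`, if the first arrival after it is the `n`-th one. -/
def residual (u : ℝ) (n : ℕ) (τ : ℕ → ℝ) : ℕ → ℝ
  | 0 => arrivalTime τ n - u
  | i + 1 => τ (n + (i + 1))

theorem arrivalTime_residual (u : ℝ) (n : ℕ) (τ : ℕ → ℝ) (k : ℕ) :
    arrivalTime (residual u n τ) k = arrivalTime τ (n + k) - u := by
  induction k with
  | zero => simp [arrivalTime, residual]
  | succ k ih =>
    rw [arrivalTime_succ, ih, ← add_assoc, arrivalTime_succ, residual]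
    ring_nf

theorem measurable_residual (n : ℕ) : Measurable fun p : ℝ × (ℕ → ℝ) => residual p.1 n p.2 := by
  refine measurable_pi_iff.2 fun i => ?_
  have := measurable_arrivalTime n
  cases i with
  | zero => simp only [residual]; fun_prop
  | succ i => simp only [residual]; fun_prop

theorem measurableSet_firstAfter (n : ℕ) :
    MeasurableSet {p : ℝ × (ℕ → ℝ) | p.2 ∈ firstAfter p.1 n} := by
  have h := measurable_arrivalTime
  have : {p : ℝ × (ℕ → ℝ) | p.2 ∈ firstAfter p.1 n} =
      (⋂ j ∈ Finset.range n, {p | arrivalTime p.2 j ≤ p.1}) ∩ {p | p.1 < arrivalTime p.2 n} := by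
    ext p
    simp [firstAfter]
  rw [this]
  refine MeasurableSet.inter (Finset.measurableSet_biInter _ fun j _ => ?_) ?_
  · exact measurableSet_le ((h j).comp measurable_snd) measurable_fst
  · exact measurableSet_lt measurable_fst ((h n).comp measurable_snd)

theorem firstAfter_succ (u : ℝ) (n : ℕ) (τ : ℕ → ℝ) :
    τ ∈ firstAfter u (n + 1) ↔ τ 0 ≤ u ∧ (fun i => τ (i + 1)) ∈ firstAfter (u - τ 0) n := by
  simp only [firstAfter, Set.mem_ofPred_eq]
  constructor
  · rintro ⟨h1, h2⟩
    refine ⟨by simpa [arrivalTime] using h1 0 (by omega), fun j hj => ?_, ?_⟩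
    · have := h1 (j + 1) (by omega)
      rw [arrivalTime_succ'] at this
      linarith
    · rw [arrivalTime_succ'] at h2
      linarith
  · rintro ⟨h0, h1, h2⟩
    refine ⟨fun j hj => ?_, ?_⟩
    · cases j with
      | zero => simpa [arrivalTime] using h0
      | succ j =>
        have := h1 j (by omega)
        rw [arrivalTime_succ']
        linarith
    · rw [arrivalTime_succ']
      linarith

theorem residual_succ (u : ℝ) (n : ℕ) (τ : ℕ → ℝ) :
    residual u (n + 1) τ = residual (u - τ 0) n fun i => τ (i + 1) := by
  funext i
  cases i with
  | zero => simp only [residual, arrivalTime_succ']; ring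
  | succ i =>
    simp only [residual]
    congr 1
    ring

/-- The sequence with the first term `x` and then the terms of `τ`. -/
def consSeq (x : ℝ) (τ : ℕ → ℝ) : ℕ → ℝ
  | 0 => x
  | i + 1 => τ i

theorem measurable_consSeq : Measurable fun p : ℝ × (ℕ → ℝ) => consSeq p.1 p.2 := by
  refine measurable_pi_iff.2 fun i => ?_
  cases i <;> simp only [consSeq] <;> fun_prop

theorem consSeq_head_tail (τ : ℕ → ℝ) : consSeq (τ 0) (fun i => τ (i + 1)) = τ := by
  funext i
  cases i <;> rfl

section Restart

variable {γ : ℝ} (hγ : 0 < γ)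

/-- The law of the waiting times of a clock of rate `γ`. -/
abbrev clockLaw (γ : ℝ) : Measure (ℕ → ℝ) := Measure.infinitePi fun _ : ℕ => expMeasure γ

include hγ

theorem expMeasure_Ioi (u : ℝ) :
    expMeasure γ (Set.Ioi u) = ENNReal.ofReal (Real.exp (-(γ * max u 0))) := by
  have := isProbabilityMeasure_expMeasure hγ
  rw [← Set.compl_Iic, prob_compl_eq_one_sub measurableSet_Iic, ← ofReal_cdf,
    cdf_expMeasure_eq hγ]
  split_ifs with hu
  · rw [max_eq_left hu, ← ENNReal.ofReal_one, ← ENNReal.ofReal_sub _ (by simp; positivity)]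
    ring_nf
  · rw [max_eq_right (not_le.1 hu).le]
    simp

/-- The shifted restriction and the multiple of the exponential law agree on all rays `(a, ∞)`, by
the formula for the tail, and these rays form a generating π-system. -/
theorem expMeasure_memoryless {u : ℝ} (hu : 0 ≤ u) {A : Set ℝ} (hA : MeasurableSet A) :
    expMeasure γ {x | u < x ∧ x - u ∈ A} = ENNReal.ofReal (Real.exp (-(γ * u))) * expMeasure γ A := by
  have := isProbabilityMeasure_expMeasure hγ
  have hm : Measurable fun x : ℝ => x - u := by fun_prop
  have hset : ∀ B : Set ℝ, MeasurableSet B →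
      ((expMeasure γ).restrict (Set.Ioi u)).map (fun x => x - u) B = expMeasure γ {x | u < x ∧ x - u ∈ B} := by
    intro B hB
    rw [Measure.map_apply hm hB, Measure.restrict_apply (hm hB), Set.inter_comm]
    rfl
  have key : ((expMeasure γ).restrict (Set.Ioi u)).map (fun x => x - u) =
      ENNReal.ofReal (Real.exp (-(γ * u))) • expMeasure γ := by
    have hI : ∀ a, ((expMeasure γ).restrict (Set.Ioi u)).map (fun x => x - u) (Set.Ioi a) =
        (ENNReal.ofReal (Real.exp (-(γ * u))) • expMeasure γ) (Set.Ioi a) := by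
      intro a
      rw [hset _ measurableSet_Ioi]
      have : {x | u < x ∧ x - u ∈ Set.Ioi a} = Set.Ioi (max u (u + a)) := by
        ext x
        simp only [Set.mem_ofPred_eq, Set.mem_Ioi, max_lt_iff]
        constructor <;> rintro ⟨h1, h2⟩ <;> exact ⟨h1, by linarith⟩
      rw [this, Measure.smul_apply, expMeasure_Ioi hγ, expMeasure_Ioi hγ, smul_eq_mul,
        ← ENNReal.ofReal_mul (by positivity), ← Real.exp_add]
      congr 2
      have h1 : max (max u (u + a)) 0 = u + max a 0 := by
        rw [max_eq_left (le_max_of_le_left hu)]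
        rcases le_total a 0 with h | h
        · rw [max_eq_left (by linarith), max_eq_right h]; ring
        · rw [max_eq_right (by linarith), max_eq_left h]
      rw [h1]
      ring
    have : IsFiniteMeasure (((expMeasure γ).restrict (Set.Ioi u)).map (fun x => x - u)) := inferInstance
    refine MeasureTheory.ext_of_generate_finite _ (borel_eq_generateFrom_Ioi ℝ ▸ BorelSpace.measurable_eq)
      isPiSystem_Ioi ?_ ?_
    · rintro s ⟨a, rfl⟩
      exact hI a
    -- The total masses are those of the ray `(-1, ∞)`, since both measures are carried by the
    -- positive half-line.
    · have h1 := hI (-1)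
      have h2 : ((expMeasure γ).restrict (Set.Ioi u)).map (fun x => x - u) Set.univ =
          ((expMeasure γ).restrict (Set.Ioi u)).map (fun x => x - u) (Set.Ioi (-1)) := by
        rw [hset _ .univ, hset _ measurableSet_Ioi]
        congr 1
        ext x
        simp only [Set.mem_ofPred_eq, Set.mem_Ioi, Set.mem_univ, and_true]
        exact ⟨fun h => ⟨h, by linarith⟩, fun h => h.1⟩
      rw [h2, h1, Measure.smul_apply, Measure.smul_apply, expMeasure_Ioi hγ]
      simp
  rw [← hset A hA, key, Measure.smul_apply, smul_eq_mul]

/-- Regeneration: whatever the number of arrivals up to time `u`, the waiting times from `u` on form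
a fresh clock. For `n = 0` this is memorylessness; for larger `n`, condition on the first waiting
time `x` and apply the induction hypothesis at time `u - x`. -/
theorem clockLaw_firstAfter_inter {u : ℝ} (hu : 0 ≤ u) (n : ℕ) {A : Set (ℕ → ℝ)} (hA : MeasurableSet A) :
    clockLaw γ (firstAfter u n ∩ residual u n ⁻¹' A) = clockLaw γ (firstAfter u n) * clockLaw γ A := by
  have := isProbabilityMeasure_expMeasure hγ
  have hht := measurePreserving_head_tail (expMeasure γ)
  induction n generalizing u A with
  | zero =>
    -- It suffices that the left side is a constant times `clockLaw γ B`; the choice `B = Set.univ`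
    -- then identifies the constant.
    have key : ∀ B : Set (ℕ → ℝ), MeasurableSet B → clockLaw γ (firstAfter u 0 ∩ residual u 0 ⁻¹' B) =
        ENNReal.ofReal (Real.exp (-(γ * u))) * clockLaw γ B := by
      intro B hB
      have hc := measurable_consSeq
      have hQ : MeasurableSet {p : ℝ × (ℕ → ℝ) | u < p.1 ∧ consSeq (p.1 - u) p.2 ∈ B} := by
        have h2 : Measurable fun p : ℝ × (ℕ → ℝ) => consSeq (p.1 - u) p.2 :=
          hc.comp (f := fun p : ℝ × (ℕ → ℝ) => (p.1 - u, p.2)) (by fun_prop)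
        exact (measurableSet_lt measurable_const measurable_fst).inter (h2 hB)
      have hQ' : MeasurableSet {p : ℝ × (ℕ → ℝ) | consSeq p.1 p.2 ∈ B} := hc hB
      have e1 : firstAfter u 0 ∩ residual u 0 ⁻¹' B = (fun τ : ℕ → ℝ => (τ 0, fun i => τ (i + 1))) ⁻¹'
          {p | u < p.1 ∧ consSeq (p.1 - u) p.2 ∈ B} := by
        ext τ
        have : residual u 0 τ = consSeq (τ 0 - u) fun i => τ (i + 1) := by
          funext i
          cases i with
          | zero => simp [residual, consSeq, arrivalTime]
          | succ i => simp [residual, consSeq]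
        simp only [Set.mem_inter_iff, Set.mem_preimage, this, Set.mem_ofPred_eq, firstAfter]
        simp [arrivalTime]
      have e2 : B = (fun τ : ℕ → ℝ => (τ 0, fun i => τ (i + 1))) ⁻¹' {p | consSeq p.1 p.2 ∈ B} := by
        ext τ
        simp only [Set.mem_preimage, Set.mem_ofPred_eq, consSeq_head_tail]
      conv_rhs => rw [e2]
      rw [e1, hht.measure_preimage hQ.nullMeasurableSet, hht.measure_preimage hQ'.nullMeasurableSet,
        Measure.prod_apply_symm hQ, Measure.prod_apply_symm hQ', ← lintegral_const_mul]
      · refine lintegral_congr fun σ => ?_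
        exact expMeasure_memoryless hγ hu (A := {y | consSeq y σ ∈ B})
          ((hc.comp (measurable_id.prodMk measurable_const)) hB)
      · exact measurable_measure_prodMk_right hQ'
    have h0 := key Set.univ .univ
    rw [Set.preimage_univ, Set.inter_univ, measure_univ, mul_one] at h0
    rw [key A hA, h0]
  | succ n ih =>
    have key : ∀ B : Set (ℕ → ℝ), MeasurableSet B → clockLaw γ (firstAfter u (n + 1) ∩ residual u (n + 1) ⁻¹' B) =
        (∫⁻ x in Set.Iic u, clockLaw γ (firstAfter (u - x) n) ∂(expMeasure γ)) * clockLaw γ B := by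
      intro B hB
      have hQ : MeasurableSet {p : ℝ × (ℕ → ℝ) | p.1 ≤ u ∧
          p.2 ∈ firstAfter (u - p.1) n ∧ residual (u - p.1) n p.2 ∈ B} := by
        have h1 : Measurable fun p : ℝ × (ℕ → ℝ) => (u - p.1, p.2) := by fun_prop
        exact (measurableSet_le measurable_fst measurable_const).inter
          ((h1 (measurableSet_firstAfter n)).inter (((measurable_residual n).comp h1) hB))
      have e1 : firstAfter u (n + 1) ∩ residual u (n + 1) ⁻¹' B =
          (fun τ : ℕ → ℝ => (τ 0, fun i => τ (i + 1))) ⁻¹' {p | p.1 ≤ u ∧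
          p.2 ∈ firstAfter (u - p.1) n ∧ residual (u - p.1) n p.2 ∈ B} := by
        ext τ
        simp only [Set.mem_inter_iff, firstAfter_succ, Set.mem_preimage, residual_succ, Set.mem_ofPred_eq,
          and_assoc]
      have hm : Measurable fun x => clockLaw γ (firstAfter (u - x) n) :=
        measurable_measure_prodMk_left (ν := clockLaw γ)
          (s := {p : ℝ × (ℕ → ℝ) | p.2 ∈ firstAfter (u - p.1) n})
          ((show Measurable fun p : ℝ × (ℕ → ℝ) => (u - p.1, p.2) by fun_prop) (measurableSet_firstAfter n))
      rw [e1, hht.measure_preimage hQ.nullMeasurableSet, Measure.prod_apply hQ, ← lintegral_mul_const _ hm,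
        ← lintegral_indicator measurableSet_Iic]
      refine lintegral_congr fun x => ?_
      by_cases hx : x ≤ u
      · rw [Set.indicator_of_mem (by exact hx), ← ih (u := u - x) (by linarith) hB]
        congr 1
        ext σ
        simp [hx]
      · rw [Set.indicator_of_notMem (by exact hx)]
        convert measure_empty (μ := clockLaw γ)
        ext σ
        simp [hx]
    have h0 := key Set.univ .univ
    rw [Set.preimage_univ, Set.inter_univ, measure_univ, mul_one] at h0
    rw [key A hA, h0]

theorem ae_clock_pos : ∀ᵐ τ ∂(clockLaw γ), ∀ i, 0 < τ i := by
  have := isProbabilityMeasure_expMeasure hγ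
  refine ae_forall_mem (E := Set.Ioi 0) ?_
  refine mem_ae_iff_prob_eq_one measurableSet_Ioi |>.2 ?_
  rw [expMeasure_Ioi hγ]
  simp

theorem ae_clock_frequently : ∀ᵐ τ ∂(clockLaw γ), ∃ᶠ i in atTop, 1 < τ i := by
  have := isProbabilityMeasure_expMeasure hγ
  refine ae_frequently_of_pos (expMeasure γ) (E := Set.Ioi 1) measurableSet_Ioi ?_ Function.injective_id
  rw [expMeasure_Ioi hγ]
  simp [Real.exp_pos]

omit hγ in
theorem tendsto_arrivalTime {τ : ℕ → ℝ} (h0 : ∀ i, 0 < τ i) (h1 : ∃ᶠ i in atTop, 1 < τ i) :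
    Tendsto (arrivalTime τ) atTop atTop := by
  have hns : ¬ Summable τ := fun hs => by
    have := hs.tendsto_atTop_zero.eventually (gt_mem_nhds one_pos)
    exact h1 (this.mono fun i hi => by linarith)
  have := (not_summable_iff_tendsto_nat_atTop_of_nonneg fun i => (h0 i).le).1 hns
  exact (tendsto_add_atTop_iff_nat 1).2 this

omit hγ in
theorem arrivalTime_strictMono {τ : ℕ → ℝ} (h0 : ∀ i, 0 < τ i) : StrictMono (arrivalTime τ) :=
  strictMono_nat_of_lt_succ fun n => by rw [arrivalTime_succ]; linarith [h0 (n + 1)]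

/-! ### Rings in a mesh of time cells -/

/-- The clock rings between the times `j δ` and `(j + 1) δ`. -/
def RingsIn (δ : ℝ) (j : ℕ) (τ : ℕ → ℝ) : Prop :=
  ∃ n, j * δ < arrivalTime τ n ∧ arrivalTime τ n ≤ (j + 1) * δ

open Classical in
/-- The indicators of the rings in the successive intervals of length `δ`. -/
def ringSeq (δ : ℝ) (τ : ℕ → ℝ) (j : ℕ) : Bool := decide (RingsIn δ j τ)

omit hγ in
theorem measurableSet_ringsIn (δ : ℝ) (j : ℕ) : MeasurableSet {τ | RingsIn δ j τ} := by
  have : {τ | RingsIn δ j τ} = ⋃ n, {τ | j * δ < arrivalTime τ n} ∩ {τ | arrivalTime τ n ≤ (j + 1) * δ} := by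
    ext τ
    simp [RingsIn]
  rw [this]
  have h := measurable_arrivalTime
  exact .iUnion fun n => (measurableSet_lt measurable_const (h n)).inter (measurableSet_le (h n) measurable_const)

omit hγ in
theorem measurable_ringSeq (δ : ℝ) : Measurable (ringSeq δ) := by
  refine measurable_pi_iff.2 fun j => measurable_to_bool ?_
  convert measurableSet_ringsIn δ j using 1
  ext τ
  simp [ringSeq]

omit hγ in
theorem ringsIn_succ_iff {δ : ℝ} (hδ : 0 < δ) {n : ℕ} {τ : ℕ → ℝ} (h : τ ∈ firstAfter δ n) (j : ℕ) :
    RingsIn δ (j + 1) τ ↔ RingsIn δ j (residual δ n τ) := by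
  simp only [RingsIn, arrivalTime_residual]
  push_cast
  constructor
  · rintro ⟨k, h1, h2⟩
    have hk : n ≤ k := by
      by_contra hlt
      have := h.1 k (by omega)
      nlinarith [show (0 : ℝ) ≤ j * δ by positivity]
    refine ⟨k - n, ?_⟩
    rw [Nat.add_sub_cancel' hk]
    constructor <;> linarith
  · rintro ⟨k, h1, h2⟩
    exact ⟨n + k, by linarith, by linarith⟩

omit hγ in
theorem ringsIn_zero_iff {δ : ℝ} {n : ℕ} {τ : ℕ → ℝ} (h0 : ∀ i, 0 < τ i) (h : τ ∈ firstAfter δ n) :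
    RingsIn δ 0 τ ↔ n ≠ 0 := by
  simp only [RingsIn, Nat.cast_zero, zero_mul, zero_add, one_mul]
  constructor
  · rintro ⟨k, -, h2⟩ rfl
    have := (arrivalTime_strictMono h0).monotone (Nat.zero_le k)
    linarith [h.2]
  · intro hn
    exact ⟨0, by simpa [arrivalTime] using h0 0, h.1 0 (by omega)⟩

omit hγ in
theorem measurableSet_firstAfter_right (u : ℝ) (n : ℕ) : MeasurableSet (firstAfter u n) :=
  (measurable_const.prodMk measurable_id : Measurable fun τ : ℕ → ℝ => (u, τ)) (measurableSet_firstAfter n)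

omit hγ in
theorem disjoint_firstAfter (u : ℝ) : Pairwise (Function.onFun Disjoint (firstAfter u)) := by
  have : ∀ n m, n < m → Disjoint (firstAfter u n) (firstAfter u m) := fun n m h =>
    Set.disjoint_left.2 fun τ h1 h2 => absurd (h2.1 n h) (not_le.2 h1.2)
  intro n m h
  rcases lt_or_gt_of_ne h with h | h
  · exact this n m h
  · exact (this m n h).symm

theorem clockLaw_eq_tsum (u : ℝ) {A : Set (ℕ → ℝ)} (hA : MeasurableSet A) :
    clockLaw γ A = ∑' n, clockLaw γ (firstAfter u n ∩ A) := by
  classical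
  have := isProbabilityMeasure_expMeasure hγ
  rw [← measure_iUnion (fun n m h => ((disjoint_firstAfter u) h).mono Set.inter_subset_left Set.inter_subset_left)
    fun n => (measurableSet_firstAfter_right u n).inter hA]
  refine measure_congr ?_
  filter_upwards [ae_clock_pos hγ, ae_clock_frequently hγ] with τ h0 h1
  have hex : ∃ n, u < arrivalTime τ n :=
    ((tendsto_arrivalTime h0 h1).eventually (eventually_gt_atTop u)).exists
  refine propext ⟨fun h => ?_, fun h => ?_⟩
  · exact Set.mem_iUnion.2 ⟨Nat.find hex, ⟨fun j hj => not_lt.1 (Nat.find_min hex hj), Nat.find_spec hex⟩, h⟩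
  · obtain ⟨n, hn⟩ := Set.mem_iUnion.1 h
    exact hn.2

/-- Restart the clock at time `δ`: given the index `n` of the first arrival after `δ`, the first
cell rings exactly when `n ≠ 0`, and the later cells are those of a fresh clock. Summing over `n`
splits off one coin. -/
theorem clockLaw_rings {δ : ℝ} (hδ : 0 < δ) (t : ℕ → Set Bool) (k : ℕ) :
    clockLaw γ {τ | ∀ j < k, ringSeq δ τ j ∈ t j} =
      ∏ j ∈ Finset.range k, coinLaw (1 - Real.exp (-(γ * δ))) (t j) := by
  classical
  have := isProbabilityMeasure_expMeasure hγ
  have hmeas : ∀ (k : ℕ) (t : ℕ → Set Bool), MeasurableSet {τ | ∀ j < k, ringSeq δ τ j ∈ t j} := by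
    intro k t
    have : {τ | ∀ j < k, ringSeq δ τ j ∈ t j} = ⋂ j ∈ Finset.range k, (fun τ => ringSeq δ τ j) ⁻¹' t j := by
      ext τ
      simp
    rw [this]
    exact Finset.measurableSet_biInter _ fun j _ =>
      (measurable_pi_iff.1 (measurable_ringSeq δ) j) (MeasurableSet.of_discrete)
  induction k generalizing t with
  | zero => simp
  | succ k ih =>
    set A := {σ | ∀ j < k, ringSeq δ σ j ∈ t (j + 1)} with hAdef
    have hA : MeasurableSet A := hmeas k fun j => t (j + 1)
    set χ : ℕ → ℝ≥0∞ := fun n => if decide (n ≠ 0) ∈ t 0 then 1 else 0 with hχ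
    have hterm : ∀ n, clockLaw γ (firstAfter δ n ∩ {τ | ∀ j < k + 1, ringSeq δ τ j ∈ t j}) =
        χ n * clockLaw γ (firstAfter δ n) * clockLaw γ A := by
      intro n
      have key : ∀ τ : ℕ → ℝ, (∀ i, 0 < τ i) → τ ∈ firstAfter δ n →
          ((∀ j < k + 1, ringSeq δ τ j ∈ t j) ↔ decide (n ≠ 0) ∈ t 0 ∧ residual δ n τ ∈ A) := by
        intro τ h0 hF
        have e0 : ringSeq δ τ 0 = decide (n ≠ 0) := by
          simp only [ringSeq, ringsIn_zero_iff h0 hF]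
        have e1 : ∀ j, ringSeq δ τ (j + 1) = ringSeq δ (residual δ n τ) j := fun j => by
          simp only [ringSeq, ringsIn_succ_iff hδ hF]
        constructor
        · intro h
          exact ⟨e0 ▸ h 0 (by omega), fun j hj => e1 j ▸ h (j + 1) (by omega)⟩
        · rintro ⟨h1, h2⟩ j hj
          cases j with
          | zero => exact e0 ▸ h1
          | succ j => rw [e1]; exact h2 j (by omega)
      by_cases hd : decide (n ≠ 0) ∈ t 0
      · simp only [hχ, if_pos hd]
        rw [one_mul, ← clockLaw_firstAfter_inter hγ hδ.le n hA]
        refine measure_congr ?_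
        filter_upwards [ae_clock_pos hγ] with τ h0
        exact propext (and_congr_right fun hF => (key τ h0 hF).trans (and_iff_right hd))
      · simp only [hχ, if_neg hd, zero_mul]
        rw [← nonpos_iff_eq_zero, ← measure_empty (μ := clockLaw γ)]
        refine (measure_congr ?_).le
        filter_upwards [ae_clock_pos hγ] with τ h0
        refine propext (iff_of_false ?_ (Set.notMem_empty τ))
        exact fun h => hd ((key τ h0 h.1).1 h.2).1
    rw [clockLaw_eq_tsum hγ δ (hmeas (k + 1) t)]
    simp_rw [hterm]
    rw [ENNReal.tsum_mul_right, Finset.prod_range_succ', mul_comm, ih fun j => t (j + 1)]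
    congr 1
    have h0 : clockLaw γ (firstAfter δ 0) = ENNReal.ofReal (Real.exp (-(γ * δ))) := by
      have : firstAfter δ 0 = (fun τ : ℕ → ℝ => τ 0) ⁻¹' Set.Ioi δ := by
        ext τ
        simp [firstAfter, arrivalTime]
      rw [this, (measurePreserving_eval_infinitePi (fun _ : ℕ => expMeasure γ) 0).measure_preimage
        measurableSet_Ioi.nullMeasurableSet, expMeasure_Ioi hγ, max_eq_left hδ.le]
    have hle : Real.exp (-(γ * δ)) ≤ 1 := by simp; positivity
    have hsum : ∑' n, clockLaw γ (firstAfter δ (n + 1)) = ENNReal.ofReal (1 - Real.exp (-(γ * δ))) := by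
      have h1 := clockLaw_eq_tsum hγ δ MeasurableSet.univ
      rw [measure_univ, tsum_eq_zero_add' ENNReal.summable] at h1
      simp only [Set.inter_univ] at h1
      rw [h0] at h1
      rw [ENNReal.ofReal_sub _ (Real.exp_nonneg _), ENNReal.ofReal_one, h1]
      exact (ENNReal.add_sub_cancel_left (by simp)).symm
    rw [tsum_eq_zero_add' ENNReal.summable, h0]
    simp only [hχ, ne_eq, Nat.add_eq_zero_iff, one_ne_zero, and_false, not_false_eq_true, decide_true,
      not_true_eq_false, decide_false]
    rw [ENNReal.tsum_mul_left, hsum]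
    simp only [coinLaw, Measure.coe_add, Measure.coe_smul, Pi.add_apply, Pi.smul_apply, smul_eq_mul,
      Measure.dirac_apply, Set.indicator_apply, sub_sub_cancel]
    simp only [Pi.one_apply]
    ring

theorem isProbabilityMeasure_ringCoin {δ : ℝ} (hδ : 0 < δ) :
    IsProbabilityMeasure (coinLaw (1 - Real.exp (-(γ * δ)))) :=
  isProbabilityMeasure_coinLaw (by simp; positivity) (by linarith [Real.exp_pos (-(γ * δ))])

theorem map_ringSeq {δ : ℝ} (hδ : 0 < δ) : (clockLaw γ).map (ringSeq δ) =
    Measure.infinitePi fun _ : ℕ => coinLaw (1 - Real.exp (-(γ * δ))) := by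
  classical
  have := isProbabilityMeasure_expMeasure hγ
  have := isProbabilityMeasure_ringCoin hγ hδ
  refine Measure.eq_infinitePi _ fun s t ht => ?_
  rw [Measure.map_apply (measurable_ringSeq δ) (.pi s.countable_toSet fun _ _ => ht _)]
  obtain ⟨k, hk⟩ : ∃ k, s ⊆ Finset.range k := ⟨s.sup id + 1, fun i hi => by
    have := Finset.le_sup (f := id) hi
    simp at this ⊢
    omega⟩
  have h := clockLaw_rings hγ hδ (fun j => if j ∈ s then t j else Set.univ) k
  have e1 : ringSeq δ ⁻¹' ((s : Set ℕ).pi t) =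
      {τ | ∀ j < k, ringSeq δ τ j ∈ (if j ∈ s then t j else Set.univ)} := by
    ext τ
    simp only [Set.mem_preimage, Set.mem_pi, Finset.mem_coe, Set.mem_ofPred_eq]
    constructor
    · intro h j _
      split_ifs with hj
      · exact h j hj
      · trivial
    · intro h j hj
      have := h j (Finset.mem_range.1 (hk hj))
      rwa [if_pos hj] at this
  rw [e1, h, ← Finset.prod_subset hk fun j _ hj => by rw [if_neg hj, measure_univ]]
  exact Finset.prod_congr rfl fun j hj => by rw [if_pos hj]

end Restart

/-! ### The cells of the two-sided clocks -/

/-- The index of the time cell `[i δ, (i + 1) δ)` of the edge `x`, for the cell `(i, x)`. -/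
def cellIndex (p : ℤ × ℤ) : ℤ × Bool × ℕ :=
  match p.1 with
  | Int.ofNat j => (p.2, true, j)
  | Int.negSucc j => (p.2, false, j)

theorem cellIndex_injective : Function.Injective cellIndex := by
  rintro ⟨i, x⟩ ⟨i', x'⟩ h
  cases i <;> cases i' <;> simp_all [cellIndex]

/-- The indicator of the rings of the edge `x` in the time cell `i`, at the index `(i, x)`. -/
def rings (δ : ℝ) (τ : ℤ × Bool × ℕ → ℝ) (p : ℤ × ℤ) : Bool :=
  ringSeq δ (fun j => τ ((cellIndex p).1, (cellIndex p).2.1, j)) (cellIndex p).2.2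

theorem measurePreserving_clocks (γ : ℝ) (hγ : 0 < γ) :
    MeasurePreserving (fun (τ : ℤ × Bool × ℕ → ℝ) (e : ℤ × Bool) (j : ℕ) => τ (e.1, e.2, j))
      (Measure.infinitePi fun _ : ℤ × Bool × ℕ => expMeasure γ)
      (Measure.infinitePi fun _ : ℤ × Bool => clockLaw γ) := by
  have := isProbabilityMeasure_expMeasure hγ
  exact measurePreserving_curry_triple (expMeasure γ)

theorem measurePreserving_rings {γ : ℝ} (hγ : 0 < γ) {δ : ℝ} (hδ : 0 < δ) :
    MeasurePreserving (rings δ) (Measure.infinitePi fun _ : ℤ × Bool × ℕ => expMeasure γ)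
      (Measure.infinitePi fun _ : ℤ × ℤ => coinLaw (1 - Real.exp (-(γ * δ)))) := by
  have := isProbabilityMeasure_expMeasure hγ
  have := isProbabilityMeasure_ringCoin hγ hδ
  have hm := measurable_ringSeq δ
  have h3 : MeasurePreserving (fun (c : ℤ × Bool → ℕ → ℝ) (e : ℤ × Bool) => ringSeq δ (c e))
      (Measure.infinitePi fun _ : ℤ × Bool => clockLaw γ)
      (Measure.infinitePi fun _ : ℤ × Bool => Measure.infinitePi fun _ : ℕ => coinLaw (1 - Real.exp (-(γ * δ)))) := by
    refine ⟨by fun_prop, ?_⟩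
    rw [Measure.infinitePi_map_pi (fun _ : ℤ × Bool => clockLaw γ) (f := fun _ => ringSeq δ) fun _ => hm]
    simp only [map_ringSeq hγ hδ]
  have h4 : MeasurePreserving (MeasurableEquiv.curry (ℤ × Bool) ℕ Bool).symm
      (Measure.infinitePi fun _ : ℤ × Bool => Measure.infinitePi fun _ : ℕ => coinLaw (1 - Real.exp (-(γ * δ))))
      (Measure.infinitePi fun _ : (ℤ × Bool) × ℕ => coinLaw (1 - Real.exp (-(γ * δ)))) :=
    ⟨MeasurableEquiv.measurable _,
      Measure.infinitePi_map_curry_symm (fun (_ : ℤ × Bool) (_ : ℕ) => coinLaw (1 - Real.exp (-(γ * δ))))⟩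
  have h5 : MeasurePreserving (fun (r : (ℤ × Bool) × ℕ → Bool) (p : ℤ × ℤ) =>
      r (((cellIndex p).1, (cellIndex p).2.1), (cellIndex p).2.2))
      (Measure.infinitePi fun _ : (ℤ × Bool) × ℕ => coinLaw (1 - Real.exp (-(γ * δ))))
      (Measure.infinitePi fun _ : ℤ × ℤ => coinLaw (1 - Real.exp (-(γ * δ)))) :=
    ⟨by fun_prop, Measure.map_infinitePi_infinitePi_of_inj
      (P := fun _ : (ℤ × Bool) × ℕ => coinLaw (1 - Real.exp (-(γ * δ))))
      (f := fun p => (((cellIndex p).1, (cellIndex p).2.1), (cellIndex p).2.2)) fun p q h => by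
        apply cellIndex_injective
        simp only [Prod.mk.injEq] at h
        exact Prod.ext h.1.1 (Prod.ext h.1.2 h.2)⟩
  exact h5.comp (h4.comp (h3.comp (measurePreserving_clocks γ hγ)))

/-! ### Stirring paths -/

section Stirring

variable {T : ℤ → Set ℝ} {path : ℝ → ℤ}

/-- By left limits, right continuity and invariance under the exchanges, the truth value of `Q` is
locally constant along the path, hence constant on a connected interval. The arrivals never have to
be enumerated. -/
theorem IsStirringPath.iff_of_exchange (h : IsStirringPath T path) {a b : ℝ} (hab : a ≤ b) (Q : ℤ → Prop)
    (hQ : ∀ s, a < s → s ≤ b → ∀ y z, Exchange T s y z → (Q y ↔ Q z)) : Q (path a) ↔ Q (path b) := by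
  classical
  have hc : ContinuousOn (fun r => decide (Q (path r))) (Set.Icc a b) := by
    intro s hs
    rw [ContinuousWithinAt, nhds_discrete, tendsto_pure]
    rw [eventually_nhdsWithin_iff, ← nhdsLT_sup_nhdsGE, ← nhdsGT_sup_nhdsWithin_singleton, eventually_sup,
      eventually_sup]
    obtain ⟨⟨y, hy, hex⟩, hr⟩ := h s
    refine ⟨?_, ?_, ?_⟩
    · filter_upwards [hy, self_mem_nhdsWithin] with r hr hrs hrI
      have : a < s := lt_of_le_of_lt hrI.1 hrs
      rw [hr, decide_eq_decide]
      exact hQ s this hs.2 _ _ hex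
    · filter_upwards [hr] with r hr _
      rw [hr]
    · rw [nhdsWithin_singleton, eventually_pure]
      exact fun _ => rfl
  have := isPreconnected_Icc.constant hc (Set.left_mem_Icc.2 hab) (Set.right_mem_Icc.2 hab)
  exact decide_eq_decide.1 this

theorem IsStirringPath.eq_of_silent (h : IsStirringPath T path) {a b : ℝ} (hab : a ≤ b)
    (hs : ∀ s, a < s → s ≤ b → s ∉ T (path a) ∧ s ∉ T (path a - 1)) : path b = path a := by
  refine (h.iff_of_exchange hab (· = path a) fun s h1 h2 y z hex => ?_).1 rfl
  obtain ⟨h3, h4⟩ := hs s h1 h2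
  rcases hex with ⟨h5, h6⟩ | ⟨h5, h6⟩ | ⟨h5, h6, h7⟩
  · constructor
    · rintro rfl; exact absurd h5 h3
    · intro hz
      rw [show y = path a - 1 by omega] at h5
      exact absurd h5 h4
  · constructor
    · rintro rfl; exact absurd h5 h4
    · intro hz
      rw [show y - 1 = path a by omega] at h5
      exact absurd h5 h3
  · rw [h7]

/-- Let the path sit at `y` at the time `a`, and let at most one clock ring near `y` until the
time `b`. Then the path makes the corresponding move. -/
theorem IsStirringPath.eq_of_single_ring (h : IsStirringPath T path) {a b s : ℝ} (has : a < s)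
    (hsb : s < b) (hdis : ∀ x y, x ≠ y → Disjoint (T x) (T y)) {x : ℤ} (hsx : s ∈ T x)
    (hx : x = path a ∨ x = path a - 1)
    (huniq : ∀ x' s', path a - 2 ≤ x' → x' ≤ path a + 1 → s' ∈ T x' → a < s' → s' ≤ b → s' = s) :
    path b = if x = path a then path a + 1 else path a - 1 := by
  have hleft : ∀ r, a ≤ r → r < s → path r = path a := by
    intro r h1 h2
    refine h.eq_of_silent h1 fun s' h3 h4 => ⟨fun h5 => ?_, fun h5 => ?_⟩
    · have := huniq _ s' (by omega) (by omega) h5 h3 (by linarith)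
      linarith
    · have := huniq _ s' (by omega) (by omega) h5 h3 (by linarith)
      linarith
  obtain ⟨⟨y, hy, hex⟩, -⟩ := h s
  have hya : y = path a := by
    have h1 : ∀ᶠ r in 𝓝[<] s, path r = path a := by
      filter_upwards [Ioo_mem_nhdsLT has] with r hr using hleft r hr.1.le hr.2
    obtain ⟨r, h2, h3⟩ := (hy.and h1).exists
    rw [← h2, h3]
  subst hya
  have hnot : ∀ x', x' ≠ x → s ∉ T x' := fun x' hne hmem =>
    Set.disjoint_left.1 (hdis x' x hne) hmem hsx
  have hs : path s = if x = path a then path a + 1 else path a - 1 := by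
    split_ifs with hxa
    · rcases hex with ⟨h5, h6⟩ | ⟨h5, h6⟩ | ⟨h5, h6, h7⟩
      · exact h6
      · exact absurd h5 (hnot _ (by omega))
      · exact absurd (hxa ▸ hsx) h5
    · have hx' : x = path a - 1 := hx.resolve_left hxa
      rcases hex with ⟨h5, h6⟩ | ⟨h5, h6⟩ | ⟨h5, h6, h7⟩
      · exact absurd h5 (hnot _ (by omega))
      · exact h6
      · exact absurd (hx' ▸ hsx) h6
  rw [← hs]
  have hsr : path a - 1 ≤ path s ∧ path s ≤ path a + 1 := by
    rw [hs]; split_ifs <;> omega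
  refine h.eq_of_silent hsb.le fun s' h3 h4 => ⟨fun h5 => ?_, fun h5 => ?_⟩
  · have := huniq _ s' (by omega) (by omega) h5 (by linarith) h4
    linarith
  · have := huniq _ s' (by omega) (by omega) h5 (by linarith) h4
    linarith

/-- Exchange along the edges which ring and whose two neighbours do not ring. -/
def isoSwap (e : ℤ → Bool) (y : ℤ) : ℤ :=
  if e y = true ∧ e (y - 1) = false ∧ e (y + 1) = false then y + 1
  else if e (y - 1) = true ∧ e (y - 2) = false ∧ e y = false then y - 1 else y

/-- This is the reason for discarding rings with a ringing neighbour: without any assumption on `e`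
the result is a permutation of the sites, so the approximation on the mesh preserves the product law
exactly. -/
theorem isoSwap_involutive (e : ℤ → Bool) : Function.Involutive (isoSwap e) := by
  intro y
  unfold isoSwap
  have e1 : y + 1 - 1 = y := by ring
  have e2 : y + 1 - 2 = y - 1 := by ring
  have e3 : y - 1 - 1 = y - 2 := by ring
  have e4 : y - 1 + 1 = y := by ring
  by_cases h1 : e y = true ∧ e (y - 1) = false ∧ e (y + 1) = false
  · simp [h1, e1, e2]
  · by_cases h2 : e (y - 1) = true ∧ e (y - 2) = false ∧ e y = false
    · simp [h2, e3, e4]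
    · simp [h1, h2]

theorem isoSwap_cases (e : ℤ → Bool) (y : ℤ) :
    isoSwap e y = y + 1 ∨ isoSwap e y = y - 1 ∨ isoSwap e y = y := by
  unfold isoSwap
  split_ifs <;> simp

theorem isoSwap_congr {e e' : ℤ → Bool} {y : ℤ} (h : ∀ x, y - 2 ≤ x → x ≤ y + 1 → e x = e' x) :
    isoSwap e y = isoSwap e' y := by
  unfold isoSwap
  rw [h y (by omega) (by omega), h (y - 1) (by omega) (by omega), h (y + 1) (by omega) (by omega),
    h (y - 2) (by omega) (by omega)]

/-- `isoSwap` at `y` inspects only the edges `y - 2, ..., y + 1`. With at most one arrival on these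
during the cell, a ring next to the path is automatically isolated. The endpoint `b` must not be an
arrival, since `e` records only the interior of the cell. -/
theorem IsStirringPath.eq_isoSwap (h : IsStirringPath T path) {a b : ℝ} (hab : a < b)
    (hdis : ∀ x y, x ≠ y → Disjoint (T x) (T y)) (hb : ∀ x, b ∉ T x)
    {e : ℤ → Bool} (he : ∀ x, e x = true ↔ ∃ s ∈ T x, a < s ∧ s < b)
    (huniq : ∀ x s x' s', path a - 2 ≤ x → x ≤ path a + 1 → path a - 2 ≤ x' → x' ≤ path a + 1 →
      s ∈ T x → a < s → s < b → s' ∈ T x' → a < s' → s' < b → s = s') :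
    path b = isoSwap e (path a) := by
  have heq : ∀ x x', path a - 2 ≤ x → x ≤ path a + 1 → path a - 2 ≤ x' → x' ≤ path a + 1 →
      x ≠ x' → e x = true → e x' = false := by
    intro x x' h1 h2 h3 h4 hne hx
    by_contra hx'
    rw [Bool.not_eq_false] at hx'
    obtain ⟨s, hs, hs1, hs2⟩ := (he x).1 hx
    obtain ⟨s', hs', hs1', hs2'⟩ := (he x').1 hx'
    have := huniq x s x' s' h1 h2 h3 h4 hs hs1 hs2 hs' hs1' hs2'
    subst this
    exact Set.disjoint_left.1 (hdis x x' hne) hs hs'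
  have single : ∀ x, (x = path a ∨ x = path a - 1) → e x = true →
      path b = if x = path a then path a + 1 else path a - 1 := by
    intro x hx hex
    obtain ⟨s, hs, hs1, hs2⟩ := (he x).1 hex
    refine h.eq_of_single_ring hs1 hs2 hdis hs hx fun x' s' h1 h2 h3 h4 h5 => ?_
    refine huniq x' s' x s h1 h2 (by omega) (by omega) h3 h4 (lt_of_le_of_ne h5 ?_) hs hs1 hs2
    rintro rfl
    exact hb x' h3
  unfold isoSwap
  by_cases h1 : e (path a) = true
  · rw [if_pos ⟨h1, heq _ _ (by omega) (by omega) (by omega) (by omega) (by omega) h1,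
      heq _ _ (by omega) (by omega) (by omega) (by omega) (by omega) h1⟩, single _ (Or.inl rfl) h1, if_pos rfl]
  · rw [if_neg fun h => h1 h.1]
    by_cases h2 : e (path a - 1) = true
    · rw [if_pos ⟨h2, heq _ _ (by omega) (by omega) (by omega) (by omega) (by omega) h2,
        by simpa using h1⟩, single _ (Or.inr rfl) h2, if_neg (by omega)]
    · rw [if_neg fun h => h2 h.1]
      refine h.eq_of_silent hab.le fun s h3 h4 => ⟨fun h5 => h1 ((he _).2 ⟨s, h5, h3, ?_⟩),
        fun h5 => h2 ((he _).2 ⟨s, h5, h3, ?_⟩)⟩ <;>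
      · refine lt_of_le_of_ne h4 ?_
        rintro rfl
        exact hb _ h5

theorem IsStirringPath.exists_bound (h : IsStirringPath T path) (a b : ℝ) :
    ∃ R : ℤ, ∀ r ∈ Set.Icc a b, |path r| ≤ R := by
  refine isCompact_Icc.induction_on (p := fun s => ∃ R : ℤ, ∀ r ∈ s, |path r| ≤ R) ⟨0, by simp⟩ ?_ ?_ ?_
  · rintro s t hst ⟨R, hR⟩
    exact ⟨R, fun r hr => hR r (hst hr)⟩
  · rintro s t ⟨R, hR⟩ ⟨R', hR'⟩
    refine ⟨max R R', fun r hr => ?_⟩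
    rcases hr with hr | hr
    · exact (hR r hr).trans (le_max_left _ _)
    · exact (hR' r hr).trans (le_max_right _ _)
  · intro s _
    obtain ⟨⟨y, hy, -⟩, hr⟩ := h s
    refine ⟨{r | |path r| ≤ max |y| |path s|}, mem_nhdsWithin_of_mem_nhds ?_, ⟨_, fun r hr => hr⟩⟩
    rw [← nhdsLT_sup_nhdsGE, ← nhdsGT_sup_nhdsWithin_singleton]
    refine mem_sup.2 ⟨?_, mem_sup.2 ⟨?_, ?_⟩⟩
    · filter_upwards [hy] with r hr
      simp [hr]
    · filter_upwards [hr] with r hr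
      simp [hr]
    · rw [nhdsWithin_singleton]
      simp

/-- The properties of the arrival times which hold almost surely. -/
structure GoodArrivals (T : ℤ → Set ℝ) : Prop where
  finite : ∀ (x : ℤ) (M : ℝ), (T x ∩ Set.Icc (-M) M).Finite
  disjoint : ∀ x y, x ≠ y → Disjoint (T x) (T y)
  notMem_rat : ∀ (x : ℤ) (q : ℚ), (q : ℝ) ∉ T x
  silent_left : ∀ k z : ℤ, ∃ x < z, ∀ s ∈ T x, ¬ (k < s ∧ s < k + 1)
  silent_right : ∀ k z : ℤ, ∃ x ≥ z, ∀ s ∈ T x, ¬ (k < s ∧ s < k + 1)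

open Classical in
/-- The indicators of the arrivals in the time cells of length `1 / n`. -/
def cellRings (T : ℤ → Set ℝ) (n : ℕ) (i x : ℤ) : Bool :=
  decide (∃ s ∈ T x, (i : ℝ) / n < s ∧ s < (i + 1 : ℝ) / n)

/-- On a compact time interval the path is bounded, so only finitely many arrivals occur on the
edges near it. Once `1 / n` is below their minimal distance, no cell contains two of them. -/
theorem GoodArrivals.eventually_eq_isoSwap (hT : GoodArrivals T) (h : IsStirringPath T path) (M : ℕ) :
    ∀ᶠ n : ℕ in atTop, ∀ i : ℤ, -(n * M : ℤ) ≤ i → i < n * M →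
      path ((i + 1 : ℝ) / n) = isoSwap (cellRings T n i) (path ((i : ℝ) / n)) := by
  classical
  obtain ⟨R, hR⟩ := h.exists_bound (-M) M
  have hfin : (⋃ x ∈ Set.Icc (-R - 2) (R + 2), T x ∩ Set.Icc (-(M : ℝ)) M).Finite :=
    (Set.finite_Icc _ _).biUnion fun x _ => hT.finite x M
  set F := hfin.toFinset with hF
  have hgap : ∀ᶠ n : ℕ in atTop, ∀ p ∈ F.offDiag, (1 : ℝ) / n < |p.1 - p.2| := by
    rw [eventually_all_finset]
    intro p hp
    have : 0 < |p.1 - p.2| := abs_pos.2 (sub_ne_zero.2 (Finset.mem_offDiag.1 hp).2.2)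
    exact tendsto_one_div_atTop_nhds_zero_nat.eventually (gt_mem_nhds this)
  filter_upwards [hgap, eventually_ge_atTop 1] with n hn hn1 i hi1 hi2
  have hn0 : (0 : ℝ) < n := by exact_mod_cast hn1
  have hMi : -(M : ℝ) ≤ (i : ℝ) / n := by
    rw [le_div_iff₀ hn0]
    have : (-(n * M : ℤ) : ℝ) ≤ i := by exact_mod_cast hi1
    push_cast at this
    linarith
  have hMi' : (i + 1 : ℝ) / n ≤ M := by
    rw [div_le_iff₀ hn0]
    have : ((i + 1 : ℤ) : ℝ) ≤ (n * M : ℤ) := by exact_mod_cast hi2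
    push_cast at this
    linarith
  have hlt : (i : ℝ) / n < (i + 1 : ℝ) / n := by gcongr; linarith
  have hpath := abs_le.1 (hR ((i : ℝ) / n) ⟨hMi, hlt.le.trans hMi'⟩)
  refine h.eq_isoSwap hlt hT.disjoint (fun x hx => ?_) (fun x => by simp [cellRings]) ?_
  · refine hT.notMem_rat x ((i + 1 : ℚ) / n) ?_
    push_cast
    exact hx
  · intro x s x' s' h1 h2 h3 h4 hs hs1 hs2 hs' hs1' hs2'
    by_contra hne
    have hmem : ∀ x s, path ((i : ℝ) / n) - 2 ≤ x → x ≤ path ((i : ℝ) / n) + 1 → s ∈ T x →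
        (i : ℝ) / n < s → s < (i + 1 : ℝ) / n → s ∈ F := by
      intro x s h1 h2 hs hs1 hs2
      rw [hF, Set.Finite.mem_toFinset]
      exact Set.mem_biUnion (x := x) ⟨by omega, by omega⟩ ⟨hs, by linarith, by linarith⟩
    have := hn (s, s') (Finset.mem_offDiag.2 ⟨hmem x s h1 h2 hs hs1 hs2, hmem x' s' h3 h4 hs' hs1' hs2', hne⟩)
    have h5 : (i + 1 : ℝ) / n - i / n = 1 / n := by ring
    rw [lt_abs] at this
    dsimp only at this
    rcases this with h | h <;> linarith

end Stirring

/-! ### The flow of the exchanges -/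

/-- The flow of the exchanges with the rows `r` of rings, for the time cells after the time `0`. -/
def flowPos (r : ℤ × ℤ → Bool) : ℕ → ℤ → ℤ
  | 0 => id
  | k + 1 => fun y => flowPos r k (isoSwap (fun x => r (k, x)) y)

/-- The same for the time cells before the time `0`. -/
def flowNeg (r : ℤ × ℤ → Bool) : ℕ → ℤ → ℤ
  | 0 => id
  | k + 1 => fun y => flowNeg r k (isoSwap (fun x => r (-(k + 1 : ℤ), x)) y)

/-- The flow of the exchanges: the content of the site `y` at the beginning of the time cell `b` is the
content of the site `flow r b y` at the time `0`. -/
def flow (r : ℤ × ℤ → Bool) : ℤ → ℤ → ℤ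
  | Int.ofNat k => flowPos r k
  | Int.negSucc k => flowNeg r (k + 1)

theorem flow_zero (r : ℤ × ℤ → Bool) (y : ℤ) : flow r 0 y = y := rfl

theorem flow_neg_natCast (r : ℤ × ℤ → Bool) (k : ℕ) : flow r (-(k : ℤ)) = flowNeg r k := by
  cases k with
  | zero => rfl
  | succ k => rfl

/-- The involution property gives the same recursion on both sides of time 0. -/
theorem flow_succ (r : ℤ × ℤ → Bool) (b : ℤ) (y : ℤ) :
    flow r (b + 1) y = flow r b (isoSwap (fun x => r (b, x)) y) := by
  cases b with
  | ofNat k => rfl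
  | negSucc k =>
    have h1 : Int.negSucc k + 1 = -(k : ℤ) := by omega
    have h2 : Int.negSucc k = -(k + 1 : ℤ) := by omega
    rw [h1, flow_neg_natCast, h2]
    change _ = flowNeg r (k + 1) _
    rw [flowNeg]
    dsimp only
    rw [isoSwap_involutive]

/-- Injectivity is what makes the configuration transported by the flow i.i.d. again. -/
theorem flow_injective (r : ℤ × ℤ → Bool) (b : ℤ) : Function.Injective (flow r b) := by
  have hiso : ∀ b : ℤ, Function.Bijective (isoSwap fun x => r (b, x)) := fun b =>
    (isoSwap_involutive _).bijective
  induction b using Int.induction_on with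
  | zero => exact Function.injective_id
  | succ k ih =>
    have : flow r (k + 1) = flow r k ∘ isoSwap fun x => r (k, x) := funext fun y => flow_succ r k y
    rw [this]
    exact ih.comp (hiso _).1
  | pred k ih =>
    have : flow r (-k) = flow r (-k - 1) ∘ isoSwap fun x => r (-k - 1, x) := funext fun y => by
      have := flow_succ r (-k - 1) y
      rwa [sub_add_cancel] at this
    rw [this] at ih
    exact (Function.Injective.of_comp_iff' _ (hiso _)).1 ih

/-- Cell by cell, the flow and the path perform the same exchange, so the flow evaluated along the
path does not change with time; at time 0 it is the identity. -/
theorem GoodArrivals.eventually_flow {T : ℤ → Set ℝ} {path : ℝ → ℤ} (hT : GoodArrivals T)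
    (h : IsStirringPath T path) (s : ℤ) :
    ∀ᶠ n : ℕ in atTop, flow (fun p => cellRings T n p.1 p.2) (n * s) (path s) = path 0 := by
  obtain ⟨N, hs⟩ := s.eq_nat_or_neg
  filter_upwards [hT.eventually_eq_isoSwap h N, eventually_ge_atTop 1] with n hn hn1
  have hn0 : (n : ℝ) ≠ 0 := by positivity
  set r : ℤ × ℤ → Bool := fun p => cellRings T n p.1 p.2 with hr
  have step : ∀ b : ℤ, -(n * N : ℤ) ≤ b → b < n * N →
      flow r (b + 1) (path ((b + 1 : ℝ) / n)) = flow r b (path ((b : ℝ) / n)) := by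
    intro b h1 h2
    rw [flow_succ, hn b h1 h2]
    exact congrArg _ (isoSwap_involutive _ _)
  have hp : ∀ k : ℕ, (k : ℤ) ≤ n * N → flow r k (path ((k : ℝ) / n)) = path 0 := by
    intro k
    induction k with
    | zero => intro _; simp [flow_zero]
    | succ k ih =>
      intro hk
      push_cast at hk ⊢
      have := step k (by omega) (by omega)
      push_cast at this
      rw [this, ih (by omega)]
  have hm : ∀ k : ℕ, (k : ℤ) ≤ n * N → flow r (-(k : ℤ)) (path ((-(k : ℝ)) / n)) = path 0 := by
    intro k
    induction k with
    | zero => intro _; simp [flow_zero]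
    | succ k ih =>
      intro hk
      push_cast at hk
      have := step (-(k + 1 : ℕ)) (by push_cast; omega) (by push_cast; omega)
      rw [← ih (by omega)]
      push_cast at this ⊢
      rw [← this]
      ring_nf
  rcases hs with rfl | rfl
  · have := hp (n * N) (by push_cast; rfl)
    push_cast at this ⊢
    rwa [mul_div_cancel_left₀ _ hn0] at this
  · have := hm (n * N) (by push_cast; rfl)
    push_cast at this ⊢
    rw [neg_div, mul_div_cancel_left₀ _ hn0] at this
    rwa [mul_neg]

/-! ### Existence of stirring paths -/

section Existence

variable {T : ℤ → Set ℝ}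

theorem exchange_self {s : ℝ} {y : ℤ} (h : ∀ x, s ∉ T x) : Exchange T s y y := Or.inr (Or.inr ⟨h _, h _, rfl⟩)

theorem Exchange.eq_of_notMem {s : ℝ} {y z : ℤ} (h : ∀ x, s ∉ T x) (hex : Exchange T s y z) : z = y := by
  rcases hex with ⟨h5, -⟩ | ⟨h5, -⟩ | ⟨-, -, h7⟩
  · exact absurd h5 (h _)
  · exact absurd h5 (h _)
  · exact h7

theorem Exchange.congr {T' : ℤ → Set ℝ} {s : ℝ} {y z : ℤ} (h : ∀ x, s ∈ T x ↔ s ∈ T' x)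
    (hex : Exchange T s y z) : Exchange T' s y z := by
  simpa only [Exchange, h] using hex

open Classical in
/-- The effect of the arrivals at time `s`, as a function. -/
def exchangeAt (T : ℤ → Set ℝ) (s : ℝ) (y : ℤ) : ℤ :=
  if s ∈ T y then y + 1 else if s ∈ T (y - 1) then y - 1 else y

theorem exchange_exchangeAt (s : ℝ) (y : ℤ) : Exchange T s y (exchangeAt T s y) := by
  unfold exchangeAt
  split_ifs with h1 h2
  · exact Or.inl ⟨h1, rfl⟩
  · exact Or.inr (Or.inl ⟨h2, rfl⟩)
  · exact Or.inr (Or.inr ⟨h1, h2, rfl⟩)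

theorem exchangeAt_involutive (hdis : ∀ x y, x ≠ y → Disjoint (T x) (T y)) (s : ℝ) :
    Function.Involutive (exchangeAt T s) := by
  intro y
  have hne : ∀ x y, x ≠ y → s ∈ T x → s ∉ T y := fun x y h h1 h2 => Set.disjoint_left.1 (hdis x y h) h1 h2
  unfold exchangeAt
  have e1 : y + 1 - 1 = y := by ring
  have e2 : y - 1 + 1 = y := by ring
  by_cases h1 : s ∈ T y
  · simp [h1, hne y (y + 1) (by omega) h1]
  · by_cases h2 : s ∈ T (y - 1)
    · simp [h1, h2]
    · simp [h1, h2]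

/-- Induction on the last arrival `s`: take a path for the earlier arrivals and apply the exchange
at `s` from that time on. -/
theorem exists_stirringPath_of_finite (F : Finset ℝ) : ∀ (T : ℤ → Set ℝ), (∀ x, T x ⊆ F) →
    (∀ x y, x ≠ y → Disjoint (T x) (T y)) → ∀ (a : ℝ) (z : ℤ), ∃ path, IsStirringPath T path ∧ path a = z := by
  induction F using Finset.induction_on_max with
  | empty =>
    intro T hT _ a z
    refine ⟨fun _ => z, fun s => ⟨⟨z, by simp, exchange_self fun x hx => ?_⟩, by simp⟩, rfl⟩
    simpa using hT x hx
  | insert s F hs ih =>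
    intro T hT hdis a z
    set T' : ℤ → Set ℝ := fun x => T x \ {s} with hT'
    have hT'F : ∀ x, T' x ⊆ F := fun x u hu => by
      have := hT x hu.1
      rw [Finset.coe_insert] at this
      exact this.resolve_left hu.2
    -- If `a` is not before `s`, the prescribed value is first pulled back through the exchange at
    -- `s`, which is its own inverse.
    obtain ⟨p, hp, hpa⟩ := ih T' hT'F (fun x y h => (hdis x y h).mono Set.sdiff_subset Set.sdiff_subset)
      a (if a < s then z else exchangeAt T s z)
    have hsT' : ∀ x, s ∉ T' x := fun x hx => hx.2 rfl
    have hmem : ∀ u, u ≠ s → ∀ x, u ∈ T' x ↔ u ∈ T x := fun u hu x => by simp [hT', hu]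
    have hafter : ∀ u, s < u → ∀ x, u ∉ T x := fun u hu x hx => by
      have := hT'F x ((hmem u hu.ne' x).2 hx)
      linarith [hs u this]
    refine ⟨fun r => if r < s then p r else exchangeAt T s (p r), fun u => ?_, ?_⟩
    · obtain ⟨⟨y, hy, hex⟩, hr⟩ := hp u
      rcases lt_trichotomy u s with hus | rfl | hus
      · refine ⟨⟨y, ?_, ?_⟩, ?_⟩
        · filter_upwards [hy, self_mem_nhdsWithin] with r hr hru
          rw [if_pos (lt_trans hru hus), hr]
        · dsimp only
          rw [if_pos hus]
          exact hex.congr (hmem u hus.ne)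
        · filter_upwards [hr, mem_nhdsWithin_of_mem_nhds (Iio_mem_nhds hus)] with r hr hru
          rw [if_pos (show r < s from hru), if_pos hus, hr]
      · refine ⟨⟨y, ?_, ?_⟩, ?_⟩
        · filter_upwards [hy, self_mem_nhdsWithin] with r hr hru
          rw [if_pos (show r < u from hru), hr]
        · dsimp only
          rw [if_neg (lt_irrefl u), hex.eq_of_notMem hsT']
          exact exchange_exchangeAt u y
        · filter_upwards [hr, self_mem_nhdsWithin] with r hr hru
          rw [if_neg (not_lt.2 (le_of_lt hru)), if_neg (lt_irrefl u), hr]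
      · refine ⟨⟨exchangeAt T s y, ?_, ?_⟩, ?_⟩
        · filter_upwards [hy, mem_nhdsWithin_of_mem_nhds (Ioi_mem_nhds hus)] with r hr hru
          rw [if_neg (not_lt.2 (le_of_lt hru)), hr]
        · dsimp only
          rw [if_neg (not_lt.2 hus.le), hex.eq_of_notMem fun x hx => hafter u hus x ((hmem u hus.ne' x).1 hx)]
          exact exchange_self (hafter u hus)
        · filter_upwards [hr, self_mem_nhdsWithin] with r hr hru
          rw [if_neg (not_lt.2 (hus.le.trans (le_of_lt hru))), if_neg (not_lt.2 hus.le), hr]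
    · dsimp only
      rw [hpa]
      split_ifs with h
      · rfl
      · exact exchangeAt_involutive hdis s z

/-- A stirring path in the time slab `[k, k + 1]`. -/
structure IsSlabPath (T : ℤ → Set ℝ) (k : ℤ) (f : ℝ → ℤ) : Prop where
  interior : ∀ s : ℝ, k < s → s < k + 1 → (∃ y : ℤ, (∀ᶠ r in 𝓝[<] s, f r = y) ∧ Exchange T s y (f s)) ∧
    ∀ᶠ r in 𝓝[>] s, f r = f s
  left : ∀ᶠ r in 𝓝[>] (k : ℝ), f r = f k
  right : ∀ᶠ r in 𝓝[<] (k + 1 : ℝ), f r = f (k + 1)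

/-- In a unit of time there are silent edges `A` and `B` on both sides of `z`. Between them only
finitely many arrivals matter, and a path for these is confined to the sites in `(A, B]`. -/
theorem GoodArrivals.exists_slabPath (hT : GoodArrivals T) (k : ℤ) (a : ℝ) (z : ℤ) :
    ∃ f, IsSlabPath T k f ∧ f a = z := by
  classical
  obtain ⟨A, hAz, hA⟩ := hT.silent_left k z
  obtain ⟨B, hBz, hB⟩ := hT.silent_right k z
  set T' : ℤ → Set ℝ := fun x => if A < x ∧ x < B then T x ∩ Set.Ioo (k : ℝ) (k + 1) else ∅ with hT'
  have hmem : ∀ x s, s ∈ T' x ↔ (A < x ∧ x < B) ∧ s ∈ T x ∧ (k : ℝ) < s ∧ s < k + 1 := by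
    intro x s
    simp only [hT']
    split_ifs with h <;> simp [h]
  have hfin : (⋃ x ∈ Set.Ioo A B, T x ∩ Set.Icc (-(|(k : ℝ)| + 1)) (|(k : ℝ)| + 1)).Finite :=
    (Set.finite_Ioo _ _).biUnion fun x _ => hT.finite x _
  obtain ⟨f, hf, hfa⟩ := exists_stirringPath_of_finite hfin.toFinset T' (fun x s hs => by
      obtain ⟨h1, h2, h3, h4⟩ := (hmem x s).1 hs
      rw [Set.Finite.coe_toFinset]
      have := neg_abs_le (k : ℝ)
      have := le_abs_self (k : ℝ)
      exact Set.mem_biUnion (x := x) h1 ⟨h2, by linarith, by linarith⟩)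
    (fun x y h => Set.disjoint_left.2 fun s h1 h2 =>
      Set.disjoint_left.1 (hT.disjoint x y h) ((hmem x s).1 h1).2.1 ((hmem y s).1 h2).2.1) a z
  have hQ : ∀ r, A < f r ∧ f r ≤ B := by
    have hQ' : ∀ s y z, Exchange T' s y z → ((A < y ∧ y ≤ B) ↔ (A < z ∧ z ≤ B)) := by
      intro s y z hex
      rcases hex with ⟨h5, h6⟩ | ⟨h5, h6⟩ | ⟨h5, h6, h7⟩
      · have := ((hmem y s).1 h5).1
        omega
      · have := ((hmem (y - 1) s).1 h5).1
        omega
      · rw [h7]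
    have hfa' : A < f a ∧ f a ≤ B := by rw [hfa]; exact ⟨hAz, hBz⟩
    intro r
    rcases le_total a r with h | h
    · exact (hf.iff_of_exchange h (fun y => A < y ∧ y ≤ B) fun s _ _ => hQ' s).1 hfa'
    · exact (hf.iff_of_exchange h (fun y => A < y ∧ y ≤ B) fun s _ _ => hQ' s).2 hfa'
  refine ⟨f, ⟨fun s h1 h2 => ?_, (hf k).2, ?_⟩, hfa⟩
  · obtain ⟨⟨y, hy, hex⟩, hr⟩ := hf s
    refine ⟨⟨y, hy, ?_⟩, hr⟩
    obtain ⟨r, rfl⟩ := hy.exists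
    obtain ⟨hQ1, hQ2⟩ := hQ r
    rcases hex with ⟨h5, h6⟩ | ⟨h5, h6⟩ | ⟨h5, h6, h7⟩
    · exact Or.inl ⟨((hmem _ s).1 h5).2.1, h6⟩
    · exact Or.inr (Or.inl ⟨((hmem _ s).1 h5).2.1, h6⟩)
    · refine Or.inr (Or.inr ⟨fun h => ?_, fun h => ?_, h7⟩)
      · rcases hQ2.lt_or_eq with h8 | h8
        · exact h5 ((hmem _ s).2 ⟨⟨hQ1, h8⟩, h, h1, h2⟩)
        · exact hB s (h8 ▸ h) ⟨h1, h2⟩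
      · rcases (show A ≤ f r - 1 by omega).lt_or_eq with h8 | h8
        · exact h6 ((hmem _ s).2 ⟨⟨h8, by omega⟩, h, h1, h2⟩)
        · exact hA s (h8 ▸ h) ⟨h1, h2⟩
  · obtain ⟨⟨y, hy, hex⟩, -⟩ := hf (k + 1)
    have := hex.eq_of_notMem fun x hx => absurd ((hmem _ _).1 hx).2.2.2 (lt_irrefl _)
    rw [this]
    exact hy

theorem exists_int_sequence {Rel : ℤ → ℤ → ℤ → Prop} (hf : ∀ k z, ∃ z', Rel k z z')
    (hb : ∀ k z', ∃ z, Rel k z z') (s y : ℤ) : ∃ p : ℤ → ℤ, p s = y ∧ ∀ k, Rel k (p k) (p (k + 1)) := by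
  choose F hF using hf
  choose G hG using hb
  let fp : ℕ → ℤ := fun j => Nat.rec y (fun j z => F (s + j) z) j
  let gp : ℕ → ℤ := fun j => Nat.rec y (fun j z => G (s - j - 1) z) j
  refine ⟨fun k => if s ≤ k then fp (k - s).toNat else gp (s - k).toNat, by simp [fp], fun k => ?_⟩
  dsimp only
  by_cases hk : s ≤ k
  · obtain ⟨j, rfl⟩ : ∃ j : ℕ, k = s + j := ⟨(k - s).toNat, by omega⟩
    rw [if_pos hk, if_pos (by omega), show (s + j - s).toNat = j by omega,
      show (s + j + 1 - s).toNat = j + 1 by omega]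
    exact hF (s + j) (fp j)
  · obtain ⟨j, rfl⟩ : ∃ j : ℕ, k = s - j - 1 := ⟨(s - k - 1).toNat, by omega⟩
    have e : (if s ≤ s - j - 1 + 1 then fp (s - j - 1 + 1 - s).toNat else gp (s - (s - j - 1 + 1)).toNat) = gp j := by
      split_ifs with h
      · have : j = 0 := by omega
        subst this
        simp [fp, gp]
      · congr 1
        omega
    rw [if_neg hk, e, show (s - (s - j - 1)).toNat = j + 1 by omega]
    exact hG (s - j - 1) (gp j)

/-- Slab paths are glued at integer times, which are never arrivals, so that no exchange takes place
at a junction. -/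
theorem GoodArrivals.exists_stirringPath (hT : GoodArrivals T) (s y : ℤ) :
    ∃ path, IsStirringPath T path ∧ path s = y := by
  obtain ⟨p, hps, hp⟩ := exists_int_sequence
    (Rel := fun k z z' => ∃ f, IsSlabPath T k f ∧ f k = z ∧ f (k + 1) = z')
    (fun k z => by
      obtain ⟨f, hf, hfz⟩ := hT.exists_slabPath k k z
      exact ⟨_, f, hf, hfz, rfl⟩)
    (fun k z => by
      obtain ⟨f, hf, hfz⟩ := hT.exists_slabPath k (k + 1) z
      exact ⟨_, f, hf, rfl, hfz⟩) s y
  choose f hf hf0 hf1 using hp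
  refine ⟨fun r => f ⌊r⌋ r, fun u => ?_, by simp [hf0, hps]⟩
  dsimp only
  rcases (Int.floor_le u).lt_or_eq with hu | hu
  · have hnear : ∀ᶠ r in 𝓝 u, ⌊r⌋ = ⌊u⌋ := by
      filter_upwards [Ioo_mem_nhds hu (Int.lt_floor_add_one u)] with r hr
      exact Int.floor_eq_iff.2 ⟨hr.1.le, hr.2⟩
    obtain ⟨⟨y, hy, hex⟩, hr⟩ := (hf ⌊u⌋).interior u hu (Int.lt_floor_add_one u)
    refine ⟨⟨y, ?_, hex⟩, ?_⟩
    · filter_upwards [hy, mem_nhdsWithin_of_mem_nhds hnear] with r hr hru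
      rw [hru, hr]
    · filter_upwards [hr, mem_nhdsWithin_of_mem_nhds hnear] with r hr hru
      rw [hru, hr]
  · set k := ⌊u⌋ with hk
    have hu' : u = k := hu.symm
    refine ⟨⟨p k, ?_, ?_⟩, ?_⟩
    · have h1 := (hf (k - 1)).right
      have e : ((k - 1 : ℤ) : ℝ) + 1 = k := by push_cast; ring
      rw [e] at h1
      rw [hu']
      have hlt : (k - 1 : ℝ) < k := by linarith
      have h2 := hf1 (k - 1)
      rw [e, sub_add_cancel] at h2
      filter_upwards [h1, Ioo_mem_nhdsLT hlt] with r hr hru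
      have : ⌊r⌋ = k - 1 := Int.floor_eq_iff.2 ⟨by push_cast; exact hru.1.le, by push_cast; linarith [hru.2]⟩
      rw [this, hr, h2]
    · rw [hu', hf0]
      exact exchange_self fun x hx => hT.notMem_rat x k (by simpa using hx)
    · have h1 := (hf k).left
      rw [hu']
      have hlt : (k : ℝ) < k + 1 := by linarith
      filter_upwards [h1, Ioo_mem_nhdsGT hlt] with r hr hru
      have : ⌊r⌋ = k := Int.floor_eq_iff.2 ⟨hru.1.le, hru.2⟩
      rw [this, hr]

end Existence

/-- The flow on a fine mesh computes the site at time 0 of every stirring path through `(s, y)`, so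
all of them start from the same site and the existential in `ssepField` is unambiguous. The mesh
size needed does not depend on `ζ`. -/
theorem GoodArrivals.exists_ssepField {τ : ℤ × Bool × ℕ → ℝ} (hT : GoodArrivals (arrivals τ)) (s y : ℤ) :
    ∀ᶠ n : ℕ in atTop, ∀ ζ : ℤ → Bool,
      (0 < ssepField (ζ, τ) s y ↔
        ζ (flow (fun p => cellRings (arrivals τ) n p.1 p.2) (n * s) y) = true) := by
  obtain ⟨path, hpath, hy⟩ := hT.exists_stirringPath s y
  have key : ∀ path', IsStirringPath (arrivals τ) path' → path' s = y → path' 0 = path 0 := by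
    intro path' h' hy'
    obtain ⟨n, h1, h2⟩ := ((hT.eventually_flow hpath s).and (hT.eventually_flow h' s)).exists
    rw [← h1, ← h2, hy, hy']
  filter_upwards [hT.eventually_flow hpath s] with n hn ζ
  rw [hy] at hn
  rw [hn]
  simp only [ssepField]
  constructor
  · intro h
    split_ifs at h with hex
    · obtain ⟨path', h1, h2, h3⟩ := hex
      rw [← key path' h1 h2]
      exact h3
    · simp at h
  · intro h
    rw [if_pos ⟨path, hpath, hy, h⟩]
    exact one_pos

/-! ### The arrival times are almost surely good -/

/-- Resampling the coordinate `i` alone shows that it is independent of `g`, and an atomless law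
gives no mass to a fixed value of `g`. -/
theorem ae_ne_of_dependsOn_compl {ι : Type*} (ν : Measure ℝ) [IsProbabilityMeasure ν] [NullSingletonClass ν] (i : ι)
    {g : (ι → ℝ) → ℝ} (hg : Measurable g) (hgi : DependsOn g {i}ᶜ) :
    ∀ᵐ τ ∂(Measure.infinitePi fun _ : ι => ν), τ i ≠ g τ := by
  set μ := Measure.infinitePi fun _ : ι => ν with hμ
  have hmeas : MeasurableSet {τ : ι → ℝ | τ i = g τ} := measurableSet_eq_fun (by fun_prop) hg
  have hmeas' : MeasurableSet {p : (ι → ℝ) × (ι → ℝ) | p.1 i = g p.2} :=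
    measurableSet_eq_fun (by fun_prop) (by fun_prop)
  have h1 : μ {τ | τ i = g τ} = (μ.prod μ) {p | p.1 i = g p.2} := by
    rw [← (measurePreserving_mixPi (fun _ : ι => ν) {i}).measure_preimage hmeas.nullMeasurableSet]
    congr 1
    ext p
    have e1 : mixPi {i} p i = p.1 i := mixPi_of_mem rfl p
    have e2 : g (mixPi {i} p) = g p.2 := hgi fun j hj => mixPi_of_notMem hj p
    simp only [Set.mem_preimage, Set.mem_ofPred_eq, e1, e2]
  have h2 : μ {τ | τ i = g τ} = 0 := by
    rw [h1, Measure.prod_apply_symm hmeas', lintegral_eq_zero_iff' (measurable_measure_prodMk_right hmeas').aemeasurable]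
    refine Eventually.of_forall fun σ => ?_
    have : (fun τ : ι → ℝ => (τ, σ)) ⁻¹' {p | p.1 i = g p.2} = (fun τ : ι → ℝ => τ i) ⁻¹' {g σ} := by
      ext τ
      simp
    dsimp only [Pi.zero_apply]
    rw [this, (measurePreserving_eval_infinitePi (fun _ : ι => ν) i).measure_preimage
      (measurableSet_singleton _).nullMeasurableSet, measure_singleton]
  rw [ae_iff]
  simpa using h2

/-- The waiting times of one of the two one-sided clocks of the edge `x`. -/
def clock (τ : ℤ × Bool × ℕ → ℝ) (x : ℤ) (b : Bool) (j : ℕ) : ℝ := τ (x, b, j)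

theorem mem_arrivals {τ : ℤ × Bool × ℕ → ℝ} {x : ℤ} {s : ℝ} : s ∈ arrivals τ x ↔
    (∃ n, s = arrivalTime (clock τ x true) n) ∨ ∃ n, s = -arrivalTime (clock τ x false) n := Iff.rfl

section

variable {γ : ℝ} (hγ : 0 < γ)

include hγ

theorem ae_clock_good : ∀ᵐ τ ∂(Measure.infinitePi fun _ : ℤ × Bool × ℕ => expMeasure γ),
    ∀ x b, (∀ i, 0 < clock τ x b i) ∧ Tendsto (arrivalTime (clock τ x b)) atTop atTop := by
  have := isProbabilityMeasure_expMeasure hγ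
  have h1 : ∀ᵐ c ∂(Measure.infinitePi fun _ : ℤ × Bool => clockLaw γ),
      ∀ e, c e ∈ {τ : ℕ → ℝ | (∀ i, 0 < τ i) ∧ Tendsto (arrivalTime τ) atTop atTop} := by
    refine ae_forall_mem ?_
    filter_upwards [ae_clock_pos hγ, ae_clock_frequently hγ] with τ h0 h1
    exact ⟨h0, tendsto_arrivalTime h0 h1⟩
  filter_upwards [(measurePreserving_clocks γ hγ).quasiMeasurePreserving.ae h1] with τ h x b
  exact h (x, b)

omit hγ in
theorem nullSingletonClass_expMeasure : NullSingletonClass (expMeasure γ) := by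
  unfold expMeasure gammaMeasure
  infer_instance

theorem ae_arrivalTime_ne_rat : ∀ᵐ τ ∂(Measure.infinitePi fun _ : ℤ × Bool × ℕ => expMeasure γ),
    ∀ x b n, ∀ q : ℚ, arrivalTime (clock τ x b) n ≠ q := by
  have := isProbabilityMeasure_expMeasure hγ
  have := nullSingletonClass_expMeasure (γ := γ)
  simp only [ae_all_iff]
  intro x b n q
  have := ae_ne_of_dependsOn_compl (expMeasure γ) (x, b, n)
    (g := fun τ => q - ∑ i ∈ Finset.range n, τ (x, b, i)) (by fun_prop) fun τ σ h => by
      dsimp only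
      congr 1
      refine Finset.sum_congr rfl fun i hi => h _ ?_
      simp at hi ⊢
      omega
  filter_upwards [this] with τ h h'
  apply h
  rw [arrivalTime, Finset.sum_range_succ] at h'
  rw [← h']
  simp [clock]

theorem ae_arrivalTime_ne : ∀ᵐ τ ∂(Measure.infinitePi fun _ : ℤ × Bool × ℕ => expMeasure γ),
    ∀ x y b n m, x ≠ y → arrivalTime (clock τ x b) n ≠ arrivalTime (clock τ y b) m := by
  have := isProbabilityMeasure_expMeasure hγ
  have := nullSingletonClass_expMeasure (γ := γ)
  simp only [ae_all_iff]
  intro x y b n m hxy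
  have := ae_ne_of_dependsOn_compl (expMeasure γ) (x, b, n)
    (g := fun τ => (∑ i ∈ Finset.range (m + 1), τ (y, b, i)) - ∑ i ∈ Finset.range n, τ (x, b, i))
    (by fun_prop) fun τ σ h => by
      dsimp only
      congr 1
      · refine Finset.sum_congr rfl fun i hi => h _ ?_
        simp [hxy.symm]
      · refine Finset.sum_congr rfl fun i hi => h _ ?_
        simp at hi ⊢
        omega
  filter_upwards [this] with τ h h'
  apply h
  rw [arrivalTime, Finset.sum_range_succ] at h'
  change _ = arrivalTime (clock τ y b) m - _
  rw [← h']
  simp [clock]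

/-- Open cells for the arrivals and half-open cells for the clocks differ only at rational
endpoints, which are almost surely not arrivals. Backwards clocks are read with reversed sign. -/
theorem ae_cellRings_eq : ∀ᵐ τ ∂(Measure.infinitePi fun _ : ℤ × Bool × ℕ => expMeasure γ),
    ∀ n : ℕ, 1 ≤ n → ∀ i x, cellRings (arrivals τ) n i x = rings (1 / n) τ (i, x) := by
  filter_upwards [ae_clock_good hγ, ae_arrivalTime_ne_rat hγ] with τ h0 h1 n hn i x
  have hn0 : (0 : ℝ) < n := by exact_mod_cast hn
  have hS : ∀ x b k, 0 < arrivalTime (clock τ x b) k := fun x b k =>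
    Finset.sum_pos (fun i _ => (h0 x b).1 i) (by simp)
  have hne : ∀ x b k (j : ℕ), arrivalTime (clock τ x b) k ≠ (j + 1) * (1 / n) := fun x b k j => by
    have := h1 x b k ((j + 1) * (1 / n))
    push_cast at this
    exact this
  unfold cellRings rings ringSeq
  rw [decide_eq_decide]
  cases i with
  | ofNat j =>
    simp only [cellIndex, RingsIn, mem_arrivals]
    change _ ↔ ∃ k, _ < arrivalTime (clock τ x true) k ∧ arrivalTime (clock τ x true) k ≤ _
    constructor
    · rintro ⟨s, ⟨k, rfl⟩ | ⟨k, rfl⟩, h2, h3⟩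
      · refine ⟨k, ?_, ?_⟩
        · simpa [div_eq_mul_inv] using h2
        · simpa [div_eq_mul_inv] using h3.le
      · have : (0 : ℝ) ≤ ((Int.ofNat j : ℤ) : ℝ) / n := by simp; positivity
        linarith [hS x false k]
    · rintro ⟨k, h2, h3⟩
      refine ⟨_, Or.inl ⟨k, rfl⟩, ?_, ?_⟩
      · simpa [div_eq_mul_inv] using h2
      · simpa [div_eq_mul_inv] using lt_of_le_of_ne h3 (hne x true k j)
  | negSucc j =>
    simp only [cellIndex, RingsIn, mem_arrivals]
    change _ ↔ ∃ k, _ < arrivalTime (clock τ x false) k ∧ arrivalTime (clock τ x false) k ≤ _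
    have e1 : ((Int.negSucc j : ℤ) : ℝ) / n = -((j + 1) * (1 / n)) := by
      rw [Int.cast_negSucc]; push_cast; ring
    have e2 : (((Int.negSucc j : ℤ) : ℝ) + 1) / n = -(j * (1 / n)) := by
      rw [Int.cast_negSucc]; push_cast; ring
    rw [e1, e2]
    constructor
    · rintro ⟨s, ⟨k, rfl⟩ | ⟨k, rfl⟩, h2, h3⟩
      · have : (0 : ℝ) ≤ j * (1 / n) := by positivity
        linarith [hS x true k]
      · exact ⟨k, by linarith, by linarith⟩
    · rintro ⟨k, h2, h3⟩
      exact ⟨_, Or.inr ⟨k, rfl⟩, by linarith [lt_of_le_of_ne h3 (hne x false k j)], by linarith⟩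

theorem ae_silent {f : ℕ → ℤ × ℤ} (hf : Function.Injective f) :
    ∀ᵐ τ ∂(Measure.infinitePi fun _ : ℤ × Bool × ℕ => expMeasure γ), ∃ j, rings 1 τ (f j) = false := by
  have := isProbabilityMeasure_ringCoin hγ one_pos
  have h := ae_frequently_of_pos (coinLaw (1 - Real.exp (-(γ * 1)))) (E := {false})
    (MeasurableSet.of_discrete) ?_ hf
  · filter_upwards [(measurePreserving_rings hγ one_pos).quasiMeasurePreserving.ae h] with τ h
    exact h.exists
  · simp [coinLaw, Real.exp_pos]

theorem ae_goodArrivals : ∀ᵐ τ ∂(Measure.infinitePi fun _ : ℤ × Bool × ℕ => expMeasure γ),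
    GoodArrivals (arrivals τ) := by
  have hl : ∀ᵐ τ ∂(Measure.infinitePi fun _ : ℤ × Bool × ℕ => expMeasure γ),
      ∀ k z : ℤ, ∃ j : ℕ, rings 1 τ (k, z - 1 - j) = false := by
    simp only [ae_all_iff]
    exact fun k z => ae_silent hγ (f := fun j => (k, z - 1 - j)) fun i j h => by simpa using h
  have hr : ∀ᵐ τ ∂(Measure.infinitePi fun _ : ℤ × Bool × ℕ => expMeasure γ),
      ∀ k z : ℤ, ∃ j : ℕ, rings 1 τ (k, z + j) = false := by
    simp only [ae_all_iff]
    exact fun k z => ae_silent hγ (f := fun j => (k, z + j)) fun i j h => by simpa using h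
  filter_upwards [hl, hr, ae_clock_good hγ, ae_arrivalTime_ne_rat hγ, ae_arrivalTime_ne hγ,
    ae_cellRings_eq hγ] with τ hl hr h0 h1 h2 h3
  have hS : ∀ x b k, 0 < arrivalTime (clock τ x b) k := fun x b k =>
    Finset.sum_pos (fun i _ => (h0 x b).1 i) (by simp)
  have hsil : ∀ k x : ℤ, rings 1 τ (k, x) = false → ∀ s ∈ arrivals τ x, ¬ ((k : ℝ) < s ∧ s < k + 1) := by
    intro k x h s hs hks
    have h4 := h3 1 le_rfl k x
    simp only [Nat.cast_one, div_one] at h4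
    rw [h, cellRings, decide_eq_false_iff_not] at h4
    exact h4 ⟨s, hs, by simpa using hks.1, by simpa using hks.2⟩
  refine ⟨fun x M => ?_, fun x y hxy => ?_, fun x q hq => ?_, fun k z => ?_, fun k z => ?_⟩
  · have hfin : ∀ b, {n | arrivalTime (clock τ x b) n ≤ M}.Finite := fun b => by
      obtain ⟨N, hN⟩ := eventually_atTop.1 ((h0 x b).2.eventually (eventually_gt_atTop M))
      exact (Set.finite_lt_nat N).subset fun n hn => by
        by_contra h
        have := hN n (not_lt.1 h)
        simp only [Set.mem_ofPred_eq] at hn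
        linarith
    refine (((hfin true).image (arrivalTime (clock τ x true))).union
      ((hfin false).image fun n => -arrivalTime (clock τ x false) n)).subset ?_
    rintro s ⟨hs, h5, h6⟩
    rcases mem_arrivals.1 hs with ⟨n, rfl⟩ | ⟨n, rfl⟩
    · exact Or.inl ⟨n, h6, rfl⟩
    · exact Or.inr ⟨n, show _ ≤ M by linarith, rfl⟩
  · refine Set.disjoint_left.2 fun s hs hs' => ?_
    rcases mem_arrivals.1 hs with ⟨n, rfl⟩ | ⟨n, rfl⟩ <;>
      rcases mem_arrivals.1 hs' with ⟨m, h⟩ | ⟨m, h⟩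
    · exact h2 x y true n m hxy h
    · linarith [hS x true n, hS y false m]
    · linarith [hS x false n, hS y true m]
    · exact h2 x y false n m hxy (neg_injective h)
  · rcases mem_arrivals.1 hq with ⟨n, h⟩ | ⟨n, h⟩
    · exact h1 x true n q h.symm
    · refine h1 x false n (-q) ?_
      push_cast
      linarith
  · obtain ⟨j, hj⟩ := hl k z
    exact ⟨z - 1 - j, by omega, hsil k _ hj⟩
  · obtain ⟨j, hj⟩ := hr k z
    exact ⟨z + j, by omega, hsil k _ hj⟩

/-- For a fine mesh, the exclusion process is given by the flow of the rings. -/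
theorem ae_eventually_ssepField : ∀ᵐ τ ∂(Measure.infinitePi fun _ : ℤ × Bool × ℕ => expMeasure γ),
    ∀ s y : ℤ, ∀ᶠ n : ℕ in atTop, ∀ ζ : ℤ → Bool,
      (0 < ssepField (ζ, τ) s y ↔ ζ (flow (rings (1 / n) τ) (n * s) y) = true) := by
  filter_upwards [ae_goodArrivals hγ, ae_cellRings_eq hγ] with τ h1 h2 s y
  filter_upwards [h1.exists_ssepField s y, eventually_ge_atTop 1] with n hn hn1 ζ
  rw [hn ζ]
  have : (fun p : ℤ × ℤ => cellRings (arrivals τ) n p.1 p.2) = rings (1 / n) τ :=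
    funext fun p => h2 n hn1 p.1 p.2
  rw [this]

end

/-! ### The exclusion process on a time mesh -/

/-- Such a set is the preimage of a subset of the finite discrete space of fields on `F`. -/
theorem measurableSet_of_dependsOn {ι : Type*} {S : Set (ι → Bool)} {F : Set ι} (hF : F.Finite)
    (h : DependsOn (· ∈ S) F) : MeasurableSet S := by
  classical
  have := hF.to_subtype
  have hS : S = F.domRestrict ⁻¹' (F.domRestrict '' S) := by
    refine Set.Subset.antisymm (Set.subset_preimage_image _ _) ?_
    rintro x ⟨y, hy, hxy⟩
    refine Eq.to_iff (h fun i hi => ?_) |>.1 hy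
    exact congrFun hxy ⟨i, hi⟩
  rw [hS]
  exact (measurable_pi_iff.2 fun i => measurable_pi_apply _) (Set.toFinite _).measurableSet

theorem finite_box (x t : ℤ) (n : ℕ) : (box x t n).Finite :=
  (boxF x t n).finite_toSet.subset fun _ hp => mem_boxF.2 hp

/-- `A` need not be measurable, which matters because the exclusion field is defined through the
existence of a path; it is replaced by the lower limit of the sets `B n`. -/
theorem tendsto_measure_of_ae_eventually {Ω : Type*} [MeasurableSpace Ω] {P : Measure Ω} [IsFiniteMeasure P]
    {A : Set Ω} {B : ℕ → Set Ω} (hB : ∀ n, MeasurableSet (B n))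
    (h : ∀ᵐ ω ∂P, ∀ᶠ n in atTop, (ω ∈ B n ↔ ω ∈ A)) : Tendsto (fun n => P (B n)) atTop (𝓝 (P A)) := by
  set A' : Set Ω := {ω | ∀ᶠ n in atTop, ω ∈ B n} with hA'
  have hmeas : MeasurableSet A' := by
    have : A' = ⋃ N, ⋂ n, ⋂ (_ : N ≤ n), B n := by
      ext ω
      simp [hA', eventually_atTop]
    rw [this]
    exact .iUnion fun N => .iInter fun n => .iInter fun _ => hB n
  have hA : P A = P A' := measure_congr <| by
    filter_upwards [h] with ω hω
    refine propext ⟨fun h => hω.mono fun n hn => hn.2 h, fun h => ?_⟩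
    obtain ⟨n, hn, hn'⟩ := (h.and hω).exists
    exact hn'.1 hn
  rw [hA]
  refine tendsto_measure_of_ae_tendsto_indicator_of_isFiniteMeasure _ hmeas hB ?_
  filter_upwards [h] with ω hω
  by_cases hA : ω ∈ A
  · have : ω ∈ A' := hω.mono fun n hn => hn.2 hA
    exact hω.mono fun n hn => iff_of_true (hn.2 hA) this
  · have : ω ∉ A' := fun h => by
      obtain ⟨n, hn, hn'⟩ := (h.and hω).exists
      exact hA (hn'.1 hn)
    exact hω.mono fun n hn => iff_of_false (fun h => hA (hn.1 h)) this

theorem measurable_comp_int {α β : Type*} [MeasurableSpace α] [MeasurableSpace β] {g : α → ℤ → β}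
    (hg : ∀ z, Measurable fun a => g a z) {h : α → ℤ} (hh : Measurable h) :
    Measurable fun a => g a (h a) :=
  (measurable_from_prod_countable_left (f := fun p : α × ℤ => g p.1 p.2) hg).comp
    (measurable_id.prodMk hh)

theorem measurable_isoSwap {α : Type*} [MeasurableSpace α] {e : α → ℤ → Bool}
    (he : ∀ x, Measurable fun a => e a x) (y : ℤ) : Measurable fun a => isoSwap (e a) y := by
  have h : ∀ x b, MeasurableSet {a | e a x = b} := fun x b => he x (measurableSet_singleton b)
  unfold isoSwap
  refine Measurable.ite (((h _ _).inter ((h _ _).inter (h _ _)))) measurable_const ?_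
  exact Measurable.ite (((h _ _).inter ((h _ _).inter (h _ _)))) measurable_const measurable_const

theorem measurable_flow (b y : ℤ) : Measurable fun r : ℤ × ℤ → Bool => flow r b y := by
  have hp : ∀ (k : ℕ) (y : ℤ), Measurable fun r : ℤ × ℤ → Bool => flowPos r k y := by
    intro k
    induction k with
    | zero => exact fun y => measurable_const
    | succ k ih =>
      intro y
      exact measurable_comp_int (fun z => ih z) (measurable_isoSwap (fun x => measurable_pi_apply _) y)
  have hn : ∀ (k : ℕ) (y : ℤ), Measurable fun r : ℤ × ℤ → Bool => flowNeg r k y := by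
    intro k
    induction k with
    | zero => exact fun y => measurable_const
    | succ k ih =>
      intro y
      exact measurable_comp_int (fun z => ih z) (measurable_isoSwap (fun x => measurable_pi_apply _) y)
  cases b with
  | ofNat k => exact hp k y
  | negSucc k => exact hn (k + 1) y

/-! ### Backward trajectories and a silenced edge -/

/-- The position at the beginning of the time cell `b` of the content which is at `y` after `k` more
time cells. -/
def back (r : ℤ × ℤ → Bool) (b : ℤ) : ℕ → ℤ → ℤ
  | 0, y => y
  | k + 1, y => back r b k (isoSwap (fun x => r (b + k, x)) y)

theorem flow_add (r : ℤ × ℤ → Bool) (b : ℤ) (k : ℕ) (y : ℤ) :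
    flow r (b + k) y = flow r b (back r b k y) := by
  induction k generalizing y with
  | zero => simp [back]
  | succ k ih =>
    push_cast
    rw [← add_assoc, flow_succ, ih, back]

theorem measurable_back (b : ℤ) (k : ℕ) (y : ℤ) : Measurable fun r : ℤ × ℤ → Bool => back r b k y := by
  induction k generalizing y with
  | zero => exact measurable_const
  | succ k ih =>
    exact measurable_comp_int (fun z => ih z) (measurable_isoSwap (fun x => measurable_pi_apply _) y)

/-- The trajectory backwards in time from `y` visits the set `G`. -/
def Visits (r : ℤ × ℤ → Bool) (b : ℤ) (G : Set ℤ) : ℕ → ℤ → Prop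
  | 0, y => y ∈ G
  | k + 1, y => y ∈ G ∨ Visits r b G k (isoSwap (fun x => r (b + k, x)) y)

theorem measurableSet_visits (b : ℤ) (G : Set ℤ) (k : ℕ) (y : ℤ) :
    MeasurableSet {r : ℤ × ℤ → Bool | Visits r b G k y} := by
  rw [← measurable_mem]
  induction k generalizing y with
  | zero => exact measurable_const
  | succ k ih =>
    change Measurable fun r : ℤ × ℤ → Bool => y ∈ G ∨ Visits r b G k (isoSwap (fun x => r (b + k, x)) y)
    exact measurable_const.or
      (measurable_comp_int (fun z => ih z) (measurable_isoSwap (fun x => measurable_pi_apply _) y))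

/-- Only rows before `b + k` are used, so the event is independent of the row which makes the
preceding backward step. -/
theorem dependsOn_visits (b : ℤ) (G : Set ℤ) (k : ℕ) (y : ℤ) :
    DependsOn (fun r : ℤ × ℤ → Bool => Visits r b G k y) {p | p.1 < b + k} := by
  induction k generalizing y with
  | zero => exact fun _ _ _ => rfl
  | succ k ih =>
    intro r r' h
    have e : (fun x => r (b + k, x)) = fun x => r' (b + k, x) := funext fun x => h _ (by
      change b + (k : ℤ) < _
      push_cast
      omega)
    change (y ∈ G ∨ Visits r b G k _) = (y ∈ G ∨ Visits r' b G k _)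
    rw [e]
    have ih' := ih (isoSwap (fun x => r' (b + k, x)) y)
    have := @ih' r r' fun p hp => h p (by
      change p.1 < b + (k : ℤ) at hp
      change p.1 < _
      push_cast
      omega)
    dsimp only at this
    rw [this]

/-- Silence the edge `m`. -/
def cutAt (m : ℤ) (r : ℤ × ℤ → Bool) (p : ℤ × ℤ) : Bool := if p.2 = m then false else r p

/-- The edge `m` is inspected only from sites `y` with `m - 1 ≤ y ≤ m + 2`; a trajectory avoiding
these does not notice the cut. -/
theorem back_cutAt_of_not_visits {m : ℤ} {G : Set ℤ} (hG : ∀ y, y ∉ G → y < m - 1 ∨ m + 2 < y)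
    (r : ℤ × ℤ → Bool) (b : ℤ) (k : ℕ) (y : ℤ) (h : ¬ Visits r b G k y) :
    back (cutAt m r) b k y = back r b k y := by
  induction k generalizing y with
  | zero => rfl
  | succ k ih =>
    simp only [Visits, not_or] at h
    have hy := hG y h.1
    have : isoSwap (fun x => cutAt m r (b + k, x)) y = isoSwap (fun x => r (b + k, x)) y := by
      refine isoSwap_congr fun x h1 h2 => ?_
      rw [cutAt, if_neg (by dsimp only; omega)]
    rw [back, back, this, ih _ h.2]

theorem isoSwap_le_of_silent {e : ℤ → Bool} {m y : ℤ} (hm : e m = false) (hy : y ≤ m) : isoSwap e y ≤ m := by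
  unfold isoSwap
  split_ifs with h1 h2
  · have : y ≠ m := by rintro rfl; simp [hm] at h1
    omega
  · omega
  · exact hy

theorem lt_isoSwap_of_silent {e : ℤ → Bool} {m y : ℤ} (hm : e m = false) (hy : m < y) : m < isoSwap e y := by
  unfold isoSwap
  split_ifs with h1 h2
  · omega
  · have : y - 1 ≠ m := by rintro rfl; simp [hm] at h2
    omega
  · exact hy

theorem isoSwap_congr_le {e e' : ℤ → Bool} {m y : ℤ} (hm : e m = false) (hm' : e' m = false) (hy : y ≤ m)
    (h : ∀ x ≤ m, e x = e' x) : isoSwap e y = isoSwap e' y := by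
  rcases hy.lt_or_eq with hy | rfl
  · exact isoSwap_congr fun x _ h2 => h x (by omega)
  · unfold isoSwap
    simp [hm, hm', h (y - 1) (by omega), h (y - 2) (by omega)]

/-- The delicate sites are `m + 1`, where the silent edge `m` blocks the move to the left before its
own neighbour is examined, and `m + 2`, where edge `m` enters only as a neighbour and is silent in
both rows. -/
theorem isoSwap_congr_lt {e e' : ℤ → Bool} {m y : ℤ} (hm : e m = false) (hm' : e' m = false) (hy : m < y)
    (h : ∀ x, m < x → e x = e' x) : isoSwap e y = isoSwap e' y := by
  rcases (show m + 1 ≤ y by omega).lt_or_eq with hy | rfl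
  · rcases (show m + 2 ≤ y by omega).lt_or_eq with hy | rfl
    · exact isoSwap_congr fun x h1 _ => h x (by omega)
    · unfold isoSwap
      simp [hm, hm', show m + 2 - 1 = m + 1 by ring, h (m + 1) (by omega), h (m + 2) (by omega),
        h (m + 2 + 1) (by omega)]
  · unfold isoSwap
    simp [hm, hm', h (m + 1) (by omega), h (m + 1 + 1) (by omega)]

theorem cutAt_self (m : ℤ) (r : ℤ × ℤ → Bool) (b : ℤ) : cutAt m r (b, m) = false := if_pos rfl

theorem cutAt_congr {m : ℤ} {r r' : ℤ × ℤ → Bool} {p : ℤ × ℤ} (h : p.2 ≠ m → r p = r' p) :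
    cutAt m r p = cutAt m r' p := by
  unfold cutAt
  split_ifs with hp
  · rfl
  · exact h hp

theorem back_cutAt_le {m : ℤ} {r r' : ℤ × ℤ → Bool} (h : ∀ p : ℤ × ℤ, p.2 ≤ m → r p = r' p) (b : ℤ) (k : ℕ)
    {y : ℤ} (hy : y ≤ m) :
    back (cutAt m r) b k y = back (cutAt m r') b k y ∧ back (cutAt m r') b k y ≤ m := by
  induction k generalizing y with
  | zero => exact ⟨rfl, hy⟩
  | succ k ih =>
    rw [back, back, isoSwap_congr_le (cutAt_self m r _) (cutAt_self m r' _) hy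
      fun x hx => cutAt_congr fun _ => h _ hx]
    exact ih (isoSwap_le_of_silent (cutAt_self m r' _) hy)

theorem back_cutAt_lt {m : ℤ} {r r' : ℤ × ℤ → Bool} (h : ∀ p : ℤ × ℤ, m < p.2 → r p = r' p) (b : ℤ) (k : ℕ)
    {y : ℤ} (hy : m < y) :
    back (cutAt m r) b k y = back (cutAt m r') b k y ∧ m < back (cutAt m r') b k y := by
  induction k generalizing y with
  | zero => exact ⟨rfl, hy⟩
  | succ k ih =>
    rw [back, back, isoSwap_congr_lt (cutAt_self m r _) (cutAt_self m r' _) hy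
      fun x hx => cutAt_congr fun _ => h _ hx]
    exact ih (lt_isoSwap_of_silent (cutAt_self m r' _) hy)

/-! #### A random walk bound -/

section Chernoff

variable {p : ℝ}

theorem coinLaw_true (p : ℝ) : coinLaw p {true} = ENNReal.ofReal p := by simp [coinLaw]

theorem coinLaw_false (p : ℝ) : coinLaw p {false} = ENNReal.ofReal (1 - p) := by simp [coinLaw]

theorem ring_pattern (h0 : 0 < p) (h1 : p < 1) (b x : ℤ) :
    (Measure.infinitePi fun _ : ℤ × ℤ => coinLaw p).real
      {r | r (b, x) = true ∧ r (b, x - 1) = false ∧ r (b, x + 1) = false} = p * (1 - p) ^ 2 := by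
  classical
  have := isProbabilityMeasure_coinLaw h0 h1
  have hset : {r : ℤ × ℤ → Bool | r (b, x) = true ∧ r (b, x - 1) = false ∧ r (b, x + 1) = false} =
      ((({(b, x), (b, x - 1), (b, x + 1)} : Finset (ℤ × ℤ)) : Set (ℤ × ℤ)).pi
        fun q => if q = (b, x) then {true} else {false}) := by
    ext r
    simp [Set.pi]
  rw [hset, Measure.real, Measure.infinitePi_pi _ fun _ _ => MeasurableSet.of_discrete,
    Finset.prod_insert (by simp; omega), Finset.prod_insert (by simp; omega), Finset.prod_singleton]
  simp only [if_true, Prod.mk.injEq, true_and, sub_eq_self, one_ne_zero, if_false, add_eq_left,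
    coinLaw_true, coinLaw_false]
  rw [ENNReal.toReal_mul, ENNReal.toReal_mul, ENNReal.toReal_ofReal h0.le,
    ENNReal.toReal_ofReal (by linarith)]
  ring

theorem isoSwap_eq_add_one (e : ℤ → Bool) (y : ℤ) :
    isoSwap e y = y + 1 ↔ e y = true ∧ e (y - 1) = false ∧ e (y + 1) = false := by
  unfold isoSwap
  split_ifs with h1 h2
  · simp [h1]
  · exact iff_of_false (by omega) h1
  · exact iff_of_false (by omega) h1

theorem isoSwap_eq_sub_one (e : ℤ → Bool) (y : ℤ) :
    isoSwap e y = y - 1 ↔ e (y - 1) = true ∧ e (y - 1 - 1) = false ∧ e (y - 1 + 1) = false := by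
  have := isoSwap_eq_add_one e (y - 1)
  rw [← this, sub_add_cancel]
  constructor
  · intro h; rw [← h, isoSwap_involutive]
  · intro h
    have := isoSwap_involutive e (y - 1)
    rwa [h] at this

/-- The probability that the backward trajectory gets far in the direction `σ`. -/
theorem visits_le (h0 : 0 < p) (h1 : p < 1) {σ : ℤ} (hσ : σ = 1 ∨ σ = -1) (h : ℤ) {θ : ℝ}
    (b : ℤ) (k : ℕ) (y : ℤ) (hθ : 0 ≤ θ) :
    (Measure.infinitePi fun _ : ℤ × ℤ => coinLaw p).real {r | Visits r b {z | h ≤ σ * z} k y} ≤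
      Real.exp (θ * (σ * y - h)) * Real.exp (2 * p * (Real.cosh θ - 1)) ^ k := by
  have := isProbabilityMeasure_coinLaw h0 h1
  set R := Measure.infinitePi fun _ : ℤ × ℤ => coinLaw p with hR
  set M := Real.exp (2 * p * (Real.cosh θ - 1)) with hM
  have hM1 : 1 ≤ M := Real.one_le_exp (by have := Real.one_le_cosh θ; nlinarith)
  have triv : ∀ k y, y ∈ {z | h ≤ σ * z} → R.real {r | Visits r b {z | h ≤ σ * z} k y} ≤
      Real.exp (θ * (σ * y - h)) * M ^ k := by
    intro k y hy
    refine measureReal_le_one.trans ?_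
    have : (h : ℝ) ≤ σ * y := by exact_mod_cast hy
    exact one_le_mul_of_one_le_of_one_le (Real.one_le_exp (mul_nonneg hθ (by linarith))) (one_le_pow₀ hM1)
  induction k generalizing y with
  | zero =>
    by_cases hy : y ∈ {z | h ≤ σ * z}
    · exact triv 0 y hy
    · simp only [Visits, hy]
      simp
      positivity
  | succ k ih =>
    by_cases hy : y ∈ {z | h ≤ σ * z}
    · exact triv (k + 1) y hy
    set G := {z | h ≤ σ * z} with hG
    set I : ℤ → Set (ℤ × ℤ → Bool) := fun z => {r | isoSwap (fun x => r (b + k, x)) y = z} with hI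
    have hImeas : ∀ z, MeasurableSet (I z) := fun z =>
      (measurable_isoSwap (fun x => measurable_pi_apply (b + k, x)) y) (measurableSet_singleton z)
    set e : ℤ → ℝ := fun z => R.real {r | Visits r b G k z} with he
    -- The row `b + k` decides the current backward step, and the earlier rows decide the rest of
    -- the trajectory.
    have hind : ∀ z, R.real (I z ∩ {r | Visits r b G k z}) = R.real (I z) * e z := by
      intro z
      simp only [he, Measure.real]
      rw [← ENNReal.toReal_mul]
      congr 1
      refine infinitePi_inter_of_dependsOn (fun _ : ℤ × ℤ => coinLaw p) (S := {q | q.1 = b + k})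
        (T := {q | q.1 < b + k}) ?_ (hImeas z) (measurableSet_visits b G k z) ?_ (dependsOn_visits b G k z)
      · exact Set.disjoint_left.2 fun q h1 h2 => by
          simp only [Set.mem_ofPred_eq] at h1 h2
          omega
      · intro r r' hrr
        have : (fun x => r (b + k, x)) = fun x => r' (b + k, x) := funext fun x => hrr _ rfl
        change (isoSwap (fun x => r (b + k, x)) y = z) = (isoSwap (fun x => r' (b + k, x)) y = z)
        rw [this]
    have hsub : {r | Visits r b G (k + 1) y} ⊆ (I y ∩ {r | Visits r b G k y}) ∪
        ((I (y + 1) ∩ {r | Visits r b G k (y + 1)}) ∪ (I (y - 1) ∩ {r | Visits r b G k (y - 1)})) := by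
      rintro r (hr | hr)
      · exact absurd hr hy
      · rcases isoSwap_cases (fun x => r (b + k, x)) y with h | h | h <;> rw [h] at hr
        · exact Or.inr (Or.inl ⟨h, hr⟩)
        · exact Or.inr (Or.inr ⟨h, hr⟩)
        · exact Or.inl ⟨h, hr⟩
    set q := p * (1 - p) ^ 2 with hq
    have hp1 : R.real (I (y + 1)) = q := by
      rw [hq, ← ring_pattern h0 h1 (b + k) y]
      congr 1
      ext r
      exact isoSwap_eq_add_one _ _
    have hp2 : R.real (I (y - 1)) = q := by
      rw [hq, ← ring_pattern h0 h1 (b + k) (y - 1)]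
      congr 1
      ext r
      exact isoSwap_eq_sub_one _ _
    have hp0 : R.real (I y) = 1 - 2 * q := by
      have hu : R.real ((I (y + 1)) ∪ (I (y - 1))) = 2 * q := by
        rw [measureReal_union ?_ (hImeas _), hp1, hp2]
        · ring
        · exact Set.disjoint_left.2 fun r h1 h2 => by
            simp only [hI, Set.mem_ofPred_eq] at h1 h2
            omega
      have hc : I y = ((I (y + 1)) ∪ (I (y - 1)))ᶜ := by
        ext r
        simp only [hI, Set.mem_compl_iff, Set.mem_union, Set.mem_ofPred_eq]
        rcases isoSwap_cases (fun x => r (b + k, x)) y with h | h | h <;> omega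
      rw [hc, probReal_compl_eq_one_sub ((hImeas _).union (hImeas _)), hu]
    have hq0 : 0 ≤ q := by positivity
    have hqp : q ≤ p := by
      rw [hq]
      have : (1 - p) ^ 2 ≤ 1 := by nlinarith
      nlinarith
    have hq2 : 0 ≤ 1 - 2 * q := hp0 ▸ measureReal_nonneg
    set f : ℤ → ℝ := fun z => Real.exp (θ * (σ * z - h)) with hf
    -- The exponential is an eigenfunction of the step operator. Each backward step therefore
    -- multiplies the bound by `1 + 2 q (cosh θ - 1)`, which is at most `M` because `q ≤ p`.
    have hfsum : f (y + 1) + f (y - 1) = 2 * Real.cosh θ * f y := by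
      have e1 : ∀ δ : ℝ, Real.exp (θ * (σ * (y + δ) - h)) = Real.exp (θ * σ * δ) * f y := by
        intro δ
        rw [hf, ← Real.exp_add]
        congr 1
        ring
      have h1 := e1 1
      have h2 := e1 (-1)
      simp only [hf] at h1 h2 ⊢
      push_cast
      rw [sub_eq_add_neg (y : ℝ) 1, h1, h2, Real.cosh_eq]
      rcases hσ with rfl | rfl
      · push_cast
        simp only [mul_one, mul_neg]
        ring
      · push_cast
        simp only [mul_one, mul_neg, neg_neg]
        ring
    calc R.real {r | Visits r b G (k + 1) y} ≤ (1 - 2 * q) * e y + (q * e (y + 1) + q * e (y - 1)) := by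
          refine (measureReal_mono hsub).trans ((measureReal_union_le _ _).trans ?_)
          rw [hind, hp0]
          gcongr
          refine (measureReal_union_le _ _).trans ?_
          rw [hind, hind, hp1, hp2]
      _ ≤ (1 - 2 * q) * (f y * M ^ k) + (q * (f (y + 1) * M ^ k) + q * (f (y - 1) * M ^ k)) := by
          have := ih y
          have := ih (y + 1)
          have := ih (y - 1)
          gcongr
      _ = ((1 - 2 * q) * f y + q * (f (y + 1) + f (y - 1))) * M ^ k := by ring
      _ = (1 + 2 * q * (Real.cosh θ - 1)) * f y * M ^ k := by rw [hfsum]; ring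
      _ ≤ M * f y * M ^ k := by
          have h3 := Real.add_one_le_exp (2 * p * (Real.cosh θ - 1))
          have h4 := Real.one_le_cosh θ
          have : 1 + 2 * q * (Real.cosh θ - 1) ≤ M := by rw [hM]; nlinarith
          gcongr
      _ = f y * M ^ (k + 1) := by ring

end Chernoff

/-! ### Decoupling on the mesh -/

open Classical in
/-- The arrows in terms of the occupied points. -/
def coinArrow (pb pw : ℝ) (U : ℤ × ℤ → unitInterval) (o : ℤ × ℤ → Bool) (p : ℤ × ℤ) : Bool :=
  decide ((U p : ℝ) ≤ if o p = true then pb else pw)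

theorem coinArrow_congr {pb pw : ℝ} {U U' : ℤ × ℤ → unitInterval} {o o' : ℤ × ℤ → Bool} {p : ℤ × ℤ}
    (hU : U p = U' p) (ho : o p = o' p) : coinArrow pb pw U o p = coinArrow pb pw U' o' p := by
  simp only [coinArrow, hU, ho]

theorem arrows_eq_coinArrow {pb pw : ℝ} {U : ℤ × ℤ → unitInterval} {η : ℝ → ℤ → ℕ∞} {o : ℤ × ℤ → Bool}
    {p : ℤ × ℤ} (h : 0 < η p.2 p.1 ↔ o p = true) : arrows η U pb pw p = coinArrow pb pw U o p := by
  simp only [arrows, coinArrow, h]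

theorem measurable_coinArrow {α : Type*} [MeasurableSpace α] (pb pw : ℝ) {U : α → ℤ × ℤ → unitInterval}
    {o : α → ℤ × ℤ → Bool} {p : ℤ × ℤ} (hU : Measurable fun a => U a p) (ho : Measurable fun a => o a p) :
    Measurable fun a => coinArrow pb pw (U a) (o a) p := by
  refine measurable_to_bool ?_
  have : (fun a => coinArrow pb pw (U a) (o a) p) ⁻¹' {true} =
      {a | (U a p : ℝ) ≤ if o a p = true then pb else pw} := by
    ext a
    simp [coinArrow]
  rw [this]
  exact measurableSet_le (measurable_subtype_coe.comp hU)
    (Measurable.ite (ho (measurableSet_singleton true)) measurable_const measurable_const)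

/-- Events which depend on the same coordinates as `S`, for two random fields which agree there. -/
theorem mem_iff_of_dependsOn {S : Set (ℤ × ℤ → Bool)} {F : Set (ℤ × ℤ)} (hS : DependsOn (· ∈ S) F)
    {a a' : ℤ × ℤ → Bool} (h : ∀ p ∈ F, a p = a' p) : a ∈ S ↔ a' ∈ S :=
  Eq.to_iff (hS h)

/-- Ring indicators, uniform variables, and the configuration at the beginning. -/
abbrev MeshSample : Type := ((ℤ × ℤ → Bool) × (ℤ × ℤ → unitInterval)) × (ℤ → Bool)

/-- The law for the ring probability `p`. -/
def meshLaw (p ρ : ℝ) : Measure MeshSample :=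
  ((Measure.infinitePi fun _ : ℤ × ℤ => coinLaw p).prod
    (Measure.infinitePi fun _ : ℤ × ℤ => (volume : Measure unitInterval))).prod
    (Measure.infinitePi fun _ : ℤ => coinLaw ρ)

/-- The arrows, for the configuration given at the time cell `b`; at the time `s` there have been
`κ s` more time cells. -/
def windowArrows (pb pw : ℝ) (κ : ℤ → ℕ) (b : ℤ) (w : MeshSample) : ℤ × ℤ → Bool :=
  coinArrow pb pw w.1.2 fun p => w.2 (back w.1.1 b (κ p.2) p.1)

/-- The same with the edge `m` silenced. -/
def cutArrows (pb pw : ℝ) (κ : ℤ → ℕ) (b m : ℤ) (w : MeshSample) : ℤ × ℤ → Bool :=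
  coinArrow pb pw w.1.2 fun p => w.2 (back (cutAt m w.1.1) b (κ p.2) p.1)

theorem measurable_cutAt (m : ℤ) : Measurable (cutAt m) := by
  refine measurable_pi_iff.2 fun p => ?_
  unfold cutAt
  split_ifs
  · exact measurable_const
  · exact measurable_pi_apply p

theorem measurable_windowArrows (pb pw : ℝ) (κ : ℤ → ℕ) (b : ℤ) : Measurable (windowArrows pb pw κ b) := by
  refine measurable_pi_iff.2 fun p => measurable_coinArrow pb pw (by fun_prop) ?_
  exact measurable_comp_int (g := fun w : MeshSample => w.2) (fun z => by fun_prop)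
    ((measurable_back b (κ p.2) p.1).comp (by fun_prop))

theorem measurable_cutArrows (pb pw : ℝ) (κ : ℤ → ℕ) (b m : ℤ) : Measurable (cutArrows pb pw κ b m) := by
  refine measurable_pi_iff.2 fun p => measurable_coinArrow pb pw (by fun_prop) ?_
  have := measurable_cutAt m
  exact measurable_comp_int (g := fun w : MeshSample => w.2) (fun z => by fun_prop)
    ((measurable_back b (κ p.2) p.1).comp (by fun_prop))

/-- With the edge `m` silent, the arrows left of the cut use only rings, uniform variables and
initial particles at indices at most `m`, and those right of it only larger indices; mixing two
samples along `m` gives independence. -/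
theorem cutArrows_independent {p ρ : ℝ} (hp0 : 0 < p) (hp1 : p < 1) (hρ0 : 0 < ρ) (hρ1 : ρ < 1)
    (pb pw : ℝ) (κ : ℤ → ℕ) (b m : ℤ) {F₁ F₂ : Finset (ℤ × ℤ)} (h1 : ∀ q ∈ F₁, q.1 ≤ m)
    (h2 : ∀ q ∈ F₂, m < q.1) {S₁ S₂ : Set (ℤ × ℤ → Bool)} (hS₁ : DependsOn (· ∈ S₁) (F₁ : Set (ℤ × ℤ)))
    (hS₂ : DependsOn (· ∈ S₂) (F₂ : Set (ℤ × ℤ))) :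
    meshLaw p ρ (cutArrows pb pw κ b m ⁻¹' S₁ ∩ cutArrows pb pw κ b m ⁻¹' S₂) =
      meshLaw p ρ (cutArrows pb pw κ b m ⁻¹' S₁) * meshLaw p ρ (cutArrows pb pw κ b m ⁻¹' S₂) := by
  have := isProbabilityMeasure_coinLaw hp0 hp1
  have := isProbabilityMeasure_coinLaw hρ0 hρ1
  have hmix := measurePreserving_mixProd
    (measurePreserving_mixProd
      (measurePreserving_mixPi (fun _ : ℤ × ℤ => coinLaw p) {q | q.2 ≤ m})
      (measurePreserving_mixPi (fun _ : ℤ × ℤ => (volume : Measure unitInterval)) {q | q.1 ≤ m}))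
    (measurePreserving_mixPi (fun _ : ℤ => coinLaw ρ) {x | x ≤ m})
  have hc := measurable_cutArrows pb pw κ b m
  unfold meshLaw
  refine measure_inter_eq_mul_of_mix hmix (hc (measurableSet_of_dependsOn F₁.finite_toSet hS₁))
    (hc (measurableSet_of_dependsOn F₂.finite_toSet hS₂)) (fun w w' => ?_) fun w w' => ?_
  · refine mem_iff_of_dependsOn hS₁ fun q hq => ?_
    have hq1 := h1 q hq
    obtain ⟨e1, e2⟩ := back_cutAt_le (m := m) (r := mixPi {q | q.2 ≤ m} (w.1.1, w'.1.1)) (r' := w.1.1)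
      (fun x hx => mixPi_of_mem (S := {q : ℤ × ℤ | q.2 ≤ m}) hx _) b (κ q.2) hq1
    refine coinArrow_congr (mixPi_of_mem (S := {q : ℤ × ℤ | q.1 ≤ m}) hq1 _) ?_
    change mixPi {x | x ≤ m} (w.2, w'.2) (back (cutAt m (mixPi {q | q.2 ≤ m} (w.1.1, w'.1.1))) b (κ q.2) q.1) = _
    rw [e1]
    exact mixPi_of_mem (S := {x : ℤ | x ≤ m}) e2 _
  · refine mem_iff_of_dependsOn hS₂ fun q hq => ?_
    have hq1 := h2 q hq
    obtain ⟨e1, e2⟩ := back_cutAt_lt (m := m) (r := mixPi {q | q.2 ≤ m} (w.1.1, w'.1.1)) (r' := w'.1.1)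
      (fun x hx => mixPi_of_notMem (S := {q : ℤ × ℤ | q.2 ≤ m}) (not_le.2 hx) _) b (κ q.2) hq1
    refine coinArrow_congr (mixPi_of_notMem (S := {q : ℤ × ℤ | q.1 ≤ m}) (not_le.2 hq1) _) ?_
    change mixPi {x | x ≤ m} (w.2, w'.2) (back (cutAt m (mixPi {q | q.2 ≤ m} (w.1.1, w'.1.1))) b (κ q.2) q.1) = _
    rw [e1]
    exact mixPi_of_notMem (S := {x : ℤ | x ≤ m}) (not_le.2 e2) _

/-- The configurations of rings for which a backward trajectory from `q` gets close to `m`. -/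
def NearCut (κ : ℤ → ℕ) (b m : ℤ) (q : ℤ × ℤ) : Set (ℤ × ℤ → Bool) :=
  if q.1 ≤ m then {r | Visits r b {z | m - 1 ≤ 1 * z} (κ q.2) q.1}
  else {r | Visits r b {z | -(m + 2) ≤ -1 * z} (κ q.2) q.1}

theorem windowArrows_eq_cutArrows {pb pw : ℝ} {κ : ℤ → ℕ} {b m : ℤ} {q : ℤ × ℤ} {w : MeshSample}
    (h : w.1.1 ∉ NearCut κ b m q) : windowArrows pb pw κ b w q = cutArrows pb pw κ b m w q := by
  refine coinArrow_congr rfl ?_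
  refine congrArg w.2 ?_
  unfold NearCut at h
  split_ifs at h
  · refine (back_cutAt_of_not_visits (fun y hy => ?_) w.1.1 b _ _ h).symm
    simp only [Set.mem_ofPred_eq] at hy
    omega
  · refine (back_cutAt_of_not_visits (fun y hy => ?_) w.1.1 b _ _ h).symm
    simp only [Set.mem_ofPred_eq] at hy
    omega

theorem nearCut_le {p : ℝ} (hp0 : 0 < p) (hp1 : p < 1) {κ : ℤ → ℕ} {b m d : ℤ} {q : ℤ × ℤ} {K : ℕ}
    (hκ : κ q.2 ≤ K) (hd : 0 ≤ d) (hq : q.1 + d ≤ m ∨ m < q.1 ∧ m + d ≤ q.1) {θ : ℝ} (hθ : 0 ≤ θ) :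
    (Measure.infinitePi fun _ : ℤ × ℤ => coinLaw p) (NearCut κ b m q) ≤
      ENNReal.ofReal (Real.exp (θ * (2 - d)) * Real.exp (2 * p * (Real.cosh θ - 1)) ^ K) := by
  have := isProbabilityMeasure_coinLaw hp0 hp1
  have hM1 : 1 ≤ Real.exp (2 * p * (Real.cosh θ - 1)) :=
    Real.one_le_exp (by have := Real.one_le_cosh θ; nlinarith)
  rw [← ENNReal.ofReal_toReal (measure_ne_top _ (NearCut κ b m q))]
  refine ENNReal.ofReal_le_ofReal ?_
  unfold NearCut
  split_ifs with h
  · refine (visits_le hp0 hp1 (Or.inl rfl) (m - 1) b (κ q.2) q.1 hθ).trans ?_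
    have : (q.1 : ℝ) + d ≤ m := by exact_mod_cast hq.resolve_right (by omega)
    refine mul_le_mul (Real.exp_le_exp.2 (mul_le_mul_of_nonneg_left ?_ hθ)) (pow_le_pow_right₀ hM1 hκ)
      (by positivity) (by positivity)
    push_cast
    linarith
  · refine (visits_le hp0 hp1 (Or.inr rfl) (-(m + 2)) b (κ q.2) q.1 hθ).trans ?_
    have : (m : ℝ) + d ≤ q.1 := by exact_mod_cast (hq.resolve_left (by omega)).2
    refine mul_le_mul (Real.exp_le_exp.2 (mul_le_mul_of_nonneg_left ?_ hθ)) (pow_le_pow_right₀ hM1 hκ)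
      (by positivity) (by positivity)
    push_cast
    linarith

/-- Cutting changes the arrows in the two sets only if some backward trajectory, started at distance
at least `d` from the cut, comes close to it. A union bound over the starting points gives the
error. -/
theorem windowArrows_decouple {p ρ : ℝ} (hp0 : 0 < p) (hp1 : p < 1) (hρ0 : 0 < ρ) (hρ1 : ρ < 1)
    (pb pw : ℝ) {κ : ℤ → ℕ} (b : ℤ) {m d : ℤ} {F₁ F₂ : Finset (ℤ × ℤ)} {K : ℕ} (hd : 0 ≤ d)
    (h1 : ∀ q ∈ F₁, κ q.2 ≤ K ∧ q.1 + d ≤ m) (h2 : ∀ q ∈ F₂, κ q.2 ≤ K ∧ m < q.1 ∧ m + d ≤ q.1)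
    {S₁ S₂ : Set (ℤ × ℤ → Bool)} (hS₁ : DependsOn (· ∈ S₁) (F₁ : Set (ℤ × ℤ)))
    (hS₂ : DependsOn (· ∈ S₂) (F₂ : Set (ℤ × ℤ))) {θ : ℝ} (hθ : 0 ≤ θ) :
    meshLaw p ρ (windowArrows pb pw κ b ⁻¹' S₁ ∩ windowArrows pb pw κ b ⁻¹' S₂) ≤
      meshLaw p ρ (windowArrows pb pw κ b ⁻¹' S₁) * meshLaw p ρ (windowArrows pb pw κ b ⁻¹' S₂) +
      4 * ENNReal.ofReal ((F₁.card + F₂.card) *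
        (Real.exp (θ * (2 - d)) * Real.exp (2 * p * (Real.cosh θ - 1)) ^ K)) := by
  classical
  have := isProbabilityMeasure_coinLaw hp0 hp1
  have := isProbabilityMeasure_coinLaw hρ0 hρ1
  have : IsProbabilityMeasure (meshLaw p ρ) := by unfold meshLaw; infer_instance
  set β := Real.exp (θ * (2 - d)) * Real.exp (2 * p * (Real.cosh θ - 1)) ^ K with hβ
  set bad : Set MeshSample := ⋃ q ∈ F₁ ∪ F₂, (fun w => w.1.1) ⁻¹' NearCut κ b m q with hbad
  have hagree : ∀ w ∉ bad, ∀ q ∈ F₁ ∪ F₂, windowArrows pb pw κ b w q = cutArrows pb pw κ b m w q := by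
    intro w hw q hq
    refine windowArrows_eq_cutArrows fun h => hw ?_
    exact Set.mem_biUnion (Finset.mem_coe.2 hq) h
  have hfst : MeasurePreserving (fun w : MeshSample => w.1.1) (meshLaw p ρ)
      (Measure.infinitePi fun _ : ℤ × ℤ => coinLaw p) := measurePreserving_fst.comp measurePreserving_fst
  have hnm : ∀ q, MeasurableSet (NearCut κ b m q) := fun q => by
    unfold NearCut
    split_ifs
    · exact measurableSet_visits _ _ _ _
    · exact measurableSet_visits _ _ _ _
  have hP : meshLaw p ρ bad ≤ ENNReal.ofReal ((F₁.card + F₂.card) * β) := by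
    calc meshLaw p ρ bad ≤ ∑ q ∈ F₁ ∪ F₂, meshLaw p ρ ((fun w => w.1.1) ⁻¹' NearCut κ b m q) :=
          measure_biUnion_finset_le _ _
      _ ≤ ∑ q ∈ F₁ ∪ F₂, ENNReal.ofReal β := by
          refine Finset.sum_le_sum fun q hq => ?_
          rw [hfst.measure_preimage (hnm q).nullMeasurableSet]
          rcases Finset.mem_union.1 hq with hq | hq
          · exact nearCut_le hp0 hp1 (h1 q hq).1 hd (Or.inl (h1 q hq).2) hθ
          · exact nearCut_le hp0 hp1 (h2 q hq).1 hd (Or.inr (h2 q hq).2) hθ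
      _ = (F₁ ∪ F₂).card * ENNReal.ofReal β := by simp
      _ ≤ ((F₁.card + F₂.card : ℕ) : ℝ≥0∞) * ENNReal.ofReal β := by
          gcongr
          exact Finset.card_union_le _ _
      _ = ENNReal.ofReal ((F₁.card + F₂.card) * β) := by
          rw [← ENNReal.ofReal_natCast, ← ENNReal.ofReal_mul (by positivity)]
          push_cast
          rfl
  refine measure_inter_le_of_approx (A₁' := cutArrows pb pw κ b m ⁻¹' S₁)
    (A₂' := cutArrows pb pw κ b m ⁻¹' S₂) hP ?_ ?_ ?_ ?_
    (cutArrows_independent hp0 hp1 hρ0 hρ1 pb pw κ b m (fun q hq => by linarith [(h1 q hq).2])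
      (fun q hq => (h2 q hq).2.1) hS₁ hS₂).le
  · intro w hw
    by_contra hc
    rw [Set.mem_union, not_or] at hc
    exact hc.1 ((mem_iff_of_dependsOn hS₁ fun q hq => hagree w hc.2 q (Finset.mem_union_left _ hq)).1 hw)
  · intro w hw
    by_contra hc
    rw [Set.mem_union, not_or] at hc
    exact hc.1 ((mem_iff_of_dependsOn hS₁ fun q hq => hagree w hc.2 q (Finset.mem_union_left _ hq)).2 hw)
  · intro w hw
    by_contra hc
    rw [Set.mem_union, not_or] at hc
    exact hc.1 ((mem_iff_of_dependsOn hS₂ fun q hq => hagree w hc.2 q (Finset.mem_union_right _ hq)).1 hw)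
  · intro w hw
    by_contra hc
    rw [Set.mem_union, not_or] at hc
    exact hc.1 ((mem_iff_of_dependsOn hS₂ fun q hq => hagree w hc.2 q (Finset.mem_union_right _ hq)).2 hw)

/-- The arrows in terms of the configuration at time `0`, for `n` time cells in a unit of time. -/
def meshArrows (pb pw : ℝ) (n : ℕ) (w : MeshSample) : ℤ × ℤ → Bool :=
  coinArrow pb pw w.1.2 fun p => w.2 (flow w.1.1 (n * p.2) p.1)

theorem measurable_meshArrows (pb pw : ℝ) (n : ℕ) : Measurable (meshArrows pb pw n) := by
  refine measurable_pi_iff.2 fun p => measurable_coinArrow pb pw (by fun_prop) ?_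
  exact measurable_comp_int (g := fun w : MeshSample => w.2) (fun z => by fun_prop)
    ((measurable_flow (n * p.2) p.1).comp (by fun_prop))

/-- The configuration at the beginning of the time cell `b` has the same law as that at time `0`. -/
theorem measurePreserving_flow {p ρ : ℝ} (hp0 : 0 < p) (hp1 : p < 1) (hρ0 : 0 < ρ) (hρ1 : ρ < 1) (b : ℤ) :
    MeasurePreserving (fun w : MeshSample => (w.1, fun y => w.2 (flow w.1.1 b y))) (meshLaw p ρ)
      (meshLaw p ρ) := by
  have := isProbabilityMeasure_coinLaw hp0 hp1
  have := isProbabilityMeasure_coinLaw hρ0 hρ1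
  refine MeasurePreserving.skew_product (f := id) (g := fun (a : (ℤ × ℤ → Bool) × (ℤ × ℤ → unitInterval)) (ζ : ℤ → Bool) y => ζ (flow a.1 b y))
    (MeasurePreserving.id _) ?_ (Eventually.of_forall fun a => ?_)
  · refine measurable_pi_iff.2 fun y => ?_
    exact measurable_comp_int (g := fun w : MeshSample => w.2) (fun z => by fun_prop)
      ((measurable_flow b y).comp (by fun_prop))
  -- For fixed rings the new configuration is an injective relabelling of i.i.d. variables, so it is
  -- again i.i.d. and independent of the rings.
  · exact Measure.map_infinitePi_infinitePi_of_inj (P := fun _ : ℤ => coinLaw ρ) (flow_injective a.1 b)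

/-- Stationarity moves the initial configuration from time 0 to time `t`, so the length of the
backward trajectories is governed by the slab and not by its distance from time 0. -/
theorem meshLaw_meshArrows {p ρ : ℝ} (hp0 : 0 < p) (hp1 : p < 1) (hρ0 : 0 < ρ) (hρ1 : ρ < 1)
    (pb pw : ℝ) (n : ℕ) (t : ℤ) {S : Set (ℤ × ℤ → Bool)} {F : Set (ℤ × ℤ)} (hF : F.Finite)
    (hS : DependsOn (· ∈ S) F) (ht : ∀ q ∈ F, t ≤ q.2) :
    meshLaw p ρ (meshArrows pb pw n ⁻¹' S) =
      meshLaw p ρ (windowArrows pb pw (fun s => n * (s - t).toNat) (n * t) ⁻¹' S) := by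
  have hw := measurable_windowArrows pb pw (fun s => n * (s - t).toNat) (n * t)
  rw [← (measurePreserving_flow hp0 hp1 hρ0 hρ1 (n * t)).measure_preimage
    (hw (measurableSet_of_dependsOn hF hS)).nullMeasurableSet]
  congr 1
  ext w
  refine mem_iff_of_dependsOn hS fun q hq => coinArrow_congr rfl ?_
  have hq' := ht q hq
  have h : (n : ℤ) * q.2 = n * t + ((n * (q.2 - t).toNat : ℕ) : ℤ) := by
    push_cast
    rw [Int.toNat_of_nonneg (by omega)]
    ring
  dsimp only
  rw [← flow_add, ← h]

/-! ### Decoupling of the exclusion process -/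

/-- The mesh sample of a sample of the exclusion process. -/
def toMesh (n : ℕ) (ω : SSEPSample × (ℤ × ℤ → unitInterval)) : MeshSample :=
  ((rings (1 / n) ω.1.2, ω.2), ω.1.1)

theorem measurePreserving_toMesh {ρ γ : ℝ} (hρ0 : 0 < ρ) (hρ1 : ρ < 1) (hγ : 0 < γ) {n : ℕ} (hn : 1 ≤ n) :
    MeasurePreserving (toMesh n) (annealed (ssep ρ γ)) (meshLaw (1 - Real.exp (-(γ * (1 / n)))) ρ) := by
  have hn0 : (0 : ℝ) < 1 / n := by positivity
  have := isProbabilityMeasure_coinLaw hρ0 hρ1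
  have := isProbabilityMeasure_expMeasure hγ
  have := isProbabilityMeasure_ringCoin hγ hn0
  set C := Measure.infinitePi fun _ : ℤ => coinLaw ρ
  set X := Measure.infinitePi fun _ : ℤ × Bool × ℕ => expMeasure γ
  set V := Measure.infinitePi fun _ : ℤ × ℤ => (volume : Measure unitInterval)
  have h1 : MeasurePreserving MeasurableEquiv.prodAssoc ((C.prod X).prod V) (C.prod (X.prod V)) :=
    measurePreserving_prodAssoc C X V
  have h2 : MeasurePreserving Prod.swap (C.prod (X.prod V)) ((X.prod V).prod C) :=
    Measure.measurePreserving_swap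
  exact (((measurePreserving_rings hγ hn0).prod (MeasurePreserving.id V)).prod
    (MeasurePreserving.id C)).comp (h2.comp h1)

theorem ae_eventually_toMesh {ρ γ : ℝ} (hρ0 : 0 < ρ) (hρ1 : ρ < 1) (hγ : 0 < γ) (pb pw : ℝ)
    {F : Set (ℤ × ℤ)} (hF : F.Finite) : ∀ᵐ ω ∂(annealed (ssep ρ γ)), ∀ᶠ n : ℕ in atTop, ∀ q ∈ F,
      meshArrows pb pw n (toMesh n ω) q = envArrows (ssep ρ γ) pb pw ω q := by
  have := isProbabilityMeasure_coinLaw hρ0 hρ1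
  have := isProbabilityMeasure_expMeasure hγ
  have hq : MeasurePreserving (fun ω : SSEPSample × (ℤ × ℤ → unitInterval) => ω.1.2) (annealed (ssep ρ γ))
      (Measure.infinitePi fun _ : ℤ × Bool × ℕ => expMeasure γ) := by
    have h1 : MeasurePreserving (Prod.snd : SSEPSample → _) (ssepLaw ρ γ)
      (Measure.infinitePi fun _ : ℤ × Bool × ℕ => expMeasure γ) := measurePreserving_snd
    have : IsProbabilityMeasure (ssepLaw ρ γ) := by unfold ssepLaw; infer_instance
    exact h1.comp (measurePreserving_fst (μ := ssepLaw ρ γ))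
  filter_upwards [hq.quasiMeasurePreserving.ae (ae_eventually_ssepField hγ)] with ω hω
  refine (eventually_all_finite hF).2 fun q _ => ?_
  filter_upwards [hω q.2 q.1] with n hn
  exact (arrows_eq_coinArrow (hn ω.1.1)).symm

theorem sq_mul_exp_neg_le {c : ℝ} (hc : 0 < c) {x : ℝ} (hx : 0 ≤ x) :
    x ^ 2 * Real.exp (-(c * x)) ≤ 2 / c ^ 2 := by
  have h1 := Real.quadratic_le_exp_of_nonneg (mul_nonneg hc.le hx)
  rw [Real.exp_neg, ← div_eq_mul_inv, div_le_div_iff₀ (Real.exp_pos _) (by positivity)]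
  nlinarith [mul_nonneg hc.le hx]

theorem cosh_sub_one_le {θ : ℝ} (h0 : 0 ≤ θ) (h1 : θ ≤ 1) : Real.cosh θ - 1 ≤ θ ^ 2 := by
  have h2 := Real.cosh_le_exp_half_sq θ
  have h3 := Real.exp_bound_div_one_sub_of_interval (x := θ ^ 2 / 2) (by positivity) (by nlinarith)
  have h4 : 1 / (1 - θ ^ 2 / 2) ≤ 1 + θ ^ 2 := by
    rw [div_le_iff₀ (by nlinarith)]
    nlinarith [sq_nonneg θ, mul_nonneg (sq_nonneg θ) (show 0 ≤ 1 - θ ^ 2 by nlinarith)]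
  linarith

/-- Over `N T` cells of ring probability at most `γ / N` the exponential moment costs at most `2 γ
θ² T ≤ θ v T / 4`, uniformly in `N`, while the distance to the cut gains almost `θ v T / 2`. -/
theorem mesh_error_le {γ v θ : ℝ} (hγ : 0 < γ) (hv : 0 < v) (hθ0 : 0 < θ) (hθ1 : θ ≤ 1)
    (hθv : 8 * γ * θ ≤ v) {N n T : ℕ} (hN : 1 ≤ N) (hnT : n ≤ T) {d : ℤ} (hd : v * T / 2 - 1 ≤ d) :
    Real.exp (θ * (2 - d)) * Real.exp (2 * (1 - Real.exp (-(γ * (1 / N)))) * (Real.cosh θ - 1)) ^ (N * T) ≤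
      Real.exp 3 * Real.exp (-(θ * v / 4 * n)) := by
  have hN0 : (0 : ℝ) < N := by exact_mod_cast hN
  have hnT' : (n : ℝ) ≤ T := by exact_mod_cast hnT
  have hp : (1 - Real.exp (-(γ * (1 / N)))) * N ≤ γ := by
    have := Real.add_one_le_exp (-(γ * (1 / N)))
    calc (1 - Real.exp (-(γ * (1 / N)))) * N ≤ (γ * (1 / N)) * N := by gcongr; linarith
      _ = γ := by field_simp
  have hc0 : 0 ≤ Real.cosh θ - 1 := by linarith [Real.one_le_cosh θ]
  have hc := cosh_sub_one_le hθ0.le hθ1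
  rw [← Real.exp_nat_mul, ← Real.exp_add, ← Real.exp_add]
  refine Real.exp_le_exp.2 ?_
  push_cast
  have hT : (0 : ℝ) ≤ T := by positivity
  have h1 : (N * T : ℝ) * (2 * (1 - Real.exp (-(γ * (1 / N)))) * (Real.cosh θ - 1)) ≤ θ * v / 4 * T := by
    calc (N * T : ℝ) * (2 * (1 - Real.exp (-(γ * (1 / N)))) * (Real.cosh θ - 1))
        = 2 * ((1 - Real.exp (-(γ * (1 / N)))) * N) * (T * (Real.cosh θ - 1)) := by ring
      _ ≤ 2 * γ * (T * θ ^ 2) := by gcongr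
      _ = (8 * γ * θ) * (θ / 4 * T) := by ring
      _ ≤ v * (θ / 4 * T) := by gcongr
      _ = θ * v / 4 * T := by ring
  have h2 : θ * (2 - d) ≤ θ * (3 - v * T / 2) :=
    mul_le_mul_of_nonneg_left (by linarith) hθ0.le
  have h3 : θ * v / 4 * n ≤ θ * v / 4 * T := by gcongr
  nlinarith

theorem decoupled_ssep {ρ γ : ℝ} (hρ0 : 0 < ρ) (hρ1 : ρ < 1) (hγ : 0 < γ) (pb pw : ℝ) :
    Decoupled (annealed (ssep ρ γ)) (envArrows (ssep ρ γ) pb pw) := by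
  refine decoupled_of_left fun v hv => ?_
  obtain ⟨θ, hθ0, hθ1, hθv⟩ : ∃ θ : ℝ, 0 < θ ∧ θ ≤ 1 ∧ 8 * γ * θ ≤ v := by
    refine ⟨min 1 (v / (8 * γ)), by positivity, min_le_left _ _, ?_⟩
    calc 8 * γ * min 1 (v / (8 * γ)) ≤ 8 * γ * (v / (8 * γ)) := by gcongr; exact min_le_right _ _
      _ = v := by field_simp
  set c := θ * v / 8 with hc
  have hc0 : 0 < c := by positivity
  refine ⟨24 * Real.exp 3 * (2 / c ^ 2), by positivity, c, hc0, ?_⟩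
  intro n T x₁ x₂ t t₁ t₂ hn hnT ht1 ht1' ht2 ht2' hx S₁ S₂ hS₁ hS₂
  have hprob : IsProbabilityMeasure (annealed (ssep ρ γ)) :=
    isProbabilityMeasure_annealed (.exclusion γ hγ) hρ0 hρ1
  set P := annealed (ssep ρ γ) with hP
  have hT0 : (1 : ℝ) ≤ T := by exact_mod_cast hn.trans hnT
  have hS₁' : DependsOn (· ∈ S₁) ((boxF x₁ t₁ n : Finset (ℤ × ℤ)) : Set (ℤ × ℤ)) :=
    fun a a' h => hS₁ fun q hq => h q (mem_boxF.2 hq)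
  have hS₂' : DependsOn (· ∈ S₂) ((boxF x₂ t₂ n : Finset (ℤ × ℤ)) : Set (ℤ × ℤ)) :=
    fun a a' h => hS₂ fun q hq => h q (mem_boxF.2 hq)
  have hS₁m := measurableSet_of_dependsOn (finite_box x₁ t₁ n) hS₁
  have hS₂m := measurableSet_of_dependsOn (finite_box x₂ t₂ n) hS₂
  set A : Set (ℤ × ℤ → Bool) → ℕ → Set (SSEPSample × (ℤ × ℤ → unitInterval)) :=
    fun S N => toMesh (N + 1) ⁻¹' (meshArrows pb pw (N + 1) ⁻¹' S) with hA
  have hpres := fun N : ℕ => measurePreserving_toMesh hρ0 hρ1 hγ (n := N + 1) (by omega)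
  have hAm : ∀ S, MeasurableSet S → ∀ N, MeasurableSet (A S N) := fun S hS N =>
    (hpres N).measurable (measurable_meshArrows pb pw (N + 1) hS)
  have hlim : ∀ (S : Set (ℤ × ℤ → Bool)) (F : Set (ℤ × ℤ)), F.Finite → DependsOn (· ∈ S) F →
      Tendsto (fun N => P (A S N)) atTop (𝓝 (P (envArrows (ssep ρ γ) pb pw ⁻¹' S))) := by
    intro S F hF hS
    refine tendsto_measure_of_ae_eventually (hAm S (measurableSet_of_dependsOn hF hS)) ?_
    filter_upwards [ae_eventually_toMesh hρ0 hρ1 hγ pb pw hF] with ω hω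
    filter_upwards [(tendsto_add_atTop_nat 1).eventually hω] with N hN
    exact mem_iff_of_dependsOn hS hN
  have hS₁₂ : DependsOn (· ∈ S₁ ∩ S₂) (box x₁ t₁ n ∪ box x₂ t₂ n) := fun a a' h =>
    propext (and_congr (mem_iff_of_dependsOn hS₁ fun q hq => h q (Or.inl hq))
      (mem_iff_of_dependsOn hS₂ fun q hq => h q (Or.inr hq)))
  have h12 := hlim (S₁ ∩ S₂) _ ((finite_box x₁ t₁ n).union (finite_box x₂ t₂ n)) hS₁₂
  have h1 := hlim S₁ _ (finite_box x₁ t₁ n) hS₁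
  have h2 := hlim S₂ _ (finite_box x₂ t₂ n) hS₂
  rw [Set.preimage_inter] at h12
  -- The error term does not depend on the mesh, so the inequality may be proved for each mesh and
  -- passes to the limit.
  refine le_of_tendsto_of_tendsto' h12 ((ENNReal.Tendsto.mul h1 (Or.inr (measure_ne_top _ _)) h2
    (Or.inr (measure_ne_top _ _))).add_const _) fun N => ?_
  set p := 1 - Real.exp (-(γ * (1 / ((N + 1 : ℕ) : ℝ)))) with hp
  have hp0 : 0 < p := by simp only [hp, sub_pos, Real.exp_lt_one_iff, neg_lt_zero]; positivity
  have hp1 : p < 1 := by simp only [hp]; linarith [Real.exp_pos (-(γ * (1 / ((N + 1 : ℕ) : ℝ))))]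
  have hmesh : ∀ S, MeasurableSet S → P (A S N) = meshLaw p ρ (meshArrows pb pw (N + 1) ⁻¹' S) :=
    fun S hS => (hpres N).measure_preimage (measurable_meshArrows pb pw (N + 1) hS).nullMeasurableSet
  have hwin : ∀ (S : Set (ℤ × ℤ → Bool)) (F : Set (ℤ × ℤ)), F.Finite → DependsOn (· ∈ S) F →
      (∀ q ∈ F, t ≤ q.2) → P (A S N) = meshLaw p ρ
        (windowArrows pb pw (fun s => (N + 1) * (s - t).toNat) ((N + 1 : ℕ) * t) ⁻¹' S) := fun S F hF hS ht => by
    rw [hmesh S (measurableSet_of_dependsOn hF hS), meshLaw_meshArrows hp0 hp1 hρ0 hρ1 pb pw (N + 1) t hF hS ht]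
  have htime1 : ∀ q ∈ box x₁ t₁ n, t ≤ q.2 := fun q hq => ht1.trans hq.2.1
  have htime2 : ∀ q ∈ box x₂ t₂ n, t ≤ q.2 := fun q hq => ht2.trans hq.2.1
  rw [hwin _ _ ((finite_box x₁ t₁ n).union (finite_box x₂ t₂ n)) hS₁₂
      (fun q hq => hq.elim (htime1 q) (htime2 q)), hwin _ _ (finite_box x₁ t₁ n) hS₁ htime1,
    hwin _ _ (finite_box x₂ t₂ n) hS₂ htime2, Set.preimage_inter]
  -- The cut is placed at distance `d` to the right of the first box; the gap of at least `v T`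
  -- leaves the distance `d` to the second box as well.
  set d := ⌊v * T / 2⌋ with hd
  have hd0 : 0 ≤ d := Int.floor_nonneg.2 (by positivity)
  have hd1 : (d : ℝ) ≤ v * T / 2 := Int.floor_le _
  have hd2 : v * T / 2 - 1 ≤ d := (Int.sub_one_lt_floor _).le
  have hdep := windowArrows_decouple hp0 hp1 hρ0 hρ1 pb pw (κ := fun s => (N + 1) * (s - t).toNat)
    ((N + 1 : ℕ) * t) (m := x₁ + 3 * n + d) (F₁ := boxF x₁ t₁ n) (F₂ := boxF x₂ t₂ n) (K := (N + 1) * T) hd0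
    (fun q hq => ?_) (fun q hq => ?_) hS₁' hS₂' hθ0.le
  · refine hdep.trans ?_
    gcongr
    rw [show (4 : ℝ≥0∞) = ENNReal.ofReal 4 by simp, ← ENNReal.ofReal_mul (by norm_num)]
    refine ENNReal.ofReal_le_ofReal ?_
    rw [card_boxF, card_boxF]
    have herr := mesh_error_le hγ hv hθ0 hθ1 hθv (N := N + 1) (by omega) hnT hd2
    have hsq := sq_mul_exp_neg_le hc0 (x := n) (by positivity)
    -- The rate available is `2 c`: one half absorbs the number of points in the boxes, of order
    -- `n²`, and the other is kept.
    have hsplit : Real.exp (-(θ * v / 4 * n)) = Real.exp (-(c * n)) * Real.exp (-c * n) := by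
      rw [← Real.exp_add]
      congr 1
      rw [hc]
      ring
    calc _ ≤ 4 * ((((3 * n * n : ℕ) : ℝ) + (3 * n * n : ℕ)) * (Real.exp 3 * Real.exp (-(θ * v / 4 * n)))) := by
          gcongr
      _ = 24 * Real.exp 3 * ((n : ℝ) ^ 2 * Real.exp (-(c * n))) * Real.exp (-c * n) := by
          rw [hsplit]; push_cast; ring
      _ ≤ 24 * Real.exp 3 * (2 / c ^ 2) * Real.exp (-c * n) := by gcongr
  · obtain ⟨⟨-, h3⟩, h4, h5⟩ := mem_boxF.1 hq
    exact ⟨Nat.mul_le_mul_left _ (by omega), by omega⟩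
  · obtain ⟨⟨h3, -⟩, h4, h5⟩ := mem_boxF.1 hq
    have h6 : (x₂ : ℝ) ≤ q.1 := by exact_mod_cast h3
    have hvT : 0 < v * T := by positivity
    refine ⟨Nat.mul_le_mul_left _ (by omega), ?_, ?_⟩
    · have : ((x₁ + 3 * n + d : ℤ) : ℝ) < q.1 := by push_cast; linarith
      exact_mod_cast this
    · have : ((x₁ + 3 * n + d + d : ℤ) : ℝ) ≤ q.1 := by push_cast; linarith
      exact_mod_cast this

/-! ### Poisson clouds of marked points -/

section Marked

variable {Y : Type*} [MeasurableSpace Y] (ν : Measure Y) [IsProbabilityMeasure ν] (r : ℝ≥0)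

/-- A Poisson number of points at every site, with independent marks of law `ν`. -/
def markedLaw : Measure ((ℤ → ℕ) × (ℤ × ℕ → Y)) :=
  (Measure.infinitePi fun _ : ℤ => poissonMeasure r).prod (Measure.infinitePi fun _ : ℤ × ℕ => ν)

instance : IsProbabilityMeasure (markedLaw ν r) := by
  unfold markedLaw
  infer_instance

/-- No point at `x` has a mark in `V`. -/
def siteVoid (x : ℤ) (V : Set Y) : Set ((ℤ → ℕ) × (ℤ × ℕ → Y)) := {ω | ∀ i < ω.1 x, ω.2 (x, i) ∉ V}

/-- No point at any site `x` has a mark in `V x`. -/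
def void (V : ℤ → Set Y) : Set ((ℤ → ℕ) × (ℤ × ℕ → Y)) := ⋂ x, siteVoid x (V x)

theorem measurableSet_siteVoid (x : ℤ) {V : Set Y} (hV : MeasurableSet V) : MeasurableSet (siteVoid x V) := by
  have : siteVoid x V = ⋂ i : ℕ, {ω | i < ω.1 x}ᶜ ∪ {ω | ω.2 (x, i) ∈ V}ᶜ := by
    ext ω
    simp only [siteVoid, Set.mem_ofPred_eq, Set.mem_iInter, Set.mem_union, Set.mem_compl_iff]
    exact forall_congr' fun i => imp_iff_not_or
  rw [this]
  have h1 : ∀ i : ℕ, MeasurableSet {ω : (ℤ → ℕ) × (ℤ × ℕ → Y) | i < ω.1 x} := fun i =>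
    measurableSet_lt measurable_const (by fun_prop)
  have h2 : ∀ i : ℕ, MeasurableSet {ω : (ℤ → ℕ) × (ℤ × ℕ → Y) | ω.2 (x, i) ∈ V} := fun i =>
    (show Measurable fun ω : (ℤ → ℕ) × (ℤ × ℕ → Y) => ω.2 (x, i) by fun_prop) hV
  exact .iInter fun i => (h1 i).compl.union (h2 i).compl

theorem measurableSet_void {V : ℤ → Set Y} (hV : ∀ x, MeasurableSet (V x)) : MeasurableSet (void V) :=
  .iInter fun x => measurableSet_siteVoid x (hV x)

theorem lintegral_poisson_pow {s : ℝ} (hs : 0 ≤ s) :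
    ∫⁻ k, ENNReal.ofReal s ^ k ∂(poissonMeasure r) = ENNReal.ofReal (Real.exp (-(r * (1 - s)))) := by
  have hterm : ∀ k : ℕ, ENNReal.ofReal (Real.exp (-(r : ℝ)) * r ^ k / k.factorial) * ENNReal.ofReal s ^ k =
      ENNReal.ofReal (Real.exp (-(r : ℝ)) * ((r * s) ^ k / k.factorial)) := by
    intro k
    rw [← ENNReal.ofReal_pow hs, ← ENNReal.ofReal_mul (by positivity)]
    congr 1
    rw [mul_pow]
    ring
  have hsum := (NormedSpace.expSeries_div_hasSum_exp (𝔸 := ℝ) (r * s)).mul_left (Real.exp (-(r : ℝ)))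
  rw [poissonMeasure, lintegral_sum_measure]
  simp only [lintegral_smul_measure, lintegral_dirac, smul_eq_mul, hterm]
  rw [← ENNReal.ofReal_tsum_of_nonneg (fun k => by positivity) hsum.summable, hsum.tsum_eq,
    ← Real.exp_eq_exp_ℝ, ← Real.exp_add]
  congr 2
  ring

/-- Given the number of points at `x`, each one avoids `V` independently; the generating function of
the Poisson law then gives an exponential. -/
theorem markedLaw_siteVoid (x : ℤ) {V : Set Y} (hV : MeasurableSet V) :
    markedLaw ν r (siteVoid x V) = ENNReal.ofReal (Real.exp (-(r * ν.real V))) := by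
  classical
  have hfib : ∀ N : ℤ → ℕ, (Measure.infinitePi fun _ : ℤ × ℕ => ν) (Prod.mk N ⁻¹' siteVoid x V) =
      ENNReal.ofReal (1 - ν.real V) ^ N x := by
    intro N
    have : Prod.mk N ⁻¹' siteVoid x V =
        ((((Finset.range (N x)).image fun i => (x, i) : Finset (ℤ × ℕ)) : Set (ℤ × ℕ)).pi fun _ => Vᶜ) := by
      ext w
      simp [siteVoid, Set.pi]
    rw [this, Measure.infinitePi_pi _ fun _ _ => hV.compl, Finset.prod_const,
      Finset.card_image_of_injective _ fun i j h => by simpa using h, Finset.card_range,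
      ← probReal_compl_eq_one_sub hV, Measure.real, ENNReal.ofReal_toReal (measure_ne_top _ _)]
  rw [markedLaw, Measure.prod_apply (measurableSet_siteVoid x hV)]
  simp only [hfib]
  rw [(measurePreserving_eval_infinitePi (fun _ : ℤ => poissonMeasure r) x).lintegral_comp
    (f := fun k => ENNReal.ofReal (1 - ν.real V) ^ k) (measurable_of_countable _),
    lintegral_poisson_pow r (by linarith [measureReal_le_one (μ := ν) (s := V)]), sub_sub_cancel]

theorem markedLaw_iInter_siteVoid (X : Finset ℤ) {V : ℤ → Set Y} (hV : ∀ x, MeasurableSet (V x)) :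
    markedLaw ν r (⋂ x ∈ X, siteVoid x (V x)) = ∏ x ∈ X, markedLaw ν r (siteVoid x (V x)) := by
  classical
  induction X using Finset.induction_on with
  | empty => simp
  | insert a X ha ih =>
    rw [Finset.prod_insert ha, ← ih, Finset.set_biInter_insert]
    have hmix := measurePreserving_mixProd (measurePreserving_mixPi (fun _ : ℤ => poissonMeasure r) {a})
      (measurePreserving_mixPi (fun _ : ℤ × ℕ => ν) {p | p.1 = a})
    refine measure_inter_eq_mul_of_mix hmix (measurableSet_siteVoid a (hV a))
      (Finset.measurableSet_biInter _ fun x _ => measurableSet_siteVoid x (hV x)) (fun p p' => ?_)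
      fun p p' => ?_
    · have e1 : mixPi {a} (p.1, p'.1) a = p.1 a := mixPi_of_mem rfl _
      have e2 : ∀ i, mixPi {q : ℤ × ℕ | q.1 = a} (p.2, p'.2) (a, i) = p.2 (a, i) := fun i =>
        mixPi_of_mem (S := {q : ℤ × ℕ | q.1 = a}) rfl _
      simp only [siteVoid, mixProd, Set.mem_ofPred_eq, e1, e2]
    · have e1 : ∀ x ∈ X, mixPi {a} (p.1, p'.1) x = p'.1 x := fun x hx =>
        mixPi_of_notMem (by rintro rfl; exact ha hx) _
      have e2 : ∀ x ∈ X, ∀ i, mixPi {q : ℤ × ℕ | q.1 = a} (p.2, p'.2) (x, i) = p'.2 (x, i) := fun x hx i =>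
        mixPi_of_notMem (S := {q : ℤ × ℕ | q.1 = a}) (by rintro rfl; exact ha hx) _
      simp only [siteVoid, mixProd, Set.mem_iInter, Set.mem_ofPred_eq]
      refine forall₂_congr fun x hx => ?_
      rw [e1 x hx]
      simp only [e2 x hx]

theorem tendsto_markedLaw_void {V : ℤ → Set Y} (hV : ∀ x, MeasurableSet (V x)) :
    Tendsto (fun R : ℕ => ∏ x ∈ Finset.Icc (-(R : ℤ)) R, markedLaw ν r (siteVoid x (V x))) atTop
      (𝓝 (markedLaw ν r (void V))) := by
  have h : void V = ⋂ R : ℕ, ⋂ x ∈ Finset.Icc (-(R : ℤ)) R, siteVoid x (V x) := by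
    ext ω
    simp only [void, Set.mem_iInter, Finset.mem_Icc]
    refine ⟨fun h R x _ => h x, fun h x => h x.natAbs x ⟨?_, ?_⟩⟩ <;> omega
  rw [h]
  simp only [← markedLaw_iInter_siteVoid ν r _ hV]
  refine tendsto_measure_iInter_atTop (fun R => (Finset.measurableSet_biInter _ fun x _ =>
    measurableSet_siteVoid x (hV x)).nullMeasurableSet) (fun R R' hR => ?_) ⟨0, measure_ne_top _ _⟩
  refine Set.biInter_subset_biInter_left fun x hx => ?_
  simp only [Finset.coe_Icc, Set.mem_Icc] at hx ⊢
  omega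

/-- Points with marks in disjoint sets are independent. -/
theorem markedLaw_void_union {V W : ℤ → Set Y} (hV : ∀ x, MeasurableSet (V x))
    (hW : ∀ x, MeasurableSet (W x)) (hd : ∀ x, Disjoint (V x) (W x)) :
    markedLaw ν r (void fun x => V x ∪ W x) = markedLaw ν r (void V) * markedLaw ν r (void W) := by
  have h1 := tendsto_markedLaw_void ν r hV
  have h2 := tendsto_markedLaw_void ν r hW
  have h3 := tendsto_markedLaw_void ν r fun x => (hV x).union (hW x)
  refine tendsto_nhds_unique h3 ?_
  convert ENNReal.Tendsto.mul h1 (Or.inr (measure_ne_top _ _)) h2 (Or.inr (measure_ne_top _ _)) using 2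
  -- Void probabilities are exponentials of `-r ν`, so additivity of `ν` on disjoint sets becomes
  -- multiplicativity.
  rw [← Finset.prod_mul_distrib]
  refine Finset.prod_congr rfl fun x _ => ?_
  rw [markedLaw_siteVoid ν r x (hV x), markedLaw_siteVoid ν r x (hW x),
    markedLaw_siteVoid ν r x ((hV x).union (hW x)), measureReal_union (hd x) (hW x),
    ← ENNReal.ofReal_mul (Real.exp_nonneg _), ← Real.exp_add]
  congr 2
  ring

/-- Union bound over the sites, together with `1 - exp (-x) ≤ x`. -/
theorem markedLaw_void_compl_le {V : ℤ → Set Y} (hV : ∀ x, MeasurableSet (V x)) :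
    markedLaw ν r (void V)ᶜ ≤ r * ∑' x, ν (V x) := by
  rw [void, Set.compl_iInter, ← ENNReal.tsum_mul_left]
  refine (measure_iUnion_le _).trans (ENNReal.tsum_le_tsum fun x => ?_)
  rw [prob_compl_eq_one_sub (measurableSet_siteVoid x (hV x)), markedLaw_siteVoid ν r x (hV x),
    tsub_le_iff_right]
  have h : (r : ℝ≥0∞) * ν (V x) = ENNReal.ofReal (r * ν.real (V x)) := by
    rw [ENNReal.ofReal_mul (by positivity), Measure.real, ENNReal.ofReal_toReal (measure_ne_top _ _)]
    simp
  rw [h, ← ENNReal.ofReal_add (by positivity) (Real.exp_nonneg _), ← ENNReal.ofReal_one]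
  refine ENNReal.ofReal_le_ofReal ?_
  linarith [Real.add_one_le_exp (-(r * ν.real (V x)))]

open Classical in
/-- The indicators of the points `q` for which some point at a site `x` has its mark in `V x q`. -/
def present {Q : Type*} (V : ℤ → Q → Set Y) (ω : (ℤ → ℕ) × (ℤ × ℕ → Y)) (q : Q) : Bool :=
  decide (ω ∉ void fun x => V x q)

variable {Q : Type*}

omit [MeasurableSpace Y] in
theorem present_eq_false_iff {V : ℤ → Q → Set Y} {ω : (ℤ → ℕ) × (ℤ × ℕ → Y)} {q : Q} :
    present V ω q = false ↔ ω ∈ void fun x => V x q := by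
  simp [present]

theorem measurable_present {V : ℤ → Q → Set Y} (hV : ∀ x q, MeasurableSet (V x q)) :
    Measurable (present V) := by
  refine measurable_pi_iff.2 fun q => measurable_to_bool ?_
  have : (fun ω => present V ω q) ⁻¹' {true} = (void fun x => V x q)ᶜ := by
    ext ω
    simp [present]
  rw [this]
  exact (measurableSet_void fun x => hV x q).compl

/-- The fields which vanish on a given finite set. -/
def vanishing (Q : Type*) : Set (Set (Q → Bool)) := Set.range fun A : Finset Q => {o | ∀ q ∈ A, o q = false}

/-- Avoidance events of finite sets already generate the product σ-algebra, so void probabilities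
determine the joint law of presence fields. -/
theorem generateFrom_vanishing : MeasurableSpace.generateFrom (vanishing Q) = MeasurableSpace.pi := by
  refine le_antisymm (MeasurableSpace.generateFrom_le ?_) ?_
  · rintro _ ⟨A, rfl⟩
    have : {o : Q → Bool | ∀ q ∈ A, o q = false} = ⋂ q ∈ A, (fun o => o q) ⁻¹' {false} := by
      ext o
      simp
    dsimp only
    rw [this]
    exact Finset.measurableSet_biInter _ fun q _ => measurable_pi_apply q (measurableSet_singleton _)
  · refine iSup_le fun q => ?_
    rw [← measurable_iff_comap_le]
    refine @measurable_to_bool _ (MeasurableSpace.generateFrom (vanishing Q)) _ ?_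
    have : (fun o : Q → Bool => o q) ⁻¹' {true} = {o | ∀ q' ∈ ({q} : Finset Q), o q' = false}ᶜ := by
      ext o
      simp
    rw [this]
    exact (MeasurableSpace.measurableSet_generateFrom (s := vanishing Q) ⟨{q}, rfl⟩).compl

theorem isPiSystem_vanishing : IsPiSystem (vanishing Q) := by
  classical
  rintro _ ⟨A, rfl⟩ _ ⟨B, rfl⟩ -
  refine ⟨A ∪ B, ?_⟩
  ext o
  simp only [Finset.mem_union, Set.mem_ofPred_eq, Set.mem_inter_iff]
  exact ⟨fun h => ⟨fun q hq => h q (Or.inl hq), fun q hq => h q (Or.inr hq)⟩,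
    fun h q hq => hq.elim (h.1 q) (h.2 q)⟩

/-- The finite spanning sequence which consists of the whole space. -/
def vanishingSpanning (μ : Measure (Q → Bool)) [IsFiniteMeasure μ] : μ.FiniteSpanningSetsIn (vanishing Q) where
  set _ := Set.univ
  set_mem _ := ⟨∅, by simp⟩
  finite _ := measure_lt_top _ _
  spanning := by simp [Set.iUnion_const]

omit [MeasurableSpace Y] in
-- Vanishing on a finite set is a void event for the union of the marks, which reduces independence
-- of the fields to the product formula for void probabilities.
theorem present_mem_vanishing {V : ℤ → Q → Set Y} (A : Finset Q) :
    present V ⁻¹' {o | ∀ q ∈ A, o q = false} = void fun x => ⋃ q ∈ A, V x q := by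
  ext ω
  simp only [Set.mem_preimage, Set.mem_ofPred_eq, present_eq_false_iff, void, siteVoid,
    Set.mem_iInter, Set.mem_iUnion, not_exists]
  exact ⟨fun h x i hi q hq => h q hq x i hi, fun h q hq x i hi => h x i hi q hq⟩

/-- The fields given by points with marks in disjoint sets are independent. -/
theorem measurePreserving_present {V W : ℤ → Q → Set Y} (hV : ∀ x q, MeasurableSet (V x q))
    (hW : ∀ x q, MeasurableSet (W x q)) (hd : ∀ x q q', Disjoint (V x q) (W x q')) :
    MeasurePreserving (fun ω => (present V ω, present W ω)) (markedLaw ν r)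
      (((markedLaw ν r).map (present V)).prod ((markedLaw ν r).map (present W))) := by
  have mV := measurable_present hV
  have mW := measurable_present hW
  have : IsProbabilityMeasure ((markedLaw ν r).map (present V)) := Measure.isProbabilityMeasure_map mV.aemeasurable
  have : IsProbabilityMeasure ((markedLaw ν r).map (present W)) := Measure.isProbabilityMeasure_map mW.aemeasurable
  refine ⟨mV.prodMk mW, (Measure.prod_eq_generateFrom generateFrom_vanishing generateFrom_vanishing
    isPiSystem_vanishing isPiSystem_vanishing (vanishingSpanning _) (vanishingSpanning _) ?_).symm⟩
  have hm : ∀ s ∈ vanishing Q, MeasurableSet s := fun s hs => by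
    rw [← generateFrom_vanishing]
    exact MeasurableSpace.measurableSet_generateFrom hs
  rintro s hs t ht
  have hs' := hm s hs
  have ht' := hm t ht
  rw [Measure.map_apply (mV.prodMk mW) (hs'.prod ht'), Measure.map_apply mV hs', Measure.map_apply mW ht']
  obtain ⟨A, rfl⟩ := hs
  obtain ⟨B, rfl⟩ := ht
  rw [Set.mk_preimage_prod, present_mem_vanishing, present_mem_vanishing,
    ← markedLaw_void_union ν r (fun x => Finset.measurableSet_biUnion _ fun q _ => hV x q)
      (fun x => Finset.measurableSet_biUnion _ fun q _ => hW x q)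
      fun x => Set.disjoint_iUnion₂_left.2 fun q _ => Set.disjoint_iUnion₂_right.2 fun q' _ => hd x q q']
  congr 1
  ext ω
  simp only [void, siteVoid, Set.mem_inter_iff, Set.mem_iInter, Set.mem_ofPred_eq, Set.mem_union, not_or]
  exact ⟨fun h x i hi => ⟨h.1 x i hi, h.2 x i hi⟩, fun h => ⟨fun x i hi => (h x i hi).1, fun x i hi => (h x i hi).2⟩⟩

end Marked

/-! ### Lazy walks -/

/-- The displacement between the times `0` and `s` of a walk with the steps `w`. -/
def disp (w : ℤ → ℤ) (s : ℤ) : ℤ := ∑ j ∈ Finset.Ico 0 s, w j - ∑ j ∈ Finset.Ico s 0, w j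

theorem disp_add_one (w : ℤ → ℤ) (s : ℤ) : disp w (s + 1) = disp w s + w s := by
  unfold disp
  rcases le_or_gt 0 s with hs | hs
  · have e1 : Finset.Ico 0 (s + 1) = insert s (Finset.Ico 0 s) := by ext j; simp; omega
    have e2 : Finset.Ico s 0 = ∅ := Finset.Ico_eq_empty (by omega)
    have e3 : Finset.Ico (s + 1) 0 = ∅ := Finset.Ico_eq_empty (by omega)
    rw [e1, e2, e3, Finset.sum_insert (by simp)]
    simp
    ring
  · have e1 : Finset.Ico s 0 = insert s (Finset.Ico (s + 1) 0) := by ext j; simp; omega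
    have e2 : Finset.Ico 0 s = ∅ := Finset.Ico_eq_empty (by omega)
    have e3 : Finset.Ico 0 (s + 1) = ∅ := Finset.Ico_eq_empty (by omega)
    rw [e1, e2, e3, Finset.sum_insert (by simp)]
    simp

theorem disp_sub_disp (w : ℤ → ℤ) {s s' : ℤ} (h : s ≤ s') :
    disp w s' - disp w s = ∑ j ∈ Finset.Ico s s', w j := by
  induction s', h using Int.leInduction with
  | base => simp
  | succ s' hs ih =>
    have e1 : Finset.Ico s (s' + 1) = insert s' (Finset.Ico s s') := by ext j; simp; omega
    rw [e1, Finset.sum_insert (by simp), disp_add_one, ← ih]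
    ring

theorem measurable_disp (s : ℤ) : Measurable fun w => disp w s := by
  unfold disp
  fun_prop

section Steps

variable {q : ℝ}

theorem ae_stepLaw_mem (q : ℝ) : ∀ᵐ x ∂(stepLaw q), -1 ≤ x ∧ x ≤ 1 := by
  rw [ae_iff]
  simp [stepLaw]

theorem integral_stepLaw (q : ℝ) : ∫ x, (x : ℝ) ∂(stepLaw q) = 0 := by
  have hi : ∀ (c : ℝ) (a : ℤ), Integrable (fun x : ℤ => (x : ℝ)) (ENNReal.ofReal c • Measure.dirac a) :=
    fun c a => (integrable_dirac (by simp)).smul_measure (by simp)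
  rw [stepLaw, integral_add_measure ((hi _ _).add_measure (hi _ _)) (hi _ _),
    integral_add_measure (hi _ _) (hi _ _)]
  simp

variable (h0 : 0 < q) (h1 : q < 1)

include h0 h1

theorem hasSubgaussianMGF_step {σ : ℝ} (hσ : σ = 1 ∨ σ = -1) (j : ℤ) :
    HasSubgaussianMGF (fun w : ℤ → ℤ => σ * (w j : ℝ)) 1 (Measure.infinitePi fun _ : ℤ => stepLaw q) := by
  have := isProbabilityMeasure_stepLaw h0 h1
  have hev := measurePreserving_eval_infinitePi (fun _ : ℤ => stepLaw q) j
  have h := hasSubgaussianMGF_of_mem_Icc_of_integral_eq_zero (a := -1) (b := 1)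
    (X := fun w : ℤ → ℤ => σ * (w j : ℝ)) (μ := Measure.infinitePi fun _ : ℤ => stepLaw q)
    (((measurable_of_countable (fun x : ℤ => (x : ℝ))).comp (measurable_pi_apply j)).const_mul σ).aemeasurable
    ?_ ?_
  · convert h using 1
    rw [show (1 - (-1) : ℝ) = 2 by norm_num]
    ext
    norm_num
  · filter_upwards [hev.quasiMeasurePreserving.ae (ae_stepLaw_mem q)] with w hw
    have h2 : (-1 : ℝ) ≤ w j := by exact_mod_cast hw.1
    have h3 : (w j : ℝ) ≤ 1 := by exact_mod_cast hw.2
    rcases hσ with rfl | rfl <;> constructor <;> linarith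
  · have hi := integral_map (μ := Measure.infinitePi fun _ : ℤ => stepLaw q) hev.measurable.aemeasurable (f := fun x : ℤ => (x : ℝ))
      (measurable_of_countable _).aestronglyMeasurable
    rw [hev.map_eq, integral_stepLaw] at hi
    rw [integral_const_mul]
    exact mul_eq_zero_of_right σ hi.symm

/-- Hoeffding's inequality for centred steps in `[-1, 1]`. Having fewer than `T` summands only
improves the exponent; the empty sum is separate since the variance in the denominator vanishes. -/
theorem step_sum_ge_le {σ : ℝ} (hσ : σ = 1 ∨ σ = -1) (J : Finset ℤ) {T : ℕ} (hJ : J.card ≤ T) {v : ℝ}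
    (hv : 0 < v) (hT : 1 ≤ T) :
    (Measure.infinitePi fun _ : ℤ => stepLaw q) {w | v * T ≤ ∑ j ∈ J, σ * (w j : ℝ)} ≤
      ENNReal.ofReal (Real.exp (-(v ^ 2 * T / 2))) := by
  have := isProbabilityMeasure_stepLaw h0 h1
  have hT0 : (1 : ℝ) ≤ T := by exact_mod_cast hT
  rcases J.eq_empty_or_nonempty with rfl | hne
  · have : {w : ℤ → ℤ | v * T ≤ ∑ j ∈ (∅ : Finset ℤ), σ * (w j : ℝ)} = ∅ := by
      ext w
      simp only [Finset.sum_empty, Set.mem_ofPred_eq, Set.mem_empty_iff_false, iff_false, not_le]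
      positivity
    rw [this]
    simp
  · have hind : iIndepFun (fun (j : ℤ) (w : ℤ → ℤ) => σ * (w j : ℝ)) (Measure.infinitePi fun _ : ℤ => stepLaw q) :=
      iIndepFun_infinitePi (P := fun _ : ℤ => stepLaw q) (X := fun _ x => σ * (x : ℝ)) fun _ => by fun_prop
    have h := HasSubgaussianMGF.measure_sum_ge_le_of_iIndepFun hind (c := fun _ => 1) (s := J)
      (fun j _ => hasSubgaussianMGF_step h0 h1 hσ j) (ε := v * T) (by positivity)
    rw [← ENNReal.ofReal_toReal (measure_ne_top _ {w : ℤ → ℤ | v * T ≤ ∑ j ∈ J, σ * (w j : ℝ)})]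
    refine ENNReal.ofReal_le_ofReal (h.trans (Real.exp_le_exp.2 ?_))
    have hc0 : (0 : ℝ) < J.card := by exact_mod_cast hne.card_pos
    have hcT : (J.card : ℝ) ≤ T := by exact_mod_cast hJ
    simp only [Finset.sum_const, nsmul_eq_mul, mul_one, NNReal.coe_natCast]
    rw [neg_div, neg_le_neg_iff, le_div_iff₀ (by positivity)]
    calc v ^ 2 * T / 2 * (2 * J.card) = v ^ 2 * T * J.card := by ring
      _ ≤ v ^ 2 * T * T := by gcongr
      _ = (v * T) ^ 2 := by ring

theorem disp_far_le {T : ℕ} (hT : 1 ≤ T) {v : ℝ} (hv : 0 < v) {s s' d : ℤ} (hs : s' - s ≤ T)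
    (hs' : s - s' ≤ T) (hd : v * T ≤ d) :
    (Measure.infinitePi fun _ : ℤ => stepLaw q) {w | disp w s' - disp w s = d} ≤
      ENNReal.ofReal (Real.exp (-(v ^ 2 * T / 2))) := by
  rcases le_total s s' with h | h
  · refine (measure_mono fun w hw => ?_).trans
      (step_sum_ge_le h0 h1 (Or.inl rfl) (Finset.Ico s s') (T := T) (by simp; omega) hv hT)
    simp only [Set.mem_ofPred_eq] at hw ⊢
    rw [disp_sub_disp w h] at hw
    rw [← Finset.mul_sum, one_mul]
    refine hd.trans (le_of_eq ?_)
    rw [← hw]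
    push_cast
    rfl
  · refine (measure_mono fun w hw => ?_).trans
      (step_sum_ge_le h0 h1 (Or.inr rfl) (Finset.Ico s' s) (T := T) (by simp; omega) hv hT)
    simp only [Set.mem_ofPred_eq] at hw ⊢
    rw [← Finset.mul_sum]
    refine hd.trans (le_of_eq ?_)
    rw [← hw, ← neg_sub, disp_sub_disp w h]
    push_cast
    ring

end Steps

/-! ### Decoupling of the Poisson cloud -/

/-- The walk from `x` is at the point `p` in space-time. -/
def hit (x : ℤ) (p : ℤ × ℤ) : Set (ℤ → ℤ) := {w | x + disp w p.2 = p.1}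

/-- The walk from `x` visits `F`. -/
def meets (F : Finset (ℤ × ℤ)) (x : ℤ) : Set (ℤ → ℤ) := ⋃ p ∈ F, hit x p

open Classical in
/-- The walk from `x` is at the point `p ∈ F` and does not visit `F'`. -/
def hitOnly (F F' : Finset (ℤ × ℤ)) (x : ℤ) (p : ℤ × ℤ) : Set (ℤ → ℤ) :=
  if p ∈ F then hit x p \ meets F' x else ∅

theorem measurableSet_hit (x : ℤ) (p : ℤ × ℤ) : MeasurableSet (hit x p) :=
  ((measurable_disp p.2).const_add x) (measurableSet_singleton p.1)

theorem measurableSet_meets (F : Finset (ℤ × ℤ)) (x : ℤ) : MeasurableSet (meets F x) :=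
  Finset.measurableSet_biUnion _ fun p _ => measurableSet_hit x p

theorem measurableSet_hitOnly (F F' : Finset (ℤ × ℤ)) (x : ℤ) (p : ℤ × ℤ) :
    MeasurableSet (hitOnly F F' x p) := by
  unfold hitOnly
  split_ifs
  · exact MeasurableSet.diff (measurableSet_hit x p) (measurableSet_meets F' x)
  · exact .empty

theorem hit_subset_meets {F : Finset (ℤ × ℤ)} {p : ℤ × ℤ} (hp : p ∈ F) (x : ℤ) : hit x p ⊆ meets F x :=
  Set.subset_biUnion_of_mem (u := fun p => hit x p) (Finset.mem_coe.2 hp)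

theorem disjoint_hitOnly (F F' : Finset (ℤ × ℤ)) (x : ℤ) (p p' : ℤ × ℤ) :
    Disjoint (hitOnly F F' x p) (hitOnly F' F x p') := by
  unfold hitOnly
  split_ifs with hp hp'
  · exact Set.disjoint_left.2 fun w h1 h2 => h1.2 (hit_subset_meets hp' x h2.1)
  · exact Set.disjoint_empty _
  · exact Set.empty_disjoint _
  · exact Set.empty_disjoint _

/-- Unless a walk visits both sets, those which visit `F` only determine the occupied points of `F`. -/
theorem present_hit_eq {F F' : Finset (ℤ × ℤ)} {ω : (ℤ → ℕ) × (ℤ × ℕ → ℤ → ℤ)}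
    (h : ω ∈ void fun x => meets F x ∩ meets F' x) {p : ℤ × ℤ} (hp : p ∈ F) :
    present hit ω p = present (hitOnly F F') ω p := by
  rw [Bool.eq_iff_iff, ← not_iff_not, Bool.not_eq_true, Bool.not_eq_true, present_eq_false_iff,
    present_eq_false_iff]
  simp only [void, siteVoid, Set.mem_iInter, Set.mem_ofPred_eq, hitOnly, if_pos hp] at h ⊢
  refine ⟨fun h' x i hi hm => h' x i hi hm.1, fun h' x i hi hm => ?_⟩
  exact h' x i hi ⟨hm, fun hm' => h x i hi ⟨hit_subset_meets hp x hm, hm'⟩⟩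

/-- The arrows in terms of the walks of the particles. -/
def cloudArrows (pb pw : ℝ) (ω : ((ℤ → ℕ) × (ℤ × ℕ → ℤ → ℤ)) × (ℤ × ℤ → unitInterval)) : ℤ × ℤ → Bool :=
  coinArrow pb pw ω.2 (present hit ω.1)

/-- Walks visiting `F₁` but not `F₂` and walks visiting `F₂` but not `F₁` are disjoint classes of
marks, so their presence fields are independent. The uniform variables are split between the two
sides of `m`. -/
theorem hitOnly_independent (ν : Measure (ℤ → ℤ)) [IsProbabilityMeasure ν] (r : ℝ≥0) (pb pw : ℝ) {m : ℤ}
    {F₁ F₂ : Finset (ℤ × ℤ)} (h1 : ∀ p ∈ F₁, p.1 ≤ m) (h2 : ∀ p ∈ F₂, m < p.1)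
    {S₁ S₂ : Set (ℤ × ℤ → Bool)} (hS₁ : DependsOn (· ∈ S₁) (F₁ : Set (ℤ × ℤ)))
    (hS₂ : DependsOn (· ∈ S₂) (F₂ : Set (ℤ × ℤ))) :
    ((markedLaw ν r).prod (Measure.infinitePi fun _ : ℤ × ℤ => (volume : Measure unitInterval)))
      ({ω | coinArrow pb pw ω.2 (present (hitOnly F₁ F₂) ω.1) ∈ S₁} ∩
        {ω | coinArrow pb pw ω.2 (present (hitOnly F₂ F₁) ω.1) ∈ S₂}) =
    ((markedLaw ν r).prod (Measure.infinitePi fun _ : ℤ × ℤ => (volume : Measure unitInterval)))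
      {ω | coinArrow pb pw ω.2 (present (hitOnly F₁ F₂) ω.1) ∈ S₁} *
    ((markedLaw ν r).prod (Measure.infinitePi fun _ : ℤ × ℤ => (volume : Measure unitInterval)))
      {ω | coinArrow pb pw ω.2 (present (hitOnly F₂ F₁) ω.1) ∈ S₂} := by
  set Unif := Measure.infinitePi fun _ : ℤ × ℤ => (volume : Measure unitInterval)
  set M₁ := (markedLaw ν r).map (present (hitOnly F₁ F₂)) with hM₁
  set M₂ := (markedLaw ν r).map (present (hitOnly F₂ F₁)) with hM₂
  have : IsProbabilityMeasure M₁ :=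
    Measure.isProbabilityMeasure_map (measurable_present (measurableSet_hitOnly F₁ F₂)).aemeasurable
  have : IsProbabilityMeasure M₂ :=
    Measure.isProbabilityMeasure_map (measurable_present (measurableSet_hitOnly F₂ F₁)).aemeasurable
  have hpres := (measurePreserving_present ν r (measurableSet_hitOnly F₁ F₂) (measurableSet_hitOnly F₂ F₁)
    (disjoint_hitOnly F₁ F₂)).prod (MeasurePreserving.id Unif)
  set A₁ : Set (((ℤ × ℤ → Bool) × (ℤ × ℤ → Bool)) × (ℤ × ℤ → unitInterval)) :=
    {z | coinArrow pb pw z.2 z.1.1 ∈ S₁} with hA₁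
  set A₂ : Set (((ℤ × ℤ → Bool) × (ℤ × ℤ → Bool)) × (ℤ × ℤ → unitInterval)) :=
    {z | coinArrow pb pw z.2 z.1.2 ∈ S₂} with hA₂
  have mA₁ : MeasurableSet A₁ :=
    (measurable_pi_iff.2 fun p => measurable_coinArrow pb pw (by fun_prop) (by fun_prop) :
      Measurable fun z : ((ℤ × ℤ → Bool) × (ℤ × ℤ → Bool)) × (ℤ × ℤ → unitInterval) =>
        coinArrow pb pw z.2 z.1.1) (measurableSet_of_dependsOn F₁.finite_toSet hS₁)
  have mA₂ : MeasurableSet A₂ :=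
    (measurable_pi_iff.2 fun p => measurable_coinArrow pb pw (by fun_prop) (by fun_prop) :
      Measurable fun z : ((ℤ × ℤ → Bool) × (ℤ × ℤ → Bool)) × (ℤ × ℤ → unitInterval) =>
        coinArrow pb pw z.2 z.1.2) (measurableSet_of_dependsOn F₂.finite_toSet hS₂)
  have e12 := hpres.measure_preimage (mA₁.inter mA₂).nullMeasurableSet
  have e1 := hpres.measure_preimage mA₁.nullMeasurableSet
  have e2 := hpres.measure_preimage mA₂.nullMeasurableSet
  have hmix := measurePreserving_mixProd (measurePreserving_mixFstSnd M₁ M₂)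
    (measurePreserving_mixPi (fun _ : ℤ × ℤ => (volume : Measure unitInterval)) {p | p.1 ≤ m})
  have hind : ((M₁.prod M₂).prod Unif) (A₁ ∩ A₂) = ((M₁.prod M₂).prod Unif) A₁ * ((M₁.prod M₂).prod Unif) A₂ := by
    refine measure_inter_eq_mul_of_mix hmix mA₁ mA₂ (fun z z' => ?_) fun z z' => ?_
    · refine mem_iff_of_dependsOn hS₁ fun p hp => coinArrow_congr ?_ rfl
      exact mixPi_of_mem (S := {p : ℤ × ℤ | p.1 ≤ m}) (h1 p hp) _
    · refine mem_iff_of_dependsOn hS₂ fun p hp => coinArrow_congr ?_ rfl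
      exact mixPi_of_notMem (S := {p : ℤ × ℤ | p.1 ≤ m}) (not_le.2 (h2 p hp)) _
  rw [hind, ← e1, ← e2] at e12
  exact e12

/-- A walk meeting both sets covers a horizontal distance of at least `v T` between two times which
differ by at most `T`. -/
theorem tsum_meets_le {q : ℝ} (h0 : 0 < q) (h1 : q < 1) {T : ℕ} (hT : 1 ≤ T) {v : ℝ} (hv : 0 < v)
    {F₁ F₂ : Finset (ℤ × ℤ)}
    (hF : ∀ p ∈ F₁, ∀ p' ∈ F₂, p'.2 - p.2 ≤ T ∧ p.2 - p'.2 ≤ T ∧ v * T ≤ ((p'.1 - p.1 : ℤ) : ℝ)) :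
    ∑' x, (Measure.infinitePi fun _ : ℤ => stepLaw q) (meets F₁ x ∩ meets F₂ x) ≤
      ENNReal.ofReal (F₁.card * F₂.card * Real.exp (-(v ^ 2 * T / 2))) := by
  have := isProbabilityMeasure_stepLaw h0 h1
  set ν := Measure.infinitePi fun _ : ℤ => stepLaw q
  calc ∑' x, ν (meets F₁ x ∩ meets F₂ x)
      ≤ ∑' x, ∑ z ∈ F₁ ×ˢ F₂, ν (hit x z.1 ∩ hit x z.2) := by
        refine ENNReal.tsum_le_tsum fun x => (measure_mono ?_).trans (measure_biUnion_finset_le _ _)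
        rintro w ⟨hw, hw'⟩
        simp only [meets, Set.mem_iUnion] at hw hw'
        obtain ⟨p, hp, hw⟩ := hw
        obtain ⟨p', hp', hw'⟩ := hw'
        exact Set.mem_biUnion (x := (p, p')) (Finset.mem_coe.2 (Finset.mk_mem_product hp hp')) ⟨hw, hw'⟩
    _ = ∑ z ∈ F₁ ×ˢ F₂, ∑' x, ν (hit x z.1 ∩ hit x z.2) :=
        Summable.tsum_finsetSum fun _ _ => ENNReal.summable
    _ ≤ ∑ z ∈ F₁ ×ˢ F₂, ENNReal.ofReal (Real.exp (-(v ^ 2 * T / 2))) := by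
        refine Finset.sum_le_sum fun z hz => ?_
        obtain ⟨h3, h4, h5⟩ := hF z.1 (Finset.mem_product.1 hz).1 z.2 (Finset.mem_product.1 hz).2
        -- For fixed points of the two sets, the events for different starting sites are disjoint,
        -- and each forces the same displacement between the two times. The sum over all sites thus
        -- costs no more than one large deviation probability.
        rw [← measure_iUnion]
        · refine (measure_mono ?_).trans (disp_far_le h0 h1 hT hv h3 h4 h5)
          intro w hw
          obtain ⟨x, hx, hx'⟩ := Set.mem_iUnion.1 hw
          simp only [hit, Set.mem_ofPred_eq] at hx hx' ⊢
          omega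
        · intro x x' hxx
          refine Set.disjoint_left.2 fun w hw hw' => hxx ?_
          have e1 := hw.1
          have e2 := hw'.1
          simp only [hit, Set.mem_ofPred_eq] at e1 e2
          omega
        · exact fun x => (measurableSet_hit x _).inter (measurableSet_hit x _)
    _ = ENNReal.ofReal (F₁.card * F₂.card * Real.exp (-(v ^ 2 * T / 2))) := by
        rw [Finset.sum_const, Finset.card_product, nsmul_eq_mul, ENNReal.ofReal_mul (by positivity),
          ← Nat.cast_mul, ENNReal.ofReal_natCast]

/-- Particles visiting both sets are the only link between them. Without such particles the arrows
agree with those of the independent fields, and the expected number of such particles bounds the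
error. -/
theorem cloudArrows_decouple {q : ℝ} (h0 : 0 < q) (h1 : q < 1) (r : ℝ≥0) (pb pw : ℝ) {T : ℕ} (hT : 1 ≤ T)
    {v : ℝ} (hv : 0 < v) {m : ℤ} {F₁ F₂ : Finset (ℤ × ℤ)} (hm1 : ∀ p ∈ F₁, p.1 ≤ m) (hm2 : ∀ p ∈ F₂, m < p.1)
    (hF : ∀ p ∈ F₁, ∀ p' ∈ F₂, p'.2 - p.2 ≤ T ∧ p.2 - p'.2 ≤ T ∧ v * T ≤ ((p'.1 - p.1 : ℤ) : ℝ))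
    {S₁ S₂ : Set (ℤ × ℤ → Bool)} (hS₁ : DependsOn (· ∈ S₁) (F₁ : Set (ℤ × ℤ)))
    (hS₂ : DependsOn (· ∈ S₂) (F₂ : Set (ℤ × ℤ)))
    {P : Measure (((ℤ → ℕ) × (ℤ × ℕ → ℤ → ℤ)) × (ℤ × ℤ → unitInterval))}
    (hP : P = (markedLaw (Measure.infinitePi fun _ : ℤ => stepLaw q) r).prod
      (Measure.infinitePi fun _ : ℤ × ℤ => (volume : Measure unitInterval))) :
    P (cloudArrows pb pw ⁻¹' S₁ ∩ cloudArrows pb pw ⁻¹' S₂) ≤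
      P (cloudArrows pb pw ⁻¹' S₁) * P (cloudArrows pb pw ⁻¹' S₂) +
      4 * (r * ENNReal.ofReal (F₁.card * F₂.card * Real.exp (-(v ^ 2 * T / 2)))) := by
  have := isProbabilityMeasure_stepLaw h0 h1
  set ν := Measure.infinitePi fun _ : ℤ => stepLaw q
  have : IsProbabilityMeasure P := by rw [hP]; infer_instance
  set bad : Set (((ℤ → ℕ) × (ℤ × ℕ → ℤ → ℤ)) × (ℤ × ℤ → unitInterval)) :=
    Prod.fst ⁻¹' (void fun x => meets F₁ x ∩ meets F₂ x)ᶜ with hbad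
  have hmeets : ∀ x, MeasurableSet (meets F₁ x ∩ meets F₂ x) := fun x =>
    (measurableSet_meets F₁ x).inter (measurableSet_meets F₂ x)
  have hPbad : P bad ≤ r * ENNReal.ofReal (F₁.card * F₂.card * Real.exp (-(v ^ 2 * T / 2))) := by
    rw [hP, hbad, measurePreserving_fst.measure_preimage (measurableSet_void hmeets).compl.nullMeasurableSet]
    refine (markedLaw_void_compl_le ν r hmeets).trans ?_
    gcongr
    exact tsum_meets_le h0 h1 hT hv hF
  have ha1 : ∀ ω ∉ bad, ∀ p ∈ F₁,
      cloudArrows pb pw ω p = coinArrow pb pw ω.2 (present (hitOnly F₁ F₂) ω.1) p := fun ω hω p hp =>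
    coinArrow_congr rfl (present_hit_eq (not_not.1 hω) hp)
  have ha2 : ∀ ω ∉ bad, ∀ p ∈ F₂,
      cloudArrows pb pw ω p = coinArrow pb pw ω.2 (present (hitOnly F₂ F₁) ω.1) p := fun ω hω p hp =>
    coinArrow_congr rfl (present_hit_eq (by simpa only [Set.inter_comm] using not_not.1 hω) hp)
  refine measure_inter_le_of_approx
    (A₁' := {ω | coinArrow pb pw ω.2 (present (hitOnly F₁ F₂) ω.1) ∈ S₁})
    (A₂' := {ω | coinArrow pb pw ω.2 (present (hitOnly F₂ F₁) ω.1) ∈ S₂}) hPbad ?_ ?_ ?_ ?_ ?_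
  · intro ω hω
    by_contra hc
    rw [Set.mem_union, not_or] at hc
    exact hc.1 ((mem_iff_of_dependsOn hS₁ (ha1 ω hc.2)).1 hω)
  · intro ω hω
    by_contra hc
    rw [Set.mem_union, not_or] at hc
    exact hc.1 ((mem_iff_of_dependsOn hS₁ (ha1 ω hc.2)).2 hω)
  · intro ω hω
    by_contra hc
    rw [Set.mem_union, not_or] at hc
    exact hc.1 ((mem_iff_of_dependsOn hS₂ (ha2 ω hc.2)).1 hω)
  · intro ω hω
    by_contra hc
    rw [Set.mem_union, not_or] at hc
    exact hc.1 ((mem_iff_of_dependsOn hS₂ (ha2 ω hc.2)).2 hω)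
  · rw [hP]
    exact (hitOnly_independent ν r pb pw hm1 hm2 hS₁ hS₂).le

/-- The particles and their walks, from a sample of the Poisson cloud. -/
def toMarked (ω : PCRWSample × (ℤ × ℤ → unitInterval)) :
    ((ℤ → ℕ) × (ℤ × ℕ → ℤ → ℤ)) × (ℤ × ℤ → unitInterval) :=
  ((ω.1.1, fun e j => ω.1.2 (e.1, e.2, j)), ω.2)

theorem measurePreserving_toMarked (ρ : ℝ) {q : ℝ} (h0 : 0 < q) (h1 : q < 1) :
    MeasurePreserving toMarked (annealed (pcrw ρ q))
      ((markedLaw (Measure.infinitePi fun _ : ℤ => stepLaw q) (-Real.log (1 - ρ)).toNNReal).prod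
        (Measure.infinitePi fun _ : ℤ × ℤ => (volume : Measure unitInterval))) := by
  have := isProbabilityMeasure_stepLaw h0 h1
  exact ((MeasurePreserving.id _).prod (measurePreserving_curry_triple (stepLaw q))).prod (MeasurePreserving.id _)

theorem envArrows_pcrw (ρ q pb pw : ℝ) (ω : PCRWSample × (ℤ × ℤ → unitInterval)) :
    envArrows (pcrw ρ q) pb pw ω = cloudArrows pb pw (toMarked ω) := by
  funext p
  refine arrows_eq_coinArrow ?_
  rw [← not_iff_not, Bool.not_eq_true, present_eq_false_iff]
  change ¬ 0 < pcrwField ω.1 p.2 p.1 ↔ _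
  simp only [pcrwField, Set.encard_pos, Set.not_nonempty_iff_eq_empty, Set.eq_empty_iff_forall_notMem,
    Set.mem_ofPred_eq, not_and, void, siteVoid, Set.mem_iInter, hit, toMarked, Prod.forall, particle,
    Int.floor_intCast, disp, add_sub_assoc]

theorem decoupled_pcrw (ρ : ℝ) {q : ℝ} (h0 : 0 < q) (h1 : q < 1) (pb pw : ℝ) :
    Decoupled (annealed (pcrw ρ q)) (envArrows (pcrw ρ q) pb pw) := by
  refine decoupled_of_left fun v hv => ?_
  set r := (-Real.log (1 - ρ)).toNNReal with hr
  set c := v ^ 2 / 8 with hc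
  have hc0 : 0 < c := by positivity
  refine ⟨36 * (r + 1) * (2 / c ^ 2) ^ 2, by positivity, 2 * c, by positivity, ?_⟩
  intro n T x₁ x₂ t t₁ t₂ hn hnT ht1 ht1' ht2 ht2' hx S₁ S₂ hS₁ hS₂
  have hT : 1 ≤ T := hn.trans hnT
  have hT0 : (1 : ℝ) ≤ T := by exact_mod_cast hT
  have hvT : 0 < v * T := by positivity
  have hpres := measurePreserving_toMarked ρ h0 h1
  have hS₁' : DependsOn (· ∈ S₁) ((boxF x₁ t₁ n : Finset (ℤ × ℤ)) : Set (ℤ × ℤ)) :=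
    fun a a' h => hS₁ fun p hp => h p (mem_boxF.2 hp)
  have hS₂' : DependsOn (· ∈ S₂) ((boxF x₂ t₂ n : Finset (ℤ × ℤ)) : Set (ℤ × ℤ)) :=
    fun a a' h => hS₂ fun p hp => h p (mem_boxF.2 hp)
  have hcm : Measurable (cloudArrows pb pw) := measurable_pi_iff.2 fun p =>
    measurable_coinArrow pb pw (by fun_prop)
      (((measurable_pi_apply p).comp (measurable_present measurableSet_hit)).comp measurable_fst)
  have hpre : ∀ S, MeasurableSet S → annealed (pcrw ρ q) (envArrows (pcrw ρ q) pb pw ⁻¹' S) =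
      ((markedLaw (Measure.infinitePi fun _ : ℤ => stepLaw q) r).prod
        (Measure.infinitePi fun _ : ℤ × ℤ => (volume : Measure unitInterval))) (cloudArrows pb pw ⁻¹' S) := by
    intro S hS
    refine Eq.trans (congrArg _ ?_) (hpres.measure_preimage (hcm hS).nullMeasurableSet)
    ext ω
    exact Eq.to_iff (congrArg (· ∈ S) (envArrows_pcrw ρ q pb pw ω))
  have m1 := measurableSet_of_dependsOn (finite_box x₁ t₁ n) hS₁
  have m2 := measurableSet_of_dependsOn (finite_box x₂ t₂ n) hS₂
  have hgap : (x₁ : ℝ) + 3 * n < x₂ := by linarith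
  have hgap' : x₁ + 3 * n < x₂ := by exact_mod_cast hgap
  rw [← Set.preimage_inter, hpre _ (m1.inter m2), hpre _ m1, hpre _ m2, Set.preimage_inter]
  refine (cloudArrows_decouple h0 h1 r pb pw hT hv (m := x₁ + 3 * n) (fun p hp => ?_) (fun p hp => ?_)
    (fun p hp p' hp' => ?_) hS₁' hS₂' rfl).trans ?_
  · have := (mem_boxF.1 hp).1.2
    omega
  · have := (mem_boxF.1 hp).1.1
    omega
  · obtain ⟨⟨h3, h4⟩, h5, h6⟩ := mem_boxF.1 hp
    obtain ⟨⟨h3', h4'⟩, h5', h6'⟩ := mem_boxF.1 hp'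
    refine ⟨by omega, by omega, ?_⟩
    have e1 : (x₂ : ℝ) ≤ p'.1 := by exact_mod_cast h3'
    have e2 : (p.1 : ℝ) < x₁ + 3 * n := by exact_mod_cast h4
    push_cast
    linarith
  · gcongr
    rw [show (4 : ℝ≥0∞) = ENNReal.ofReal 4 by simp, ← ENNReal.ofReal_coe_nnreal,
      ← ENNReal.ofReal_mul (by positivity), ← ENNReal.ofReal_mul (by norm_num)]
    refine ENNReal.ofReal_le_ofReal ?_
    rw [card_boxF, card_boxF]
    have hsq := sq_mul_exp_neg_le hc0 (x := n) (by positivity)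
    have hnT' : (n : ℝ) ≤ T := by exact_mod_cast hnT
    -- As `v² / 2 = 4 c`, half of the exponent absorbs the factor `n⁴` from pairs of points in the
    -- boxes, and the other half is the claimed rate `2 c`.
    have hexp : Real.exp (-(v ^ 2 * T / 2)) ≤ Real.exp (-(c * n)) ^ 2 * Real.exp (-(2 * c) * n) := by
      rw [← Real.exp_nat_mul, ← Real.exp_add]
      refine Real.exp_le_exp.2 ?_
      have : v ^ 2 * n ≤ v ^ 2 * T := by gcongr
      rw [hc]
      push_cast
      linarith
    calc 4 * ((r : ℝ) * (((3 * n * n : ℕ) : ℝ) * ((3 * n * n : ℕ) : ℝ) * Real.exp (-(v ^ 2 * T / 2))))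
        ≤ 4 * ((r + 1 : ℝ) * (((3 * n * n : ℕ) : ℝ) * ((3 * n * n : ℕ) : ℝ) *
          (Real.exp (-(c * n)) ^ 2 * Real.exp (-(2 * c) * n)))) := by
          gcongr
          linarith
      _ = 36 * (r + 1) * ((n : ℝ) ^ 2 * Real.exp (-(c * n))) ^ 2 * Real.exp (-(2 * c) * n) := by
          push_cast
          ring
      _ ≤ 36 * (r + 1) * (2 / c ^ 2) ^ 2 * Real.exp (-(2 * c) * n) := by gcongr

end DynRW

end

theorem lemma3p2 (M : DynRW.EnvModel) (ρ : ℝ) (hρ0 : 0 < ρ) (hρ1 : ρ < 1)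
    (pb pw : ℝ) (hpw : 0 < pw) (hpwb : pw ≤ pb) (hpb : pb < 1) (ε : ℝ) (hε : 0 < ε) :
    ∃ c : ℝ, 0 < c ∧ ∀ H : ℝ, 1 ≤ H →
      DynRW.fastProb (M.env ρ) pb pw H (max (DynRW.upperSpeed (M.env ρ) pb pw) 0 + ε)
        ≤ ENNReal.ofReal (c * Real.exp (-2 * (Real.log H) ^ (3 / 2 : ℝ))) ∧
      DynRW.slowProb (M.env ρ) pb pw H (min (DynRW.lowerSpeed (M.env ρ) pb pw) 0 - ε)
        ≤ ENNReal.ofReal (c * Real.exp (-2 * (Real.log H) ^ (3 / 2 : ℝ))) := by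
  have := DynRW.isProbabilityMeasure_annealed M hρ0 hρ1
  refine DynRW.deviation_bounds_of_decoupled (M.env ρ) pb pw ?_ hε
  cases M with
  | exclusion γ hγ => exact DynRW.decoupled_ssep hρ0 hρ1 hγ pb pw
  | cloud q hq0 hq1 => exact DynRW.decoupled_pcrw ρ hq0 hq1 pb pw
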